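/- Let $\mathbb F$ be a field of characteristic $0$ and $n\ge 0$ an integer. For a commutative ring $R$ let $\mathbf W_R$ be the Lie algebra over $R$ spanned by the $x^\alpha\partial$ with $\alpha\in\mathbb Z^n$, $\partial=\sum_i a_i\partial_i$ ($a_i\in R$, $\partial_i=x_i\,\partial/\partial x_i$), with bracket $[x^\alpha\partial,x^\beta\partial']=x^{\alpha+\beta}(\partial(\beta)\partial'-\partial'(\alpha)\partial)$, where $\partial(\beta)=\sum_i a_i\beta_i$. Let $\mathbf S^+_R\subset\mathbf W_R$ be the Lie subalgebra of divergence-free polynomial vector fields, i.e. $\mathbf S^+_R=\mathrm{Ker}(\mathrm{Div})\cap\mathrm{Span}_R\{x^\alpha D_i\mid \alpha\in\mathbb Z_{\ge0}^n\}$ with $D_i=\partial/\partial x_i=x_i^{-1}\partial_i$ and $\mathrm{Div}(\sum_i f_iD_i)=\sum_i D_i(f_i)$. Let $(\Delta_0,S_0,\varepsilon_0)$ be the standard Hopf structure of an enveloping algebra, and let $A[[t]]\,\widehat\otimes\,A[[t]]=(A\otimes A)[[t]]$. Write $x_a^{\langle m\rangle}=\prod_{j=0}^{m-1}(x+a+j)$,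 $x^{\langle m\rangle}=x_0^{\langle m\rangle}$, $x^{[m]}=\prod_{j=0}^{m-1}(x-j)$, and let $\epsilon_i$ be the standard basis of $\mathbb Z^n$. For $1\le k\ne k'\le n$ put $h=\partial_k-\partial_{k'}$, $e=x^{\epsilon_k}(\partial_k-2\partial_{k'})$ (elements of $\mathbf S^+_{\mathbb Z}$), $\rho=h\otimes e-e\otimes h$, and $$\mathcal F(k,k')=\sum_{r\ge0}\frac{(-1)^r}{r!}\,h^{[r]}\otimes e^r\,t^r\in \bigl(U(\mathbf S^+_{\mathbb F})\otimes U(\mathbf S^+_{\mathbb F})\bigr)[[t]].$$ (1) $\mathcal F=\mathcal F(k,k')$ is a Drinfel'd twist: it is invertible, $(\mathcal F\otimes1)(\Delta_0\otimes\mathrm{Id})(\mathcal F)=(1\otimes\mathcal F)(\mathrm{Id}\otimes\Delta_0)(\mathcal F)$ and $(\varepsilon_0\otimes\mathrm{Id})(\mathcal F)=1=(\mathrm{Id}\otimes\varepsilon_0)(\mathcal F)$. (2) There is exactly one topological Hopf algebra structure $(\Delta,S,\varepsilon)$ over $\mathbb Z[[t]]$ on $U(\mathbf S^+_{\mathbb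 Z})[[t]]$, with undeformed product and unit, with the following two properties. (a) It is an integral form of the quantization by $\mathcal F$: after mapping coefficients to $\mathbb F$ one has $\Delta(x)=\mathcal F\Delta_0(x)\mathcal F^{-1}$ and $S(x)=w\,S_0(x)\,w^{-1}$, where $w=m(\mathrm{Id}\otimes S_0)(\mathcal F)$ is invertible; moreover $\varepsilon=\varepsilon_0$; modulo $t$ the structure is the standard Hopf algebra $U(\mathbf S^+_{\mathbb Z})$; and $\mathcal F$ and $\Delta$ are governed by the $r$-matrix $\rho$: $\mathcal F\equiv1 \pmod t$, $\mathcal F_{21}-\mathcal F\equiv\rho\,t \pmod{t^2}$ and $\Delta(a)-\Delta^{\mathrm{op}}(a)\equiv[\Delta_0(a),\rho]\,t \pmod{t^2}$ for $a\in U(\mathbf S^+_{\mathbb Z})$. (b) For every $x^\alpha\partial\in\mathbf S^+_{\mathbb Z}$, put $A_\ell=\frac1{\ell!}\prod_{j=0}^{\ell-1}(\alpha_k-2\alpha_{k'}+j)$ and $B_\ell=\partial(\epsilon_k)A_{\ell-1}$ (with $A_0=1$, $A_{-1}=0$). Then $A_\ell,B_\ell\in\mathbb Z$, the elements $x^{\alpha+\ell\epsilon_k}(A_\ell\partial-B_\ell(\partial_k-2\partial_{k'}))$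 lie in $\mathbf S^+_{\mathbb Z}$ for all $\ell\ge0$, and $$\Delta(x^\alpha\partial)=x^\alpha\partial\otimes(1-et)^{\alpha_k-\alpha_{k'}}+\sum_{\ell\ge0}(-1)^\ell\, h^{\langle\ell\rangle}\otimes(1-et)^{-\ell}\cdot x^{\alpha+\ell\epsilon_k}\bigl(A_\ell\partial-B_\ell(\partial_k-2\partial_{k'})\bigr)t^\ell,$$ $$S(x^\alpha\partial)=-(1-et)^{-(\alpha_k-\alpha_{k'})}\cdot\Bigl(\sum_{\ell\ge0}x^{\alpha+\ell\epsilon_k}\bigl(A_\ell\partial-B_\ell(\partial_k-2\partial_{k'})\bigr)\cdot h_1^{\langle\ell\rangle}t^\ell\Bigr),\qquad \varepsilon(x^\alpha\partial)=0.$$ (3) There are exactly $n(n-1)$ different basic twists $\mathcal F(k,k')$ $(k\ne k')$, and exactly $n(n-1)$ different Hopf structures on $U(\mathbf S^+_{\mathbb Z})[[t]]$ arising from them as in (2). -/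

import Mathlib

open scoped TensorProduct PowerSeries

noncomputable section

/-! ### The Lie algebra of generalized Witt type and its special subalgebra -/

/-- `W = R[x₁^{±1}, …, xₙ^{±1}] ⊗ T` with `T = ⊕ R ∂ᵢ`, `∂ᵢ = xᵢ ∂/∂xᵢ`; the function `f` stands for
`∑_α x^α ∂` with `∂ = ∑ᵢ f α i ∂ᵢ`. -/
def Witt (R : Type*) [CommRing R] (n : ℕ) : Type _ := (Fin n → ℤ) →₀ (Fin n → R)

namespace Witt

variable {R : Type*} [CommRing R] {n : ℕ}

instance : AddCommGroup (Witt R n) := inferInstanceAs (AddCommGroup ((Fin n → ℤ) →₀ (Fin n → R)))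

instance : Module R (Witt R n) := inferInstanceAs (Module R ((Fin n → ℤ) →₀ (Fin n → R)))

/-- The coefficient in `T` of `x^α`. -/
def comp (α : Fin n → ℤ) : Witt R n →ₗ[R] (Fin n → R) :=
  Finsupp.lapply (M := Fin n → R) (R := R) α

/-- The element `x^α ∂` with `∂ = ∑ᵢ aᵢ ∂ᵢ`. -/
def mono (α : Fin n → ℤ) : (Fin n → R) →ₗ[R] Witt R n :=
  Finsupp.lsingle (M := Fin n → R) (R := R) α

/-- `⟨∂, β⟩ = ∂(β) = ∑ᵢ aᵢ βᵢ` for `∂ = ∑ᵢ aᵢ ∂ᵢ`. -/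
def pair (a : Fin n → R) (β : Fin n → ℤ) : R := ∑ i, a i * (β i : R)

/-- `[x^α ∂, x^β ∂'] = x^{α+β} (∂(β) ∂' - ∂'(α) ∂)` on homogeneous elements. -/
def monoBracket (α β : Fin n → ℤ) : (Fin n → R) →ₗ[R] (Fin n → R) →ₗ[R] Witt R n :=
  LinearMap.mk₂ R (fun a b => mono (α + β) (pair a β • b - pair b α • a))
    (fun a a' b => by
      rw [← map_add]; congr 1; ext i
      simp only [pair, Pi.add_apply, Pi.sub_apply, Pi.smul_apply, smul_eq_mul, add_mul,
        Finset.sum_add_distrib]; ring)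
    (fun c a b => by
      rw [← map_smul]; congr 1; ext i
      simp only [pair, Pi.sub_apply, Pi.smul_apply, smul_eq_mul, mul_assoc, ← Finset.mul_sum]
      ring)
    (fun a b b' => by
      rw [← map_add]; congr 1; ext i
      simp only [pair, Pi.add_apply, Pi.sub_apply, Pi.smul_apply, smul_eq_mul, add_mul,
        Finset.sum_add_distrib]; ring)
    (fun c a b => by
      rw [← map_smul]; congr 1; ext i
      simp only [pair, Pi.sub_apply, Pi.smul_apply, smul_eq_mul, mul_assoc, ← Finset.mul_sum]
      ring)

/-- The bracket of `W`, extended bilinearly. -/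
def bracket : Witt R n →ₗ[R] Witt R n →ₗ[R] Witt R n :=
  Finsupp.lsum (M := Fin n → R) R fun α =>
    (Finsupp.lsum (M := Fin n → R) R (fun β => (monoBracket α β).flip)).flip

theorem bracket_mono (α β : Fin n → ℤ) (a b : Fin n → R) :
    bracket (mono α a) (mono β b) = mono (α + β) (pair a β • b - pair b α • a) := by
  unfold bracket mono
  erw [Finsupp.lsum_single]
  change (Finsupp.lsum (M := Fin n → R) R fun β => (monoBracket α β).flip)
    (Finsupp.single β b) a = _
  erw [Finsupp.lsum_single]
  rfl

theorem induction {p : Witt R n → Prop} (f : Witt R n) (h0 : p 0)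
    (hadd : ∀ f g, p f → p g → p (f + g)) (hs : ∀ α a, p (mono α a)) : p f :=
  Finsupp.induction_linear f h0 hadd hs

theorem bracket_skew (f g : Witt R n) : bracket f g = - bracket g f := by
  induction f using Witt.induction with
  | h0 => simp
  | hadd f f' h h' => rw [map_add, LinearMap.add_apply, h, h', map_add, neg_add]
  | hs α a =>
    induction g using Witt.induction with
    | h0 => simp
    | hadd f f' h h' => rw [map_add, h, h', map_add, LinearMap.add_apply, neg_add]
    | hs β b => rw [bracket_mono, bracket_mono, ← map_neg, add_comm, neg_sub]

theorem bracket_self (f : Witt R n) : bracket f f = 0 := by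
  induction f using Witt.induction with
  | h0 => simp
  | hadd f g h h' =>
    simp only [map_add, LinearMap.add_apply, h, h', zero_add, add_zero]
    rw [bracket_skew]; simp
  | hs α a => rw [bracket_mono]; simp

theorem pair_sub_smul (a b : Fin n → R) (c d : R) (β : Fin n → ℤ) :
    pair (c • a - d • b) β = c * pair a β - d * pair b β := by
  simp only [pair, Pi.sub_apply, Pi.smul_apply, smul_eq_mul, sub_mul, mul_assoc,
    Finset.sum_sub_distrib, ← Finset.mul_sum]

theorem pair_add (a : Fin n → R) (β γ : Fin n → ℤ) : pair a (β + γ) = pair a β + pair a γ := by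
  simp [pair, mul_add, Finset.sum_add_distrib]

theorem bracket_jacobi (f g k : Witt R n) :
    bracket f (bracket g k) = bracket (bracket f g) k + bracket g (bracket f k) := by
  induction f using Witt.induction with
  | h0 => simp
  | hadd f f' h h' => simp only [map_add, LinearMap.add_apply, h, h']; abel
  | hs α a =>
  induction g using Witt.induction with
  | h0 => simp
  | hadd f f' h h' => simp only [map_add, LinearMap.add_apply, h, h']; abel
  | hs β b =>
  induction k using Witt.induction with
  | h0 => simp
  | hadd f f' h h' => simp only [map_add, h, h']; abel
  | hs γ c =>
    simp only [bracket_mono]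
    rw [show β + (α + γ) = α + (β + γ) by abel, show α + β + γ = α + (β + γ) by abel, ← map_add]
    congr 1
    ext i
    simp only [pair_sub_smul, pair_add, Pi.add_apply, Pi.sub_apply, Pi.smul_apply, smul_eq_mul]
    ring

instance : LieRing (Witt R n) where
  bracket f g := bracket f g
  add_lie f g k := by simp
  lie_add f g k := by simp
  lie_self f := bracket_self f
  leibniz_lie f g k := bracket_jacobi f g k

instance : LieAlgebra R (Witt R n) where
  lie_smul c f g := by simp [Bracket.bracket]

theorem lie_mono (α β : Fin n → ℤ) (a b : Fin n → R) :
    ⁅mono α a, mono β b⁆ = mono (α + β) (pair a β • b - pair b α • a) := bracket_mono α β a b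

/-- The divergence `Div (∑ aᵢ Dᵢ) = ∑ Dᵢ(aᵢ)`, `Dᵢ = ∂/∂xᵢ`, coefficient of `x^α`: as
`x^α ∂ᵢ = x^{α + εᵢ} Dᵢ`, one has `Div (x^α ∂ᵢ) = (αᵢ + 1) x^α`. -/
def divCoeff (f : Witt R n) (α : Fin n → ℤ) : R := ∑ i, comp α f i * ((α i : R) + 1)

/-- `f` lies in `W⁺ = Span {x^α Dᵢ | α ∈ ℤ₊ⁿ}`: if `x^α ∂ᵢ = x^{α + εᵢ} Dᵢ` occurs in `f` then
`α + εᵢ` is nonnegative. -/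
def IsPositive (f : Witt R n) : Prop :=
  ∀ α i, comp α f i ≠ 0 → 0 ≤ α + Pi.single i 1


theorem comp_mono (α β : Fin n → ℤ) (a : Fin n → R) :
    comp β (mono α a) = if α = β then a else 0 := by
  change (Finsupp.single α a) β = _
  rw [Finsupp.single_apply]

/-- A homogeneous element `x^α ∂` is admissible if it lies in `W⁺` and has divergence zero. -/
def Adm (α : Fin n → ℤ) (a : Fin n → R) : Prop :=
  (∀ i, a i ≠ 0 → 0 ≤ α + Pi.single i 1) ∧ ∑ i, a i * ((α i : R) + 1) = 0

theorem Adm.zero (α : Fin n → ℤ) : Adm α (0 : Fin n → R) := ⟨by simp, by simp⟩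

theorem Adm.add {α : Fin n → ℤ} {a b : Fin n → R} (ha : Adm α a) (hb : Adm α b) :
    Adm α (a + b) := by
  refine ⟨fun i hi => ?_, by simp [add_mul, Finset.sum_add_distrib, ha.2, hb.2]⟩
  by_cases h : a i = 0
  · exact hb.1 i fun h' => hi (by simp [h, h'])
  · exact ha.1 i h

theorem Adm.smul {α : Fin n → ℤ} {a : Fin n → R} (c : R) (ha : Adm α a) : Adm α (c • a) := by
  refine ⟨fun i hi => ha.1 i fun h => hi (by simp [h]), ?_⟩
  simp [mul_assoc, ← Finset.mul_sum, ha.2]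

theorem pair_eq_of_supp {a : Fin n → R} (l : Fin n) (h : ∀ i, i ≠ l → a i = 0)
    (β : Fin n → ℤ) : pair a β = a l * β l := by
  rw [pair, Finset.sum_eq_single l]
  · intro i _ hi; simp [h i hi]
  · simp

theorem Adm.bracket {α β : Fin n → ℤ} {a b : Fin n → R} (ha : Adm α a) (hb : Adm β b) :
    Adm (α + β) (pair a β • b - pair b α • a) := by
  constructor
  · intro i hi
    by_contra hneg
    apply hi
    simp only [Pi.le_def, not_forall, not_le] at hneg
    obtain ⟨l, hl⟩ := hneg
    have key : ∀ {α : Fin n → ℤ} {a : Fin n → R}, Adm α a →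
        a = 0 ∨ 0 ≤ α l ∨ (α l = -1 ∧ ∀ j, j ≠ l → a j = 0) := by
      intro α a h
      by_cases h0 : 0 ≤ α l
      · exact Or.inr (Or.inl h0)
      by_cases hz : a = 0
      · exact Or.inl hz
      have hs : ∀ j, j ≠ l → a j = 0 := by
        intro j hj
        by_contra hne
        have := h.1 j hne l
        simp [hj.symm] at this
        exact h0 this
      have hl0 : a l ≠ 0 := fun hl0 => hz (by
        ext j; by_cases hj : j = l
        · rw [hj, hl0]; rfl
        · exact hs j hj)
      have := h.1 l hl0 l
      simp at this
      exact Or.inr (Or.inr ⟨by omega, hs⟩)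
    simp only [Pi.add_apply, Pi.zero_apply, Pi.single_apply] at hl
    simp only [Pi.sub_apply, Pi.smul_apply, smul_eq_mul]
    rcases key ha with rfl | h1 | ⟨h1, h1'⟩
    · simp [pair]
    · rcases key hb with rfl | h2 | ⟨h2, h2'⟩
      · simp [pair]
      · split_ifs at hl <;> omega
      · split_ifs at hl with hli
        · omega
        · have hz : α l = 0 := by omega
          rw [pair_eq_of_supp l h2', hz, h2' i (fun h => hli h.symm)]
          simp
    · rcases key hb with rfl | h2 | ⟨h2, h2'⟩
      · simp [pair]
      · split_ifs at hl with hli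
        · omega
        · have hz : β l = 0 := by omega
          rw [pair_eq_of_supp l h1', hz, h1' i (fun h => hli h.symm)]
          simp
      · rw [pair_eq_of_supp l h1', pair_eq_of_supp l h2', h1, h2]
        by_cases hi : i = l
        · subst hi; ring
        · rw [h1' i hi, h2' i hi]; simp
  · have e : ∀ {α : Fin n → ℤ} {a : Fin n → R}, Adm α a → ∀ γ : Fin n → ℤ,
        ∑ i, a i * ((α i : R) + γ i + 1) = pair a γ := by
      intro α a h γ
      have : ∀ i, a i * ((α i : R) + γ i + 1) = a i * ((α i : R) + 1) + a i * γ i := fun i => by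
        ring
      simp only [this, Finset.sum_add_distrib, h.2, zero_add, pair]
    have e1 := e ha β
    have e2 := e hb α
    have : ∀ i, (pair a β • b - pair b α • a) i * (((α + β) i : ℤ) + 1 : R) =
        pair a β * (b i * ((β i : R) + α i + 1)) - pair b α * (a i * ((α i : R) + β i + 1)) := by
      intro i; simp; ring
    simp only [this, Finset.sum_sub_distrib, ← Finset.mul_sum, e1, e2]
    ring

theorem adm_iff (f : Witt R n) :
    (IsPositive f ∧ ∀ α, divCoeff f α = 0) ↔ ∀ α, Adm α (comp α f) :=
  ⟨fun h α => ⟨h.1 α, h.2 α⟩, fun h => ⟨fun α => (h α).1, fun α => (h α).2⟩⟩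

theorem adm_mono {α : Fin n → ℤ} {a : Fin n → R} (h : Adm α a) (β : Fin n → ℤ) :
    Adm β (comp β (mono α a)) := by
  rw [comp_mono]
  split_ifs with h'
  · exact h' ▸ h
  · exact Adm.zero β

theorem adm_lie {f g : Witt R n} (hf : ∀ α, Adm α (comp α f)) (hg : ∀ α, Adm α (comp α g)) :
    ∀ α, Adm α (comp α ⁅f, g⁆) := by
  have hsum : ∀ {ι : Type} (s : Finset ι) (F : ι → Witt R n),
      (∀ i ∈ s, ∀ α, Adm α (comp α (F i))) → ∀ α, Adm α (comp α (∑ i ∈ s, F i)) := by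
    intro ι s F h α
    rw [map_sum]
    exact Finset.sum_induction _ (Adm α) (fun _ _ => Adm.add) (Adm.zero α) fun i hi => h i hi α
  have hdec : ∀ f : Witt R n, f = ∑ α ∈ f.support, mono α (comp α f) := fun f =>
    (Finsupp.sum_single f).symm
  rw [hdec f, hdec g, sum_lie_sum]
  refine hsum _ _ fun α _ => hsum _ _ fun β _ => ?_
  rw [lie_mono]
  exact adm_mono ((hf α).bracket (hg β))

/-- The map `W_R → W_K` applying `R → K` to coefficients. -/
def map (R K : Type*) [CommRing R] [CommRing K] [Algebra R K] {n : ℕ} : Witt R n →+ Witt K n :=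
  Finsupp.mapRange.addMonoidHom (M := Fin n → R) (N := Fin n → K)
    ((algebraMap R K).toAddMonoidHom.compLeft (Fin n))

section Map

variable (R K : Type*) [CommRing R] [CommRing K] [Algebra R K] {n : ℕ}

theorem comp_map (f : Witt R n) (α : Fin n → ℤ) (i : Fin n) :
    comp α (map R K f) i = algebraMap R K (comp α f i) := rfl

theorem map_mono (α : Fin n → ℤ) (a : Fin n → R) :
    map R K (mono α a) = mono α (fun i => algebraMap R K (a i)) :=
  Finsupp.mapRange_single (hf := _root_.map_zero _)

theorem map_smul (c : R) (f : Witt R n) : map R K (c • f) = algebraMap R K c • map R K f :=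
  Finsupp.ext fun α => funext fun i => by
    change algebraMap R K (c * comp α f i) = algebraMap R K c * algebraMap R K (comp α f i)
    rw [map_mul]

theorem map_lie (f g : Witt R n) : map R K ⁅f, g⁆ = ⁅map R K f, map R K g⁆ := by
  induction f using Witt.induction with
  | h0 => simp
  | hadd f f' h h' => simp only [add_lie, map_add, h, h']
  | hs α a =>
  induction g using Witt.induction with
  | h0 => simp
  | hadd f f' h h' => simp only [lie_add, map_add, h, h']
  | hs β b =>
    rw [lie_mono, map_mono, map_mono, map_mono, lie_mono]
    congr 1
    ext i
    simp [pair]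

end Map

end Witt

/-- The Lie algebra `S⁺ = Ker(Div) ∩ W⁺` over `R`; for `R = ℤ` it is the `ℤ`-form. -/
def SPlus (R : Type*) [CommRing R] (n : ℕ) : LieSubalgebra R (Witt R n) where
  carrier := {f | f.IsPositive ∧ ∀ α, f.divCoeff α = 0}
  zero_mem' := (Witt.adm_iff _).2 fun α => by rw [map_zero]; exact Witt.Adm.zero α
  add_mem' hf hg := (Witt.adm_iff _).2 fun α => by
    rw [map_add]; exact ((Witt.adm_iff _).1 hf α).add ((Witt.adm_iff _).1 hg α)
  smul_mem' c _ hf := (Witt.adm_iff _).2 fun α => by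
    rw [map_smul]; exact ((Witt.adm_iff _).1 hf α).smul c
  lie_mem' hf hg := (Witt.adm_iff _).2
    (Witt.adm_lie ((Witt.adm_iff _).1 hf) ((Witt.adm_iff _).1 hg))

/-! ### The standard Hopf algebra structure of an enveloping algebra -/

section

attribute [local instance 100] LieRing.ofAssociativeRing
attribute [local instance 2000] Algebra.toModule

namespace UniversalEnvelopingAlgebra

variable (R : Type*) (L : Type*) [CommRing R] [LieRing L] [LieAlgebra R L]

/-- `Δ₀(x) = x ⊗ 1 + 1 ⊗ x` for `x ∈ L`. -/
def comul₀ : UniversalEnvelopingAlgebra R L →ₐ[R]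
    UniversalEnvelopingAlgebra R L ⊗[R] UniversalEnvelopingAlgebra R L :=
  lift R
    { toFun := fun x => ι R x ⊗ₜ[R] 1 + 1 ⊗ₜ[R] ι R x
      map_add' := fun x y => by simp only [map_add, TensorProduct.add_tmul, TensorProduct.tmul_add]; abel
      map_smul' := fun c x => by simp only [map_smul, TensorProduct.smul_tmul', TensorProduct.tmul_smul, smul_add, RingHom.id_apply]
      map_lie' := fun {x y} => by
        simp only [LieHom.map_lie, LieRing.of_associative_ring_bracket, add_mul, mul_add,
          Algebra.TensorProduct.tmul_mul_tmul, one_mul, mul_one, TensorProduct.sub_tmul,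
          TensorProduct.tmul_sub]
        abel }

/-- `ε₀(x) = 0` for `x ∈ L`. -/
def counit₀ : UniversalEnvelopingAlgebra R L →ₐ[R] R := lift R 0

/-- The antipode as an algebra map to the opposite algebra: `S₀(x) = -x` for `x ∈ L`. -/
def antipodeOp₀ : UniversalEnvelopingAlgebra R L →ₐ[R] (UniversalEnvelopingAlgebra R L)ᵐᵒᵖ :=
  lift R
    { toFun := fun x => MulOpposite.op (- ι R x)
      map_add' := fun x y => by simp only [map_add, neg_add, MulOpposite.op_add]
      map_smul' := fun c x => by simp only [map_smul, ← smul_neg, MulOpposite.op_smul, RingHom.id_apply]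
      map_lie' := fun {x y} => by
        simp only [LieHom.map_lie, LieRing.of_associative_ring_bracket, ← MulOpposite.op_mul,
          ← MulOpposite.op_sub]
        congr 1; noncomm_ring }

theorem comul₀_ι (x : L) : comul₀ R L (ι R x) = ι R x ⊗ₜ[R] 1 + 1 ⊗ₜ[R] ι R x :=
  lift_ι_apply R _ x

theorem counit₀_ι (x : L) : counit₀ R L (ι R x) = 0 := lift_ι_apply R _ x

theorem antipodeOp₀_ι (x : L) : antipodeOp₀ R L (ι R x) = MulOpposite.op (- ι R x) :=
  lift_ι_apply R _ x

theorem alg_ext {A : Type*} [Ring A] [Algebra R A]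
    {f g : UniversalEnvelopingAlgebra R L →ₐ[R] A} (h : ∀ x, f (ι R x) = g (ι R x)) : f = g :=
  hom_ext R (LieHom.ext h)

theorem comul₀_coassoc : (Algebra.TensorProduct.assoc R R R (UniversalEnvelopingAlgebra R L)
      (UniversalEnvelopingAlgebra R L) (UniversalEnvelopingAlgebra R L)).toAlgHom.comp
      ((Algebra.TensorProduct.map (comul₀ R L) (.id R _)).comp (comul₀ R L)) =
      (Algebra.TensorProduct.map (.id R _) (comul₀ R L)).comp (comul₀ R L) :=
  alg_ext R L fun x => by
    simp [comul₀_ι, TensorProduct.add_tmul, TensorProduct.tmul_add,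
      Algebra.TensorProduct.one_def, add_assoc, -ι_apply]

instance instBialgebra : Bialgebra R (UniversalEnvelopingAlgebra R L) :=
  Bialgebra.ofAlgHom (comul₀ R L) (counit₀ R L) (comul₀_coassoc R L)
    (alg_ext R L fun x => by simp [comul₀_ι, counit₀_ι, -ι_apply])
    (alg_ext R L fun x => by simp [comul₀_ι, counit₀_ι, -ι_apply])

/-- The antipode `S₀` as a linear map. -/
def antipode₀ : UniversalEnvelopingAlgebra R L →ₗ[R] UniversalEnvelopingAlgebra R L :=
  (MulOpposite.opLinearEquiv R).symm.toLinearMap ∘ₗ (antipodeOp₀ R L).toLinearMap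

theorem antipode₀_ι (x : L) : antipode₀ R L (ι R x) = - ι R x := by
  simp [antipode₀, antipodeOp₀_ι, -ι_apply]

theorem antipode₀_mul (a b : UniversalEnvelopingAlgebra R L) :
    antipode₀ R L (a * b) = antipode₀ R L b * antipode₀ R L a := by simp [antipode₀]

theorem antipode₀_one : antipode₀ R L 1 = 1 := by simp [antipode₀]

theorem induct {p : UniversalEnvelopingAlgebra R L → Prop} (h1 : p 1)
    (hadd : ∀ a b, p a → p b → p (a + b)) (hs : ∀ (c : R) a, p a → p (c • a))
    (hι : ∀ x a, p a → p (ι R x * a)) (a) : p a := by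
  obtain ⟨a, rfl⟩ := RingCon.mk'_surjective (c := ringCon R L) a
  have key : ∀ a : TensorAlgebra R L, ∀ b, p b → p (mkAlgHom R L a * b) := by
    intro a
    induction a using TensorAlgebra.induction with
    | algebraMap r => intro b hb; rw [AlgHom.commutes, ← Algebra.smul_def]; exact hs r b hb
    | ι x => exact hι x
    | mul a b ha hb => intro c hc; rw [map_mul, mul_assoc]; exact ha _ (hb _ hc)
    | add a b ha hb => intro c hc; rw [map_add, add_mul]; exact hadd _ _ (ha _ hc) (hb _ hc)
  have := key a 1 h1
  rwa [mul_one] at this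

theorem mul_antipode₀_left (a : UniversalEnvelopingAlgebra R L) :
    LinearMap.mul' R _ ((antipode₀ R L).rTensor _ (comul₀ R L a)) =
      algebraMap R _ (counit₀ R L a) := by
  induction a using induct with
  | h1 => simp [Algebra.TensorProduct.one_def, antipode₀_one]
  | hadd a b ha hb => simp only [map_add, ha, hb]
  | hs c a ha => rw [map_smul, map_smul, map_smul, ha, map_smul, smul_eq_mul, map_mul,
      Algebra.smul_def]
  | hι x a _ =>
    rw [map_mul (comul₀ R L), map_mul (counit₀ R L), comul₀_ι, counit₀_ι, zero_mul, map_zero]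
    induction comul₀ R L a with
    | zero => simp
    | add u v hu hv => rw [mul_add, map_add, map_add, hu, hv, add_zero]
    | tmul b c =>
      simp [add_mul, antipode₀_mul, antipode₀_ι, mul_assoc, -ι_apply]

theorem mul_antipode₀_right (a : UniversalEnvelopingAlgebra R L) :
    LinearMap.mul' R _ ((antipode₀ R L).lTensor _ (comul₀ R L a)) =
      algebraMap R _ (counit₀ R L a) := by
  induction a using induct with
  | h1 => simp [Algebra.TensorProduct.one_def, antipode₀_one]
  | hadd a b ha hb => simp only [map_add, ha, hb]
  | hs c a ha => rw [map_smul, map_smul, map_smul, ha, map_smul, smul_eq_mul, map_mul,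
      Algebra.smul_def]
  | hι x a ha =>
    rw [map_mul (comul₀ R L), map_mul (counit₀ R L), comul₀_ι, counit₀_ι, zero_mul, map_zero]
    have key : ∀ z, LinearMap.mul' R _ ((antipode₀ R L).lTensor _
        ((ι R x ⊗ₜ[R] 1 + 1 ⊗ₜ[R] ι R x) * z)) =
        ι R x * LinearMap.mul' R _ ((antipode₀ R L).lTensor _ z) -
          LinearMap.mul' R _ ((antipode₀ R L).lTensor _ z) * ι R x := by
      intro z
      induction z with
      | zero => simp
      | add u v hu hv => rw [mul_add, map_add, map_add, hu, hv, map_add, map_add]; noncomm_ring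
      | tmul b c =>
        simp [add_mul, antipode₀_mul, antipode₀_ι, mul_assoc, sub_eq_add_neg, -ι_apply]
    rw [key, ha, Algebra.commutes, sub_self]

instance instHopf : HopfAlgebra R (UniversalEnvelopingAlgebra R L) where
  antipode := antipode₀ R L
  mul_antipode_rTensor_comul := LinearMap.ext (mul_antipode₀_left R L)
  mul_antipode_lTensor_comul := LinearMap.ext (mul_antipode₀_right R L)

end UniversalEnvelopingAlgebra

end

/-! ### Topologically free Hopf algebras `A⟦t⟧` over `R⟦t⟧`

The completed tensor product `A⟦t⟧ ⊗̂ A⟦t⟧` over `R⟦t⟧` is `(A ⊗ A)⟦t⟧`. -/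

namespace Topological

open PowerSeries

section Maps

variable {R A B A' B' : Type*} [CommRing R] [Ring A] [Algebra R A] [Ring B] [Algebra R B]
  [Ring A'] [Algebra R A'] [Ring B'] [Algebra R B']

/-- The structure map `R⟦t⟧ → A⟦t⟧`. -/
def scalar (R A : Type*) [CommRing R] [Ring A] [Algebra R A] : R⟦X⟧ →+* A⟦X⟧ :=
  PowerSeries.map (algebraMap R A)

/-- An `R`-linear map `A⟦t⟧ → B⟦t⟧` is `R⟦t⟧`-linear (hence `t`-adically continuous). -/
def IsLinear (f : A⟦X⟧ →ₗ[R] B⟦X⟧) : Prop :=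
  ∀ (c : R⟦X⟧) (x : A⟦X⟧), f (scalar R A c * x) = scalar R B c * f x

/-- The `R⟦t⟧`-linear map `A⟦t⟧ → B⟦t⟧` with `a ↦ ∑ₙ fₙ(a) tⁿ` on `A`. -/
def ofComponents (f : ℕ → A →ₗ[R] B) : A⟦X⟧ →ₗ[R] B⟦X⟧ where
  toFun x := PowerSeries.mk fun n =>
    ∑ p ∈ Finset.HasAntidiagonal.antidiagonal n, f p.1 (PowerSeries.coeff p.2 x)
  map_add' x y := by ext n; simp [Finset.sum_add_distrib]
  map_smul' c x := by
    ext n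
    simp [Finset.smul_sum]

/-- The coefficient maps `A → B` of the restriction to `A` of a map `A⟦t⟧ → B⟦t⟧`. -/
def component (f : A⟦X⟧ →ₗ[R] B⟦X⟧) (n : ℕ) : A →ₗ[R] B where
  toFun a := PowerSeries.coeff n (f (PowerSeries.C a))
  map_add' a b := by simp
  map_smul' c a := by
    have h : (PowerSeries.C (c • a) : A⟦X⟧) = c • PowerSeries.C a := by
      ext m
      change _ = c • PowerSeries.coeff m (PowerSeries.C a)
      simp only [PowerSeries.coeff_C]
      split_ifs <;> simp
    rw [h, map_smul]
    rfl

/-- The completed tensor product `f ⊗̂ g` of two `R⟦t⟧`-linear maps. -/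
def tensorMap (f : A⟦X⟧ →ₗ[R] B⟦X⟧) (g : A'⟦X⟧ →ₗ[R] B'⟦X⟧) :
    (A ⊗[R] A')⟦X⟧ →ₗ[R] (B ⊗[R] B')⟦X⟧ :=
  ofComponents fun n => ∑ p ∈ Finset.HasAntidiagonal.antidiagonal n,
    TensorProduct.map (component f p.1) (component g p.2)

/-- Coefficientwise extension `A⟦t⟧ → B⟦t⟧` of a linear map `A → B`. -/
def extend (f : A →ₗ[R] B) : A⟦X⟧ →ₗ[R] B⟦X⟧ where
  toFun x := PowerSeries.mk fun n => f (PowerSeries.coeff n x)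
  map_add' x y := by ext n; simp
  map_smul' c x := by
    ext n
    simp

/-- The element `x ⊗ y` of `A⟦t⟧ ⊗̂ A⟦t⟧ = (A ⊗ A)⟦t⟧`. -/
def tmul (R : Type*) {A : Type*} [CommRing R] [Ring A] [Algebra R A] (x y : A⟦X⟧) :
    (A ⊗[R] A)⟦X⟧ :=
  PowerSeries.map (Algebra.TensorProduct.includeLeft (R := R) (S := R) (B := A)).toRingHom x *
    PowerSeries.map (Algebra.TensorProduct.includeRight (R := R) (A := A)).toRingHom y

end Maps

section Elements

variable {A : Type*} [Ring A]

/-- The series `∑_ℓ f_ℓ t^ℓ` with `f_ℓ ∈ A⟦t⟧`. -/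
def series (f : ℕ → A⟦X⟧) : A⟦X⟧ :=
  PowerSeries.mk fun n => ∑ p ∈ Finset.HasAntidiagonal.antidiagonal n, PowerSeries.coeff p.2 (f p.1)

/-- `x_a^{⟨m⟩} = (x + a)(x + a + 1) ⋯ (x + a + m - 1)`. -/
def rising (x : A) (a : ℤ) : ℕ → A
  | 0 => 1
  | m + 1 => rising x a m * (x + (a : A) + (m : A))

/-- `x_a^{[m]} = (x + a)(x + a - 1) ⋯ (x + a - m + 1)`. -/
def falling (x : A) (a : ℤ) : ℕ → A
  | 0 => 1
  | m + 1 => falling x a m * (x + (a : A) - (m : A))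

/-- The invertible element `1 - e t` of `A⟦t⟧`, with inverse `∑ eʳ tʳ`. -/
def oneSub (e : A) : (A⟦X⟧)ˣ where
  val := 1 - PowerSeries.C e * PowerSeries.X
  inv := PowerSeries.mk fun r => e ^ r
  val_inv := by
    ext n
    rw [sub_mul, one_mul, mul_assoc, map_sub, PowerSeries.coeff_C_mul]
    cases n with
    | zero => simp
    | succ n => simp [PowerSeries.coeff_succ_X_mul, PowerSeries.coeff_one, pow_succ']
  inv_val := by
    ext n
    rw [mul_sub, mul_one, (PowerSeries.commute_X (PowerSeries.C e)).eq, ← mul_assoc, map_sub]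
    cases n with
    | zero => simp
    | succ n => simp [PowerSeries.coeff_succ_mul_X, PowerSeries.coeff_one, pow_succ]

/-- `(1 - e t)^m` for `m ∈ ℤ`. -/
def oneSubPow (e : A) (m : ℤ) : A⟦X⟧ := ((oneSub e ^ m : (A⟦X⟧)ˣ) : A⟦X⟧)

end Elements

/-- A topological Hopf algebra structure over `R⟦t⟧` on `A⟦t⟧` with the product and the unit of the
power series algebra. -/
@[ext]
structure HopfStructure (R A : Type*) [CommRing R] [Ring A] [Algebra R A] where
  comul : A⟦X⟧ →ₐ[R] (A ⊗[R] A)⟦X⟧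
  counit : A⟦X⟧ →ₐ[R] R⟦X⟧
  antipode : A⟦X⟧ →ₗ[R] A⟦X⟧
  comul_linear : IsLinear comul.toLinearMap
  counit_linear : IsLinear counit.toLinearMap
  antipode_linear : IsLinear antipode
  coassoc : ∀ x, PowerSeries.map (Algebra.TensorProduct.assoc R R R A A A).toRingEquiv.toRingHom
      (tensorMap comul.toLinearMap LinearMap.id (comul x)) =
    tensorMap LinearMap.id comul.toLinearMap (comul x)
  counit_left : ∀ x, PowerSeries.map (Algebra.TensorProduct.lid R A).toRingEquiv.toRingHom
      (tensorMap counit.toLinearMap LinearMap.id (comul x)) = x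
  counit_right : ∀ x, PowerSeries.map (Algebra.TensorProduct.rid R R A).toRingEquiv.toRingHom
      (tensorMap LinearMap.id counit.toLinearMap (comul x)) = x
  antipode_left : ∀ x, extend (LinearMap.mul' R A)
      (tensorMap antipode LinearMap.id (comul x)) = scalar R A (counit x)
  antipode_right : ∀ x, extend (LinearMap.mul' R A)
      (tensorMap LinearMap.id antipode (comul x)) = scalar R A (counit x)

section Twist

variable (R : Type*) {A : Type*} [CommRing R] [Ring A] [HopfAlgebra R A]

/-- `Δ₀` on `A⟦t⟧`, for a Hopf algebra `A`. -/
def comul₀ : A⟦X⟧ →+* (A ⊗[R] A)⟦X⟧ :=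
  PowerSeries.map (Bialgebra.comulAlgHom R A).toRingHom

/-- `ε₀` on `A⟦t⟧`. -/
def counit₀ : A⟦X⟧ →+* R⟦X⟧ := PowerSeries.map (Bialgebra.counitAlgHom R A).toRingHom

/-- `S₀` on `A⟦t⟧`. -/
def antipode₀ : A⟦X⟧ →ₗ[R] A⟦X⟧ := extend (HopfAlgebra.antipode R)

/-- `F ∈ (A ⊗ A)⟦t⟧` is a Drinfel'd twist on `A⟦t⟧`: it is invertible,
`(F ⊗ 1)(Δ₀ ⊗ Id)(F) = (1 ⊗ F)(Id ⊗ Δ₀)(F)` and `(ε₀ ⊗ Id)(F) = 1 = (Id ⊗ ε₀)(F)`. -/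
structure IsDrinfeldTwist (F : (A ⊗[R] A)⟦X⟧) : Prop where
  isUnit : IsUnit F
  cocycle :
    PowerSeries.map (Algebra.TensorProduct.assoc R R R A A A).toRingEquiv.toRingHom
      (PowerSeries.map
          (Algebra.TensorProduct.includeLeft (R := R) (S := R) (A := A ⊗[R] A) (B := A)).toRingHom F *
        PowerSeries.map (Algebra.TensorProduct.map (Bialgebra.comulAlgHom R A)
          (AlgHom.id R A)).toRingHom F) =
      PowerSeries.map
          (Algebra.TensorProduct.includeRight (R := R) (A := A) (B := A ⊗[R] A)).toRingHom F *
        PowerSeries.map (Algebra.TensorProduct.map (AlgHom.id R A)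
          (Bialgebra.comulAlgHom R A)).toRingHom F
  counit_left : PowerSeries.map (((Algebra.TensorProduct.lid R A).toAlgHom.comp
    (Algebra.TensorProduct.map (Bialgebra.counitAlgHom R A) (AlgHom.id R A))).toRingHom) F = 1
  counit_right : PowerSeries.map (((Algebra.TensorProduct.rid R R A).toAlgHom.comp
    (Algebra.TensorProduct.map (AlgHom.id R A) (Bialgebra.counitAlgHom R A))).toRingHom) F = 1

/-- `w = m (Id ⊗ S₀)(F)`. -/
def twistElement (F : (A ⊗[R] A)⟦X⟧) : A⟦X⟧ :=
  extend (LinearMap.mul' R A ∘ₗ (HopfAlgebra.antipode R).lTensor A) F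

end Twist

section BaseChange

variable {R K A B : Type*} [CommRing R] [CommRing K] [Algebra R K] [Ring A] [Algebra R A]
  [Ring B] [Algebra K B]

/-- The map `A ⊗_R A → B ⊗_K B` induced by a map `φ : A → B` over `R → K`. -/
def tensorBaseChange (φ : A →+* B)
    (hφ : ∀ r, φ (algebraMap R A r) = algebraMap K B (algebraMap R K r)) :
    A ⊗[R] A →+* B ⊗[K] B :=
  letI : Algebra R (B ⊗[K] B) := Algebra.compHom _ (algebraMap R K)
  (Algebra.TensorProduct.lift (R := R) (S := R)
    ({ (Algebra.TensorProduct.includeLeft (R := K) (S := K) (A := B) (B := B)).toRingHom.comp φ with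
        commutes' := fun r => by
          change (φ (algebraMap R A r)) ⊗ₜ[K] (1 : B) = algebraMap K (B ⊗[K] B) (algebraMap R K r)
          rw [hφ]; rfl } : A →ₐ[R] B ⊗[K] B)
    ({ (Algebra.TensorProduct.includeRight (R := K) (A := B) (B := B)).toRingHom.comp φ with
        commutes' := fun r => by
          change (1 : B) ⊗ₜ[K] (φ (algebraMap R A r)) = algebraMap K (B ⊗[K] B) (algebraMap R K r)
          rw [hφ, Algebra.TensorProduct.algebraMap_apply, Algebra.algebraMap_eq_smul_one,
            Algebra.algebraMap_eq_smul_one, TensorProduct.tmul_smul, TensorProduct.smul_tmul'] } :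
      A →ₐ[R] B ⊗[K] B)
    (fun x y => by
      change (φ x ⊗ₜ[K] (1 : B)) * ((1 : B) ⊗ₜ[K] φ y) = ((1 : B) ⊗ₜ[K] φ y) * (φ x ⊗ₜ[K] (1 : B))
      simp)).toRingHom

theorem tensorBaseChange_tmul (φ : A →+* B)
    (hφ : ∀ r, φ (algebraMap R A r) = algebraMap K B (algebraMap R K r)) (x y : A) :
    tensorBaseChange φ hφ (x ⊗ₜ y) = φ x ⊗ₜ φ y := by
  change (φ x ⊗ₜ[K] (1 : B)) * ((1 : B) ⊗ₜ[K] φ y) = _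
  simp

end BaseChange

end Topological

namespace SPlus

/-- The enveloping algebra `U(S⁺)` over `R`. -/
abbrev U (R : Type*) [CommRing R] (n : ℕ) : Type _ := UniversalEnvelopingAlgebra R (SPlus R n)

/-- Topological Hopf algebra structures on `U(S⁺_R)⟦t⟧` with undeformed product. -/
abbrev UHopf (R : Type*) [CommRing R] (n : ℕ) : Type _ := Topological.HopfStructure R (U R n)

variable (R K : Type*) [CommRing R] [CommRing K] [Algebra R K] {n : ℕ}

/-- `∂ᵢ ∈ T`. -/
def del (i : Fin n) : Fin n → R := Pi.single i 1

/-- `εᵢ ∈ ℤⁿ`. -/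
def eps (i : Fin n) : Fin n → ℤ := Pi.single i 1

theorem mono_mem {α : Fin n → ℤ} {a : Fin n → R} (h : Witt.Adm α a) : Witt.mono α a ∈ SPlus R n :=
  (Witt.adm_iff _).2 (Witt.adm_mono h)

/-- `h = ∂_k - ∂_{k'}`. -/
def h (k k' : Fin n) : SPlus R n :=
  ⟨Witt.mono 0 (del R k - del R k'), mono_mem R
    ⟨fun i _ j => by simp only [Pi.zero_apply, Pi.add_apply, zero_add, Pi.single_apply]; split_ifs <;> simp,
      by simp [del, Finset.sum_sub_distrib]⟩⟩

/-- `e = x^{ε_k} (∂_k - 2 ∂_{k'})`. -/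
def e {k k' : Fin n} (hk : k ≠ k') : SPlus R n :=
  ⟨Witt.mono (eps k) (del R k - (2 : R) • del R k'), mono_mem R
    ⟨fun i _ j => by
      simp only [eps, Pi.zero_apply, Pi.add_apply, Pi.single_apply]; split_ifs <;> simp,
      by
        have : ∀ i, (del R k - (2 : R) • del R k') i * ((eps k i : R) + 1) =
            del R k i * ((eps k i : R) + 1) - 2 * (del R k' i * ((eps k i : R) + 1)) := by
          intro i; simp; ring
        simp only [this, Finset.sum_sub_distrib, ← Finset.mul_sum]
        simp [del, eps, Pi.single_apply, hk.symm]
        norm_num⟩⟩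

/-- The inclusion `S⁺ → U(S⁺) ⊆ U(S⁺)⟦t⟧`. -/
def inc (x : SPlus R n) : (U R n)⟦X⟧ := PowerSeries.C (UniversalEnvelopingAlgebra.ι R x)

/-- `h` as an element of `U(S⁺)`. -/
def hU (k k' : Fin n) : U R n := UniversalEnvelopingAlgebra.ι R (h R k k')

/-- `e` as an element of `U(S⁺)`. -/
def eU {k k' : Fin n} (hk : k ≠ k') : U R n := UniversalEnvelopingAlgebra.ι R (e R hk)

/-- The classical `r`-matrix `r = h ⊗ e - e ⊗ h`. -/
def rMatrix {k k' : Fin n} (hk : k ≠ k') : U R n ⊗[R] U R n :=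
  hU R k k' ⊗ₜ eU R hk - eU R hk ⊗ₜ hU R k k'

/-- The map `S⁺_R → S⁺_K` applying `R → K` to coefficients. -/
def map (x : SPlus R n) : SPlus K n :=
  ⟨Witt.map R K x.1, by
    obtain ⟨h1, h2⟩ := x.2
    constructor
    · intro α i hi
      refine h1 α i fun h0 => hi ?_
      rw [Witt.comp_map, h0, map_zero]
    · intro α
      have := congrArg (algebraMap R K) (h2 α)
      simp only [Witt.divCoeff, map_sum, map_mul, map_add, map_one, map_intCast, map_zero] at this
      simpa only [Witt.divCoeff, Witt.comp_map] using this⟩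

section

attribute [local instance 100] LieRing.ofAssociativeRing
attribute [local instance 2000] Algebra.toModule

/-- The canonical map `U(S⁺_R) → U(S⁺_K)`. -/
def baseChange (n : ℕ) : U R n →+* U K n :=
  letI : Algebra R (U K n) := Algebra.compHom _ (algebraMap R K)
  (UniversalEnvelopingAlgebra.lift R
    ({ toFun := fun x => UniversalEnvelopingAlgebra.ι K (map R K x)
       map_add' := fun x y => by
        rw [← _root_.map_add]; congr 1; exact Subtype.ext (_root_.map_add (Witt.map R K) x.1 y.1)
       map_smul' := fun c x => by
        change _ = algebraMap R K c • UniversalEnvelopingAlgebra.ι K (map R K x)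
        refine Eq.trans ?_ ((UniversalEnvelopingAlgebra.ι K).toLinearMap.map_smul
          (algebraMap R K c) (map R K x))
        exact congrArg (UniversalEnvelopingAlgebra.ι K) (Subtype.ext (Witt.map_smul R K c x.1))
       map_lie' := fun {x y} => by
        rw [← LieHom.map_lie]; congr 1; exact Subtype.ext (Witt.map_lie R K x.1 y.1) } :
      SPlus R n →ₗ⁅R⁆ U K n)).toRingHom

theorem baseChange_ι (x : SPlus R n) :
    baseChange R K n (UniversalEnvelopingAlgebra.ι R x) =
      UniversalEnvelopingAlgebra.ι K (map R K x) :=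
  letI : Algebra R (U K n) := Algebra.compHom _ (algebraMap R K)
  UniversalEnvelopingAlgebra.lift_ι_apply R _ x

theorem baseChange_algebraMap (n : ℕ) (r : R) :
    baseChange R K n (algebraMap R _ r) = algebraMap K _ (algebraMap R K r) :=
  letI : Algebra R (U K n) := Algebra.compHom _ (algebraMap R K)
  AlgHom.commutes (UniversalEnvelopingAlgebra.lift R _) r

end

/-- The canonical map `U(S⁺_R) ⊗ U(S⁺_R) → U(S⁺_K) ⊗ U(S⁺_K)`. -/
def baseChange₂ (n : ℕ) : U R n ⊗[R] U R n →+* U K n ⊗[K] U K n :=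
  Topological.tensorBaseChange (baseChange R K n) (baseChange_algebraMap R K n)

end SPlus

open SPlus Topological PowerSeries

/-- The basic twist `F(k, k') = ∑_r ((-1)^r / r!) h^{[r]} ⊗ e^r t^r`. -/
def basicTwist (K : Type*) [Field K] {n : ℕ} {k k' : Fin n} (hk : k ≠ k') :
    (U K n ⊗[K] U K n)⟦X⟧ :=
  PowerSeries.mk fun r =>
    ((-1 : K) ^ r / (r.factorial : K)) • (falling (hU K k k') 0 r ⊗ₜ[K] (eU K hk ^ r) : U K n ⊗[K] U K n)

/-- `Q` is the integral form over `R` of the quantization by the basic twist `F = F(k, k')` over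
`K`. On `U(S⁺_R)⟦t⟧` the coproduct is `F Δ₀ F⁻¹`, the antipode is `w S₀ w⁻¹` with
`w = m (Id ⊗ S₀)(F)`, the counit is `ε₀`; modulo `t` one recovers the standard Hopf algebra
`U(S⁺_R)`; and `F` and `Q` have the classical limit given by the `r`-matrix `r = h ⊗ e - e ⊗ h`,
that is `F ≡ 1` modulo `t`, `(F₂₁ - F)/t ≡ r` and `(Δ(a) - Δ^{op}(a))/t ≡ [Δ₀(a), r]`. -/
structure IsQuantization (R K : Type*) [CommRing R] [Field K] [Algebra R K] {n : ℕ}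
    {k k' : Fin n} (hk : k ≠ k') (Q : UHopf R n) : Prop where
  isUnit_twistElement : IsUnit (twistElement K (basicTwist K hk))
  comul_eq : ∀ x, PowerSeries.map (baseChange₂ R K n) (Q.comul x) =
    basicTwist K hk * Topological.comul₀ K (PowerSeries.map (baseChange R K n) x) *
      Ring.inverse (basicTwist K hk)
  antipode_eq : ∀ x, PowerSeries.map (baseChange R K n) (Q.antipode x) =
    twistElement K (basicTwist K hk) *
      Topological.antipode₀ K (PowerSeries.map (baseChange R K n) x) *
        Ring.inverse (twistElement K (basicTwist K hk))
  counit_eq : ∀ x, Q.counit x = Topological.counit₀ R x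
  comul_mod : ∀ x, constantCoeff (Q.comul x) =
    Bialgebra.comulAlgHom R (U R n) (constantCoeff x)
  antipode_mod : ∀ x, constantCoeff (Q.antipode x) =
    HopfAlgebra.antipode R (constantCoeff x)
  twist_mod : constantCoeff (basicTwist K hk) = 1
  twist_classical : Algebra.TensorProduct.comm K (U K n) (U K n) (coeff 1 (basicTwist K hk)) -
    coeff 1 (basicTwist K hk) = rMatrix K hk
  comul_classical : ∀ a : U R n, coeff 1 (Q.comul (C a)) -
      Algebra.TensorProduct.comm R (U R n) (U R n) (coeff 1 (Q.comul (C a))) =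
    Bialgebra.comulAlgHom R (U R n) a * rMatrix R hk -
      rMatrix R hk * Bialgebra.comulAlgHom R (U R n) a

/-- `x ⊗ (1 - et)^m + ∑_ℓ (-1)^ℓ h^{⟨ℓ⟩} ⊗ (1 - et)^{-ℓ} y_ℓ t^ℓ`. -/
def comulFormula (R : Type*) [CommRing R] {n : ℕ} {k k' : Fin n} (hk : k ≠ k') (m : ℤ)
    (x : SPlus R n) (y : ℕ → SPlus R n) : (U R n ⊗[R] U R n)⟦X⟧ :=
  tmul R (inc R x) (oneSubPow (eU R hk) m) +
    series fun l => (-1) ^ l *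
      tmul R (C (rising (hU R k k') 0 l)) (oneSubPow (eU R hk) (-(l : ℤ)) * inc R (y l))

/-- `-(1 - et)^{-m} ∑_ℓ y_ℓ h_1^{⟨ℓ⟩} t^ℓ`. -/
def antipodeFormula (R : Type*) [CommRing R] {n : ℕ} {k k' : Fin n} (hk : k ≠ k') (m : ℤ)
    (y : ℕ → SPlus R n) : (U R n)⟦X⟧ :=
  -(oneSubPow (eU R hk) (-m) * series fun l => inc R (y l) * C (rising (hU R k k') 1 l))

/-- The coproduct, antipode and counit of `Q` on each `x = x^α ∂ ∈ S⁺_ℤ`, `∂ = ∑ᵢ aᵢ ∂ᵢ`. With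
`A_ℓ = (1/ℓ!) ∏_{j<ℓ} (α_k - 2 α_{k'} + j)`, `B_ℓ = ∂(ε_k) A_{ℓ-1}` (`A_{-1} = 0`), which are
integers, `y_ℓ = x^{α + ℓ ε_k} (A_ℓ ∂ - B_ℓ (∂_k - 2 ∂_{k'}))` lies in `S⁺_ℤ` and
* `Δ(x) = x ⊗ (1 - et)^{α_k - α_{k'}} + ∑_ℓ (-1)^ℓ h^{⟨ℓ⟩} ⊗ (1 - et)^{-ℓ} y_ℓ t^ℓ`,
* `S(x) = -(1 - et)^{-(α_k - α_{k'})} ∑_ℓ y_ℓ h_1^{⟨ℓ⟩} t^ℓ`,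
* `ε(x) = 0`. -/
def HasFormulas {n : ℕ} {k k' : Fin n} (hk : k ≠ k') (Q : UHopf ℤ n) : Prop :=
  ∀ (α : Fin n → ℤ) (a : Fin n → ℤ) (x : SPlus ℤ n), (x : Witt ℤ n) = Witt.mono α a →
    ∃ (A B : ℕ → ℤ) (y : ℕ → SPlus ℤ n),
      (∀ l, (A l : ℚ) =
        1 / (l.factorial : ℚ) * ∏ j ∈ Finset.range l, ((α k : ℚ) - 2 * (α k' : ℚ) + (j : ℚ))) ∧
      B 0 = 0 ∧ (∀ l, B (l + 1) = Witt.pair a (eps k) * A l) ∧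
      (∀ l, (y l : Witt ℤ n) = Witt.mono (α + l • eps k)
        (A l • a - B l • (del ℤ k - 2 • del ℤ k'))) ∧
      Q.comul (inc ℤ x) = comulFormula ℤ hk (α k - α k') x y ∧
      Q.antipode (inc ℤ x) = antipodeFormula ℤ hk (α k - α k') y ∧
      Q.counit (inc ℤ x) = 0

end

open SPlus Topological PowerSeries

/-! Write u = 1 - et. Since [h, e] = e, the twist is the binomial series of u^h, with h in the first
tensor factor and e in the second, where the two commute. If [h, x] = m x, then F (x ⊗ 1) F⁻¹ = x ⊗
u^m, and F (1 ⊗ x) F⁻¹ = ∑ (-1)^l h^{⟨l⟩} ⊗ u^{-l} D_l(x) t^l with D_l = (ad e)^l / l!. Similarly w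
= ∑ (1/r!) h^{[r]} e^r t^r conjugates S₀(x) into -u^{-m} ∑ D_l(x) h_1^{⟨l⟩} t^l. The only
denominators left are those of D_l, and these disappear on monomials: the coefficients of D_l(x^α ∂)
are the A_l and B_l of the statement, which are multiset coefficients and their multiples, so D_l
preserves the integral form.

The argument is carried out for `JordanianData`: a torsion free Lie algebra over R with elements h,
e, integral weights for ad h and divided powers D_l of ad e. The formulas above serve as definitions
of Δ and S over R, and the Hopf axioms are verified over R on weight vectors (`comulL_lie`,
`coassoc`, `mulAntipodeLeft_comulL`, `mulAntipodeRight_comulL`). In this way nothing has to be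
descended from the field, and injectivity of U(S⁺_ℤ) → U(S⁺_𝔽) is not needed. The link with the
twist is then the pair of intertwining identities `comul_mul_twist` and `antipode_mul_twistElement`,
while the twist axioms over the field are `twistSeries_cocycle` and `map_twist_eq_one`.

Uniqueness: Δ and ε are R⟦t⟧-linear algebra maps prescribed on monomials, which span S⁺, and an
antipode is determined by Δ and ε as a convolution inverse (`antipode_unique`).

Counting: the coefficient of t is -h ⊗ e in F and h ⊗ e in Δ(h). Matrix coefficients of the action
of S⁺ on functions on ℤⁿ recover (k, k') from h ⊗ e, even up to a scalar (`eq_of_hU_tmul_eU`). -/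

namespace Topological

/-! ### Rising and falling factorials in a noncommutative ring. -/

section Factorials

variable {A B : Type*} [Ring A] [Ring B]

theorem map_rising (φ : A →+* B) (x : A) (a : ℤ) (m : ℕ) :
    φ (rising x a m) = rising (φ x) a m := by
  induction m with
  | zero => simp [rising]
  | succ m ih => simp [rising, ih]

theorem map_falling (φ : A →+* B) (x : A) (a : ℤ) (m : ℕ) :
    φ (falling x a m) = falling (φ x) a m := by
  induction m with
  | zero => simp [falling]
  | succ m ih => simp [falling, ih]

theorem Commute.rising_right {x y : A} (h : Commute y x) (a : ℤ) (m : ℕ) :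
    Commute y (rising x a m) := by
  induction m with
  | zero => exact Commute.one_right y
  | succ m ih =>
    exact ih.mul_right ((h.add_right (Int.commute_cast y a)).add_right (Nat.commute_cast y m))

theorem rising_succ_left (x : A) (a : ℤ) (m : ℕ) :
    rising x a (m + 1) = (x + a) * rising x (a + 1) m := by
  induction m with
  | zero => simp [rising]
  | succ m ih =>
    rw [rising, ih, rising, mul_assoc]
    push_cast
    congr 2
    abel

theorem rising_succ_left' (x : A) (a : ℤ) (m : ℕ) :
    rising x a (m + 1) = rising x (a + 1) m * (x + a) := by
  rw [rising_succ_left]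
  exact Commute.rising_right ((Commute.refl x).add_left (Int.cast_commute a x)) _ _

theorem rising_add (x : A) (a : ℤ) (m n : ℕ) :
    rising x a (m + n) = rising x a m * rising x (a + m) n := by
  induction n with
  | zero => simp [rising]
  | succ n ih =>
    rw [← add_assoc, rising, ih, rising, mul_assoc]
    push_cast
    congr 2
    abel

/-- The discrete derivative of the rising factorial. Every statement that changes an exponent of 1 -
et by one reduces to it. -/
theorem rising_shift_sub (x : A) (a : ℤ) (m : ℕ) :
    rising x (a + 1) (m + 1) - rising x a (m + 1) = (m + 1 : A) * rising x (a + 1) m := by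
  rw [rising_succ_left x a, rising, ← (Commute.rising_right (x := x)
    (((Commute.refl x).add_left (Int.cast_commute (a + 1) x)).add_left (Nat.cast_commute m x))
      (a + 1) m).eq, ← sub_mul]
  push_cast
  congr 1
  abel

theorem falling_eq_rising (x : A) (a : ℤ) (m : ℕ) :
    falling x a m = rising x (a - m + 1) m := by
  induction m with
  | zero => rfl
  | succ m ih =>
    rw [falling, ih, rising_succ_left']
    push_cast
    congr 1
    · congr 1; ring
    · abel

theorem Commute.falling_right {x y : A} (h : Commute y x) (a : ℤ) (m : ℕ) :
    Commute y (falling x a m) := by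
  rw [falling_eq_rising]; exact Commute.rising_right h _ _

theorem falling_add (x : A) (a : ℤ) (m n : ℕ) :
    falling x a (m + n) = falling x a m * falling x (a - m) n := by
  induction n with
  | zero => simp [falling]
  | succ n ih =>
    rw [← add_assoc, falling, ih, falling, mul_assoc]
    push_cast
    congr 2
    abel

/-- `(-1)^m x^{⟨m⟩} = (-x)^{[m]}`. -/
theorem neg_one_pow_mul_rising (x : A) (a : ℤ) (m : ℕ) :
    (-1) ^ m * rising x a m = falling (-x) (-a) m := by
  induction m with
  | zero => simp [rising, falling]
  | succ m ih =>
    rw [rising, falling, ← ih, pow_succ]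
    push_cast
    noncomm_ring

/-- An eigenvector x of ad h with eigenvalue m satisfies p(h) x = x p(h + m) for every polynomial p.
-/
theorem rising_mul_of_weight {h x : A} {m : ℤ} (hx : h * x = x * h + m * x) (a : ℤ) (l : ℕ) :
    rising h a l * x = x * rising h (a + m) l := by
  induction l with
  | zero => simp [rising]
  | succ l ih =>
    have : (h + a + l) * x = x * (h + (a + m : ℤ) + l) := by
      push_cast
      rw [add_mul, add_mul, hx, mul_add, mul_add, mul_add, (Int.cast_commute a x).eq,
        (Nat.cast_commute l x).eq, (Int.cast_commute m x).eq]
      abel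
    rw [rising, mul_assoc, this, ← mul_assoc, ih, mul_assoc, rising]

theorem falling_mul_of_weight {h x : A} {m : ℤ} (hx : h * x = x * h + m * x) (a : ℤ) (l : ℕ) :
    falling h a l * x = x * falling h (a + m) l := by
  rw [falling_eq_rising, falling_eq_rising, rising_mul_of_weight hx]; congr 2; ring

/-- The Chu–Vandermonde identity. -/
theorem falling_vandermonde {x y : A} (h : Commute x y) (a b : ℤ) (n : ℕ) :
    falling (x + y) (a + b) n = ∑ p ∈ Finset.HasAntidiagonal.antidiagonal n,
      (n.choose p.1 : A) * (falling x a p.1 * falling y b p.2) := by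
  induction n with
  | zero => simp [falling]
  | succ n ih =>
    rw [Finset.sum_antidiagonal_choose_succ_mul (fun i j => falling x a i * falling y b j),
      falling, ih, Finset.sum_mul, ← Finset.sum_add_distrib]
    -- With n = i + j, the new factor x + y + a + b - n splits as (x + a - i) + (y + b - j), which
    -- extends one or the other factorial; Pascal's rule collects the terms.
    refine Finset.sum_congr rfl fun p hp => ?_
    have hn : (n : A) = p.1 + p.2 := by
      rw [← Finset.HasAntidiagonal.mem_antidiagonal.1 hp]; push_cast; rfl
    have hc : n.choose p.2 = n.choose p.1 := by
      rw [Nat.choose_symm_of_eq_add]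
      rw [← Finset.HasAntidiagonal.mem_antidiagonal.1 hp, add_comm]
    have hcomm : Commute (falling y b p.2) (x + a - p.1) :=
      ((((Commute.falling_right h b p.2).symm.add_right
        (Int.commute_cast _ a)).sub_right (Nat.commute_cast _ p.1)))
    rw [hc, falling, falling, mul_assoc (falling x a p.1) (x + a - p.1), ← hcomm.eq, hn]
    push_cast
    noncomm_ring

theorem falling_zero_zero_succ (n : ℕ) : falling (0 : A) 0 (n + 1) = 0 := by
  induction n with
  | zero => simp [falling]
  | succ n ih => rw [falling, ih, zero_mul]

theorem rising_zero_zero_succ (n : ℕ) : rising (0 : A) 0 (n + 1) = 0 := by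
  rw [rising_succ_left]; simp

/-- Chu–Vandermonde for -x and x, whose sum 0 has vanishing factorials of positive order. This is
the coefficient form of (1 - t)^{-x} (1 - t)^x = 1. -/
theorem sum_rising_mul_falling (x : A) (n : ℕ) :
    ∑ p ∈ Finset.HasAntidiagonal.antidiagonal n,
      (n.choose p.1 : A) * ((-1) ^ p.1 * rising x 0 p.1 * falling x 0 p.2) =
        if n = 0 then 1 else 0 := by
  have := falling_vandermonde (Commute.neg_left (Commute.refl x)) 0 0 n
  simp only [neg_add_cancel, add_zero] at this
  simp only [neg_one_pow_mul_rising, neg_zero, ← this]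
  cases n with
  | zero => rfl
  | succ n => simp [falling_zero_zero_succ]

theorem sum_rising_mul_falling' (x : A) (n : ℕ) :
    ∑ p ∈ Finset.HasAntidiagonal.antidiagonal n,
      (n.choose p.1 : A) * (rising x 0 p.1 * ((-1) ^ p.2 * falling x 0 p.2)) =
        if n = 0 then 1 else 0 := by
  have : (-1 : A) ^ n * (if n = 0 then 1 else 0) = if n = 0 then 1 else 0 := by
    split_ifs with h <;> simp [h]
  rw [← this, ← sum_rising_mul_falling x, Finset.mul_sum]
  refine Finset.sum_congr rfl fun p hp => ?_
  rw [← Finset.HasAntidiagonal.mem_antidiagonal.1 hp, pow_add]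
  rcases neg_one_pow_eq_or A p.1 with h | h <;> rcases neg_one_pow_eq_or A p.2 with h' | h' <;>
    simp [h, h']

end Factorials

/-! ### Convergent sums ∑ f_l t^l whose terms f_l are themselves power series. -/

section Series

variable {A B : Type*} [Ring A] [Ring B]

theorem coeff_series (f : ℕ → A⟦X⟧) (n : ℕ) : coeff n (series f) =
    ∑ p ∈ Finset.HasAntidiagonal.antidiagonal n, coeff p.2 (f p.1) := coeff_mk _ _

theorem series_add (f g : ℕ → A⟦X⟧) : series (fun l => f l + g l) = series f + series g := by
  ext n; simp [coeff_series, Finset.sum_add_distrib]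

theorem series_neg (f : ℕ → A⟦X⟧) : series (fun l => -f l) = -series f := by
  ext n; simp [coeff_series]

theorem series_sub (f g : ℕ → A⟦X⟧) : series (fun l => f l - g l) = series f - series g := by
  ext n; simp [coeff_series, Finset.sum_sub_distrib]

theorem sum_antidiagonal_assoc {M : Type*} [AddCommMonoid M] (f : ℕ → ℕ → ℕ → M) (n : ℕ) :
    ∑ p ∈ Finset.HasAntidiagonal.antidiagonal n,
        ∑ q ∈ Finset.HasAntidiagonal.antidiagonal p.1, f q.1 q.2 p.2 =
      ∑ p ∈ Finset.HasAntidiagonal.antidiagonal n,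
        ∑ q ∈ Finset.HasAntidiagonal.antidiagonal p.2, f p.1 q.1 q.2 := by
  rw [Finset.sum_sigma', Finset.sum_sigma']
  refine Finset.sum_nbij' (fun x => ⟨(x.2.1, x.2.2 + x.1.2), (x.2.2, x.1.2)⟩)
    (fun x => ⟨(x.1.1 + x.2.1, x.2.2), (x.1.1, x.2.1)⟩) ?_ ?_ ?_ ?_ ?_ <;>
    rintro ⟨⟨a, b⟩, ⟨c, d⟩⟩ hx <;>
    simp only [Finset.mem_sigma, Finset.HasAntidiagonal.mem_antidiagonal] at hx ⊢ <;>
    obtain ⟨h1, h2⟩ := hx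
  · exact ⟨by omega, trivial⟩
  · exact ⟨by omega, trivial⟩
  · subst h2; rfl
  · subst h2; rfl

theorem sum_antidiagonal_left_comm {M : Type*} [AddCommMonoid M] (f : ℕ → ℕ → ℕ → M) (n : ℕ) :
    ∑ p ∈ Finset.HasAntidiagonal.antidiagonal n,
        ∑ q ∈ Finset.HasAntidiagonal.antidiagonal p.2, f p.1 q.1 q.2 =
      ∑ p ∈ Finset.HasAntidiagonal.antidiagonal n,
        ∑ q ∈ Finset.HasAntidiagonal.antidiagonal p.2, f q.1 p.1 q.2 := by
  rw [← sum_antidiagonal_assoc, ← sum_antidiagonal_assoc fun i j k => f j i k]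
  refine Finset.sum_congr rfl fun p _ => ?_
  exact (Finset.Nat.sum_antidiagonal_swap (f := fun q => f q.1 q.2 p.2)).symm

theorem series_mul_right (f : ℕ → A⟦X⟧) (c : A⟦X⟧) : series f * c = series fun l => f l * c := by
  ext n
  simp only [coeff_series, coeff_mul, Finset.sum_mul]
  exact sum_antidiagonal_assoc (fun i j k => coeff j (f i) * coeff k c) n

theorem mul_series (f : ℕ → A⟦X⟧) (c : A⟦X⟧) : c * series f = series fun l => c * f l := by
  ext n
  simp only [coeff_series, coeff_mul, Finset.mul_sum]
  exact sum_antidiagonal_left_comm (fun i j k => coeff i c * coeff k (f j)) n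

theorem series_series (f : ℕ → ℕ → A⟦X⟧) : series (fun l => series (f l)) =
    series fun n => ∑ p ∈ Finset.HasAntidiagonal.antidiagonal n, f p.1 p.2 := by
  ext n
  simp only [coeff_series, map_sum]
  exact (sum_antidiagonal_assoc (fun i j k => coeff k (f i j)) n).symm

theorem series_mul_series (f g : ℕ → A⟦X⟧) : series f * series g =
    series fun n => ∑ p ∈ Finset.HasAntidiagonal.antidiagonal n, f p.1 * g p.2 := by
  rw [series_mul_right]
  simp only [mul_series]
  exact series_series _

/-- Splitting off the first term turns a correction carrying one factor t into a shift of the index,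
and allows induction on the order in t. -/
theorem series_succ (f : ℕ → A⟦X⟧) : series f = f 0 + series (fun l => f (l + 1)) * X := by
  ext n
  cases n with
  | zero => simp [coeff_series]
  | succ n =>
    rw [map_add, coeff_succ_mul_X, coeff_series, coeff_series,
      Finset.Nat.sum_antidiagonal_succ]

theorem series_eq_zeroth (f : ℕ → A⟦X⟧) (h : ∀ l, f (l + 1) = 0) : series f = f 0 := by
  rw [series_succ]
  have : series (fun l => f (l + 1)) = 0 := by ext n; simp [coeff_series, h]
  rw [this, zero_mul, add_zero]

theorem map_series (φ : A →+* B) (f : ℕ → A⟦X⟧) :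
    PowerSeries.map φ (series f) = series fun l => PowerSeries.map φ (f l) := by
  ext n; simp [coeff_series]

theorem series_C (a : ℕ → A) : series (fun l => C (a l)) = mk a := by
  ext n
  rw [coeff_series, coeff_mk, Finset.sum_eq_single (n, 0)]
  · simp
  · rintro ⟨i, j⟩ hp hne
    rw [coeff_C, if_neg]
    rintro (rfl : j = 0)
    exact hne (by rw [← Finset.HasAntidiagonal.mem_antidiagonal.1 hp]; rfl)
  · intro h; exact absurd (Finset.HasAntidiagonal.mem_antidiagonal.2 (add_zero n)) h

theorem series_coeff (x : A⟦X⟧) : series (fun l => C (coeff l x)) = x := by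
  rw [series_C]; ext n; simp

end Series

/-! ### Integral powers of 1 - et. -/

section OneSubPow

variable {A B : Type*} [Ring A] [Ring B]

theorem oneSubPow_zero (e : A) : oneSubPow e 0 = 1 := by simp [oneSubPow]

theorem oneSubPow_one (e : A) : oneSubPow e 1 = 1 - C e * X := by simp [oneSubPow, oneSub]

theorem oneSubPow_add (e : A) (m n : ℤ) :
    oneSubPow e (m + n) = oneSubPow e m * oneSubPow e n := by
  simp [oneSubPow, zpow_add]

theorem oneSubPow_neg_mul (e : A) (m : ℤ) : oneSubPow e (-m) * oneSubPow e m = 1 := by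
  rw [← oneSubPow_add, neg_add_cancel, oneSubPow_zero]

theorem oneSubPow_mul_neg (e : A) (m : ℤ) : oneSubPow e m * oneSubPow e (-m) = 1 := by
  rw [← oneSubPow_add, add_neg_cancel, oneSubPow_zero]

/-- Working with units makes negative exponents automatic: only the image of 1 - et has to be known.
-/
theorem map_units_zpow_oneSub {S : Type*} [Ring S] (φ : A⟦X⟧ →+* S) (e : A) (v : Sˣ)
    (h : φ (1 - C e * X) = v) (m : ℤ) : φ (oneSubPow e m) = (v ^ m : Sˣ) := by
  have : Units.map (φ : A⟦X⟧ →* S) (oneSub e) = v := Units.ext h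
  rw [← this, ← map_zpow]; rfl

theorem map_oneSubPow (φ : A →+* B) (e : A) (m : ℤ) :
    PowerSeries.map φ (oneSubPow e m) = oneSubPow (φ e) m :=
  map_units_zpow_oneSub (PowerSeries.map φ) e (oneSub (φ e)) (by simp [oneSub]) m

theorem Commute.oneSubPow_right {x : A⟦X⟧} {e : A} (h : Commute x (C e)) (m : ℤ) :
    Commute x (oneSubPow e m) := by
  have : Commute x (oneSub e : A⟦X⟧) :=
    (Commute.one_right x).sub_right (h.mul_right (PowerSeries.commute_X x))
  exact this.units_zpow_right m

theorem constantCoeff_oneSubPow (e : A) (m : ℤ) : constantCoeff (oneSubPow e m) = 1 := by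
  rw [map_units_zpow_oneSub constantCoeff e 1 (by simp), one_zpow, Units.val_one]

/-- All the powers have constant term 1, so the coefficient of t is additive in m and is determined
by its value at m = 1. -/
theorem coeff_one_oneSubPow (e : A) (m : ℤ) : coeff 1 (oneSubPow e m) = -(m * e) := by
  have add : ∀ a b : ℤ, coeff 1 (oneSubPow e (a + b)) =
      coeff 1 (oneSubPow e a) + coeff 1 (oneSubPow e b) := fun a b => by
    rw [oneSubPow_add, coeff_mul, Finset.Nat.sum_antidiagonal_succ]
    simp [constantCoeff_oneSubPow, add_comm]
  let f : ℤ →+ A := AddMonoidHom.mk' (fun m => coeff 1 (oneSubPow e m)) add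
  have h1 : f 1 = -e := by
    change coeff 1 (oneSubPow e 1) = _
    rw [oneSubPow_one, map_sub, coeff_C_mul, coeff_one_X, coeff_one]; simp
  have : f m = m • f 1 := by
    rw [← map_zsmul]; simp
  change f m = _
  rw [this, h1]; simp

end OneSubPow

/-! ### Conjugation by (1 - et)^H, and the series that enters the antipode. -/

section Conjugation

variable {A B : Type*} [Ring A] [Ring B]

/-- `∑_l (-1)^l (H + c)^{⟨l⟩} (1 - e t)^{-l} d_l t^l`: when the `d_l` are the divided powers
`(ad e)^l d_0 / l!`, this is the conjugate of `d_0` by `(1 - e t)^{H + c}`. -/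
noncomputable def conjSeries (H e : A) (c : ℤ) (d : ℕ → A) : A⟦X⟧ :=
  series fun l => (-1) ^ l * (C (rising H c l) * (oneSubPow e (-(l : ℤ)) * C (d l)))

theorem map_conjSeries (φ : A →+* B) (H e : A) (c : ℤ) (d : ℕ → A) :
    PowerSeries.map φ (conjSeries H e c d) = conjSeries (φ H) (φ e) c fun l => φ (d l) := by
  simp [conjSeries, map_series, map_rising, map_oneSubPow]

variable {H e : A} {d : ℕ → A}

theorem neg_one_pow_comm (l : ℕ) (x : A) : x * (-1) ^ l = (-1) ^ l * x :=
  ((Commute.neg_one_right x).pow_right l).eq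

theorem C_mul_oneSubPow_one (hd : ∀ l, e * d l - d l * e = (l + 1 : A) * d (l + 1)) (l : ℕ) :
    C (d l) * oneSubPow e 1 = oneSubPow e 1 * C (d l) + C ((l + 1 : A) * d (l + 1)) * X := by
  rw [← hd, oneSubPow_one, sub_mul, mul_sub, mul_assoc, (PowerSeries.commute_X (C (d l))).symm.eq,
    ← mul_assoc, ← mul_assoc, map_sub, map_mul, map_mul, sub_mul]
  noncomm_ring

/-- Conjugation by `1 - e t` shifts the exponent. -/
theorem oneSubPow_one_mul_conjSeries (hHe : Commute H e)
    (hd : ∀ l, e * d l - d l * e = (l + 1 : A) * d (l + 1)) (c : ℤ) :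
    oneSubPow e 1 * conjSeries H e c d = conjSeries H e (c + 1) d * oneSubPow e 1 := by
  have hr : ∀ c l, Commute (C (rising H c l)) (oneSubPow e 1) := fun c l =>
    Commute.oneSubPow_right ((Commute.rising_right hHe.symm c l).symm.map C) 1
  have hL : ∀ l : ℕ, oneSubPow e 1 * ((-1) ^ l * (C (rising H c l) *
      (oneSubPow e (-(l : ℤ)) * C (d l)))) =
      (-1) ^ l * (C (rising H c l) * (oneSubPow e (1 - l) * C (d l))) := fun l => by
    rw [← mul_assoc, neg_one_pow_comm, mul_assoc, ← mul_assoc (oneSubPow e 1), ← (hr c l).eq,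
      mul_assoc, ← mul_assoc (oneSubPow e 1), ← oneSubPow_add, sub_eq_add_neg]
  have hR : ∀ l : ℕ, ((-1) ^ l * (C (rising H (c + 1) l) *
      (oneSubPow e (-(l : ℤ)) * C (d l)))) * oneSubPow e 1 =
      (-1) ^ l * (C (rising H (c + 1) l) * (oneSubPow e (1 - l) * C (d l))) +
      ((-1) ^ l * (C (rising H (c + 1) l) * (oneSubPow e (-l) * C ((l + 1 : A) * d (l + 1))))) * X :=
    fun l => by
      simp only [mul_assoc]
      rw [C_mul_oneSubPow_one hd, mul_add, mul_add, mul_add, ← mul_assoc (oneSubPow e (-(l : ℤ))),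
        ← oneSubPow_add, sub_eq_neg_add]
  rw [conjSeries, conjSeries, mul_series, series_mul_right]
  simp only [hL, hR]
  -- Moving 1 - et past d_l costs (l + 1) d_{l+1} t. Because of the factor t, this correction joins
  -- the term of index l + 1; the terms of index 0 agree.
  rw [series_add, ← series_mul_right, series_succ, series_succ fun l : ℕ => (-1) ^ l * (C (rising H (c + 1) l) * (oneSubPow e (1 - l) * C (d l))), add_assoc, ← add_mul, ← series_add]
  congr 2
  congr 1
  funext l
  -- The discrete derivative in H absorbs exactly the correction by (l + 1) d_{l+1}.
  have key : C (rising H c (l + 1)) = C (rising H (c + 1) (l + 1)) -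
      C (rising H (c + 1) l) * (l + 1 : A⟦X⟧) := by
    have := rising_shift_sub H c l
    rw [← map_natCast (C : A →+* A⟦X⟧), ← map_one (C : A →+* A⟦X⟧), ← map_add, ← map_mul, ← map_sub]
    congr 1
    have hc : Commute (rising H (c + 1) l) (l + 1 : A) :=
      (Nat.commute_cast _ l).add_right (Commute.one_right _)
    rw [hc.eq, ← this, sub_sub_cancel]
  have hc : Commute (oneSubPow e (-l)) (l + 1 : A⟦X⟧) :=
      (Nat.commute_cast _ l).add_right (Commute.one_right _)
  rw [key, map_mul, map_add, map_one, map_natCast, ← mul_assoc (oneSubPow e (-l)), hc.eq]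
  push_cast
  rw [show (1 - (l + 1 : ℤ)) = -l by ring, pow_succ]
  noncomm_ring

/-- Iteration of `oneSubPow_one_mul_conjSeries`; for negative m the one-step relation is multiplied
by (1 - et)⁻¹ on both sides. -/
theorem oneSubPow_mul_conjSeries (hHe : Commute H e)
    (hd : ∀ l, e * d l - d l * e = (l + 1 : A) * d (l + 1)) (c m : ℤ) :
    oneSubPow e m * conjSeries H e c d = conjSeries H e (c + m) d * oneSubPow e m := by
  have step := fun c => oneSubPow_one_mul_conjSeries hHe hd c
  induction m with
  | zero => simp [oneSubPow_zero]
  | succ m ih =>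
    rw [add_comm (m : ℤ) 1, oneSubPow_add, mul_assoc, ih, ← mul_assoc, step, mul_assoc,
      add_comm (1 : ℤ) m, add_assoc]
  | pred m ih =>
    have h1 := step (c + (-m - 1))
    rw [show c + (-m - 1 : ℤ) + 1 = c + -m by ring] at h1
    rw [show (-m - 1 : ℤ) = -1 + -m by ring, oneSubPow_add, mul_assoc, ih, ← mul_assoc]
    rw [show c + (-1 + -m : ℤ) = c + (-m - 1) by ring, ← mul_assoc]
    congr 1
    calc oneSubPow e (-1) * conjSeries H e (c + -m) d
        = oneSubPow e (-1) * (conjSeries H e (c + -m) d * oneSubPow e 1) * oneSubPow e (-1) := by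
          rw [mul_assoc, mul_assoc, oneSubPow_mul_neg, mul_one]
      _ = _ := by rw [← h1, ← mul_assoc, oneSubPow_neg_mul, one_mul]

/-- Conjugation by `(1 - e t)^H` is multiplicative. -/
theorem conjSeries_mul_conjSeries {d' : ℕ → A} (hHe : Commute H e) (hHd : ∀ l, Commute H (d l))
    (hd : ∀ l, e * d l - d l * e = (l + 1 : A) * d (l + 1)) :
    conjSeries H e 0 d * conjSeries H e 0 d' = conjSeries H e 0 fun n =>
      ∑ p ∈ Finset.HasAntidiagonal.antidiagonal n, d p.2 * d' p.1 := by
  have hr : ∀ c l (m : ℤ), Commute (C (rising H c l)) (oneSubPow e m) := fun c l m =>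
    Commute.oneSubPow_right ((Commute.rising_right hHe.symm c l).symm.map C) m
  have hrr : ∀ c c' l l', Commute (C (rising H c l)) (C (rising H c' l')) := fun c c' l l' =>
    (Commute.rising_right (Commute.rising_right (Commute.refl H) c l).symm c' l').map C
  have hrd : ∀ c l l', Commute (C (rising H c l)) (C (d l')) := fun c l l' =>
    (Commute.rising_right (hHd l').symm c l).symm.map C
  have hcomm : ∀ c l, Commute (conjSeries H e c d) (C (rising H 0 l)) := fun c l => by
    rw [commute_iff_eq, conjSeries, series_mul_right, mul_series]
    congr 1; funext m
    exact (((Commute.neg_one_left _).pow_left m).mul_left ((hrr _ _ _ _).mul_left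
      ((hr _ _ _).symm.mul_left (hrd _ _ _).symm))).eq
  -- Carrying the whole first series past (1 - et)^{-m} raises its shift from 0 to m, and then
  -- H^{⟨m⟩} (H + m)^{⟨l⟩} = H^{⟨m+l⟩}. The product thus depends on m + l except for d_l d'_m.
  have step : ∀ m : ℕ, conjSeries H e 0 d * ((-1) ^ m * (C (rising H 0 m) *
      (oneSubPow e (-(m : ℤ)) * C (d' m)))) = series fun l =>
      (-1) ^ (m + l) * (C (rising H 0 (m + l)) * (oneSubPow e (-((m + l : ℕ) : ℤ)) *
        C (d l * d' m))) := fun m => by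
    have h1 := oneSubPow_mul_conjSeries hHe hd m (-m)
    rw [add_neg_cancel] at h1
    rw [← mul_assoc, neg_one_pow_comm, mul_assoc, ← mul_assoc (conjSeries H e 0 d),
      (hcomm 0 m).eq, mul_assoc, ← mul_assoc (conjSeries H e 0 d), ← h1, conjSeries,
      mul_series, series_mul_right, mul_series, mul_series]
    congr 1; funext l
    rw [rising_add, zero_add, map_mul, map_mul, pow_add, mul_assoc ((-1) ^ m)]
    congr 1
    rw [mul_assoc (oneSubPow e _), mul_assoc ((-1) ^ l), ← mul_assoc (oneSubPow e _),
      neg_one_pow_comm, mul_assoc ((-1) ^ l), ← mul_assoc (C _), neg_one_pow_comm,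
      mul_assoc ((-1) ^ l)]
    congr 1
    rw [mul_assoc (C (rising H 0 m))]
    congr 1
    rw [mul_assoc (C (rising H _ l)), ← mul_assoc (oneSubPow e _), ← (hr _ _ _).eq, mul_assoc]
    congr 1
    rw [mul_assoc (oneSubPow e _), ← mul_assoc (oneSubPow e (-m)), ← oneSubPow_add]
    push_cast
    rw [neg_add]
  conv_lhs => rw [conjSeries.eq_1 (d := d'), mul_series]
  simp only [step]
  rw [series_series, conjSeries]
  congr 1; funext n
  rw [map_sum, Finset.mul_sum, Finset.mul_sum, Finset.mul_sum]
  refine Finset.sum_congr rfl fun p hp => ?_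
  rw [Finset.HasAntidiagonal.mem_antidiagonal.1 hp]

/-- `∑_l d_l (h + c)^{⟨l⟩} t^l`. -/
noncomputable def antiSeries (h : A) (c : ℤ) (d : ℕ → A) : A⟦X⟧ :=
  series fun l => C (d l) * C (rising h c l)

/-- Here h and e do not commute. Moving e to the left past h_c^{⟨l⟩} shifts c to c + 1, leaving the
commutator of d_l with e, that is -(l + 1) d_{l+1}; `rising_shift_sub` matches it with the change of
the factorial in the next term. -/
theorem antiSeries_mul_oneSubPow_one {h : A} (he : h * e = e * h + e)
    (hd : ∀ l, e * d l - d l * e = (l + 1 : A) * d (l + 1)) (c : ℤ) :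
    antiSeries h c d * oneSubPow e 1 = oneSubPow e 1 * antiSeries h (c + 1) d := by
  have hcom : ∀ l, rising h c l * e = e * rising h (c + 1) l := fun l =>
    rising_mul_of_weight (by simpa using he) c l
  have h1 : antiSeries h c d * oneSubPow e 1 = antiSeries h c d -
      series (fun l => C (d l * rising h c l * e)) * X := by
    rw [oneSubPow_one, mul_sub, mul_one, ← mul_assoc, antiSeries, series_mul_right]
    simp only [map_mul]
  have h2 : oneSubPow e 1 * antiSeries h (c + 1) d = antiSeries h (c + 1) d -
      series (fun l => C (e * d l * rising h (c + 1) l)) * X := by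
    rw [oneSubPow_one, sub_mul, one_mul, mul_assoc, ← PowerSeries.commute_X, ← mul_assoc,
      antiSeries, mul_series]
    simp only [map_mul, mul_assoc]
  rw [h1, h2, sub_eq_sub_iff_sub_eq_sub, ← sub_mul, ← series_sub, antiSeries, antiSeries,
    series_succ, series_succ fun l => C (d l) * C (rising h (c + 1) l), add_sub_add_comm,
    ← sub_mul, ← series_sub]
  simp only [rising, sub_self, zero_add]
  congr 2
  funext l
  rw [← map_mul, ← map_mul, ← map_sub, ← map_sub]
  congr 1
  rw [mul_assoc (d l), hcom, ← mul_assoc (d l) e, ← sub_mul (d l * e)]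
  have := hd l
  have h3 : d l * e - e * d l = -((l + 1 : A) * d (l + 1)) := by rw [← this]; abel
  have h4 := rising_shift_sub h c l
  have h5 : Commute (l + 1 : A) (d (l + 1)) :=
      (Nat.cast_commute l _).add_left (Commute.one_left _)
  rw [h3, h5.eq, neg_mul, mul_assoc, ← h4]
  simp only [rising]
  noncomm_ring

theorem antiSeries_mul_oneSubPow {h : A} (he : h * e = e * h + e)
    (hd : ∀ l, e * d l - d l * e = (l + 1 : A) * d (l + 1)) (c m : ℤ) :
    antiSeries h c d * oneSubPow e m = oneSubPow e m * antiSeries h (c + m) d := by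
  have step := fun c => antiSeries_mul_oneSubPow_one he hd c
  induction m with
  | zero => simp [oneSubPow_zero]
  | succ m ih =>
    rw [oneSubPow_add, ← mul_assoc, ih, mul_assoc, step, ← mul_assoc, add_assoc]
  | pred m ih =>
    have h1 := step (c + (-m - 1))
    rw [show c + (-m - 1 : ℤ) + 1 = c + -m by ring] at h1
    rw [show (-m - 1 : ℤ) = -m + -1 by ring, oneSubPow_add, ← mul_assoc, ih, mul_assoc, mul_assoc]
    rw [show c + (-m + -1 : ℤ) = c + (-m - 1) by ring]
    congr 1
    calc antiSeries h (c + -m) d * oneSubPow e (-1)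
        = oneSubPow e (-1) * (oneSubPow e 1 * antiSeries h (c + -m) d) * oneSubPow e (-1) := by
          rw [← mul_assoc, oneSubPow_neg_mul, one_mul]
      _ = _ := by rw [← h1, mul_assoc, mul_assoc, oneSubPow_mul_neg, mul_one]

/-- The starting point 1 - m' is chosen so that, after passing d'_p of weight m' + p, the first
factorial starts at 1 + p, exactly where h_1^{⟨p⟩} stops; the two join into one factorial. -/
theorem antiSeries_mul_antiSeries {h : A} {d' : ℕ → A} {m' : ℤ}
    (hd' : ∀ l : ℕ, h * d' l = d' l * h + (m' + l : ℤ) * d' l) :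
    antiSeries h (1 - m') d * antiSeries h 1 d' = antiSeries h 1 fun n =>
      ∑ p ∈ Finset.HasAntidiagonal.antidiagonal n, d p.1 * d' p.2 := by
  rw [antiSeries, antiSeries, antiSeries, series_mul_series]
  congr 1; funext n
  rw [map_sum, Finset.sum_mul]
  refine Finset.sum_congr rfl fun p hp => ?_
  simp only [← map_mul]
  congr 1
  rw [mul_assoc, ← mul_assoc (rising _ _ _), rising_mul_of_weight (hd' p.2), mul_assoc, mul_assoc]
  congr 2
  rw [← Finset.HasAntidiagonal.mem_antidiagonal.1 hp, add_comm p.1, rising_add,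
    show (1 - m' + (m' + p.2) : ℤ) = 1 + p.2 by ring]
  exact (Commute.rising_right (Commute.rising_right (Commute.refl h) _ _).symm _ _).eq

/-- Moving the factorials to the left of elements of weight `m + l`. -/
theorem antiSeries_eq_falling {h : A} {m : ℤ}
    (hd : ∀ l : ℕ, h * d l = d l * h + (m + l : ℤ) * d l) (c : ℤ) :
    antiSeries h (c + 1 + m) d = series fun l => C (falling h c l * d l) := by
  rw [antiSeries]
  congr 1; funext l
  rw [falling_mul_of_weight (hd l), falling_eq_rising, ← map_mul]
  congr 3; ring

end Conjugation

/-! ### Maps compatible with convergent series. -/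

section PreservesSeries

variable {A B B' : Type*} [Ring A] [Ring B] [Ring B']

/-- `F` commutes with the series `∑_l f_l t^l`; such maps are determined by their values on the
constants. -/
def PreservesSeries (F : A⟦X⟧ → B⟦X⟧) : Prop :=
  ∀ s : ℕ → A⟦X⟧, F (series s) = series fun l => F (s l)

theorem PreservesSeries.comp {G : B⟦X⟧ → B'⟦X⟧} {F : A⟦X⟧ → B⟦X⟧} (hG : PreservesSeries G)
    (hF : PreservesSeries F) : PreservesSeries fun x => G (F x) :=
  fun s => (congrArg G (hF s)).trans (hG _)

theorem preservesSeries_map (φ : A →+* B) : PreservesSeries (PowerSeries.map φ) := map_series φ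

theorem preservesSeries_id : PreservesSeries fun x : A⟦X⟧ => x := fun _ => rfl

theorem PreservesSeries.mul_left {F : A⟦X⟧ → B⟦X⟧} (hF : PreservesSeries F) (c : B⟦X⟧) :
    PreservesSeries fun x => c * F x := fun s => by
  simp only [hF s, mul_series]

theorem PreservesSeries.mul_right {F : A⟦X⟧ → B⟦X⟧} (hF : PreservesSeries F) (c : B⟦X⟧) :
    PreservesSeries fun x => F x * c := fun s => by
  simp only [hF s, series_mul_right]

theorem PreservesSeries.congr {F G : A⟦X⟧ → B⟦X⟧} (hF : PreservesSeries F)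
    (hG : PreservesSeries G) (h : ∀ a, F (C a) = G (C a)) (x : A⟦X⟧) : F x = G x := by
  rw [← series_coeff x, hF, hG]
  simp only [h]

end PreservesSeries

/-! ### R⟦t⟧-linear maps and completed tensor products. -/

section Linear

variable {R A B A' B' A'' B'' : Type*} [CommRing R] [Ring A] [Algebra R A] [Ring B] [Algebra R B]
  [Ring A'] [Algebra R A'] [Ring B'] [Algebra R B'] [Ring A''] [Algebra R A'']
  [Ring B''] [Algebra R B'']

theorem smul_eq_C_algebraMap_mul (c : R) (x : A⟦X⟧) : c • x = C (algebraMap R A c) * x := by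
  ext n
  rw [coeff_C_mul, ← Algebra.smul_def]; rfl

theorem C_smul (c : R) (a : A) : C (c • a) = c • C a := by
  rw [smul_eq_C_algebraMap_mul, ← map_mul, Algebra.smul_def]

theorem algebraMap_eq_C (c : R) : algebraMap R A⟦X⟧ c = C (algebraMap R A c) := by
  rw [Algebra.algebraMap_eq_smul_one, smul_eq_C_algebraMap_mul, mul_one]

theorem scalar_C (c : R) : scalar R A (C c) = C (algebraMap R A c) := by simp [scalar]

theorem scalar_commute (c : R⟦X⟧) (x : A⟦X⟧) : scalar R A c * x = x * scalar R A c := by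
  ext n
  rw [coeff_mul, coeff_mul, ← Finset.Nat.sum_antidiagonal_swap]
  exact Finset.sum_congr rfl fun p _ => by
    simpa [scalar] using Algebra.commutes _ _

theorem IsLinear.map_mul_X {f : A⟦X⟧ →ₗ[R] B⟦X⟧} (hf : IsLinear f) (x : A⟦X⟧) :
    f (x * X) = f x * X := by
  have := hf X x
  simp only [scalar, map_X] at this
  rw [(PowerSeries.commute_X x).eq, this, ← (PowerSeries.commute_X _).eq]

/-- Linearity over R⟦t⟧ gives f(x t) = f(x) t, so the coefficient of t^n follows by splitting off
leading terms. This is the continuity that reduces later identities to constants. -/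
theorem IsLinear.preservesSeries {f : A⟦X⟧ →ₗ[R] B⟦X⟧} (hf : IsLinear f) : PreservesSeries f := by
  intro s
  ext n
  induction n generalizing s with
  | zero =>
    rw [series_succ, map_add, hf.map_mul_X, series_succ fun l => f (s l)]
    simp
  | succ n ih =>
    rw [series_succ, map_add, hf.map_mul_X, series_succ fun l => f (s l), map_add, map_add,
      coeff_succ_mul_X, coeff_succ_mul_X, ih]

theorem IsLinear.comp {g : B⟦X⟧ →ₗ[R] B'⟦X⟧} {f : A⟦X⟧ →ₗ[R] B⟦X⟧} (hg : IsLinear g)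
    (hf : IsLinear f) : IsLinear (g ∘ₗ f) := fun c x => by
  rw [LinearMap.comp_apply, hf c x, hg, LinearMap.comp_apply]

theorem isLinear_id : IsLinear (LinearMap.id : A⟦X⟧ →ₗ[R] A⟦X⟧) := fun _ _ => rfl

theorem isLinear_ofComponents (f : ℕ → A →ₗ[R] B) : IsLinear (ofComponents f) := fun c x => by
  ext n
  simp only [ofComponents, LinearMap.coe_mk, AddHom.coe_mk, coeff_mk, coeff_mul, scalar, coeff_map,
    map_sum, Finset.mul_sum, ← Algebra.smul_def, map_smul]
  exact sum_antidiagonal_left_comm (fun i j k => coeff j c • f i (coeff k x)) n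

theorem ofComponents_C (f : ℕ → A →ₗ[R] B) (a : A) : ofComponents f (C a) = mk fun n => f n a := by
  ext n
  simp only [ofComponents, LinearMap.coe_mk, AddHom.coe_mk, coeff_mk]
  rw [Finset.sum_eq_single (n, 0)]
  · simp
  · rintro ⟨i, j⟩ hp hne
    rw [coeff_C, if_neg, map_zero]
    rintro (rfl : j = 0)
    exact hne (by rw [← Finset.HasAntidiagonal.mem_antidiagonal.1 hp]; rfl)
  · intro h; exact absurd (Finset.HasAntidiagonal.mem_antidiagonal.2 (add_zero n)) h

theorem isLinear_tensorMap (f : A⟦X⟧ →ₗ[R] B⟦X⟧) (g : A'⟦X⟧ →ₗ[R] B'⟦X⟧) :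
    IsLinear (tensorMap f g) := isLinear_ofComponents _

theorem isLinear_extend (f : A →ₗ[R] B) : IsLinear (extend f) := fun c x => by
  ext n
  simp [extend, coeff_mul, scalar, ← Algebra.smul_def]

theorem extend_C (f : A →ₗ[R] B) (a : A) : extend f (C a) = C (f a) := by
  ext n
  simp only [extend, LinearMap.coe_mk, AddHom.coe_mk, coeff_mk, coeff_C]
  split_ifs <;> simp

theorem preservesSeries_scalar : PreservesSeries (scalar R A) := preservesSeries_map _

/-- The element `x ⊗ y` of `A⟦t⟧ ⊗̂ B⟦t⟧ = (A ⊗ B)⟦t⟧`. -/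
noncomputable def mixedTmul (R : Type*) {A B : Type*} [CommRing R] [Ring A] [Algebra R A] [Ring B]
    [Algebra R B] (x : A⟦X⟧) (y : B⟦X⟧) : (A ⊗[R] B)⟦X⟧ :=
  PowerSeries.map (Algebra.TensorProduct.includeLeft (R := R) (S := R) (B := B)).toRingHom x *
    PowerSeries.map (Algebra.TensorProduct.includeRight (R := R) (A := A)).toRingHom y

theorem coeff_mixedTmul (x : A⟦X⟧) (y : B⟦X⟧) (n : ℕ) : coeff n (mixedTmul R x y) =
    ∑ p ∈ Finset.HasAntidiagonal.antidiagonal n, coeff p.1 x ⊗ₜ coeff p.2 y := by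
  simp [mixedTmul, coeff_mul]

theorem mixedTmul_C (a : A) (b : B) : mixedTmul R (C a) (C b) = C (a ⊗ₜ b) := by
  simp [mixedTmul, ← map_mul]

theorem preservesSeries_mixedTmul_left (y : B⟦X⟧) :
    PreservesSeries fun x : A⟦X⟧ => mixedTmul R x y :=
  (preservesSeries_map _).mul_right _

theorem preservesSeries_mixedTmul_right (x : A⟦X⟧) :
    PreservesSeries fun y : B⟦X⟧ => mixedTmul R x y :=
  (preservesSeries_map _).mul_left _

theorem mixedTmul_mul (x x' : A⟦X⟧) (y y' : B⟦X⟧) :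
    mixedTmul R x y * mixedTmul R x' y' = mixedTmul R (x * x') (y * y') := by
  have hcomm : ∀ (x : A⟦X⟧) (y : B⟦X⟧),
      PowerSeries.map (Algebra.TensorProduct.includeRight (R := R) (A := A)).toRingHom y *
        PowerSeries.map (Algebra.TensorProduct.includeLeft (R := R) (S := R) (B := B)).toRingHom x =
      PowerSeries.map (Algebra.TensorProduct.includeLeft (R := R) (S := R) (B := B)).toRingHom x *
        PowerSeries.map (Algebra.TensorProduct.includeRight (R := R) (A := A)).toRingHom y := by
    intro x y
    ext n
    rw [coeff_mul, coeff_mul, ← Finset.Nat.sum_antidiagonal_swap]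
    exact Finset.sum_congr rfl fun p _ => by simp
  simp only [mixedTmul, map_mul]
  rw [mul_assoc, ← mul_assoc (PowerSeries.map _ y), hcomm]
  simp only [mul_assoc]

theorem mixedTmul_one_one : mixedTmul R (1 : A⟦X⟧) (1 : B⟦X⟧) = 1 := by simp [mixedTmul]

theorem mixedTmul_add_left (x x' : A⟦X⟧) (y : B⟦X⟧) :
    mixedTmul R (x + x') y = mixedTmul R x y + mixedTmul R x' y := by
  simp [mixedTmul, add_mul]

theorem mixedTmul_add_right (x : A⟦X⟧) (y y' : B⟦X⟧) :
    mixedTmul R x (y + y') = mixedTmul R x y + mixedTmul R x y' := by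
  simp [mixedTmul, mul_add]

/-- Both sides respect series in each variable separately, so x and y may be taken constant, where
the defining convolution of coefficients is visible. -/
theorem tensorMap_mixedTmul {f : A⟦X⟧ →ₗ[R] B⟦X⟧} {g : A'⟦X⟧ →ₗ[R] B'⟦X⟧} (hf : IsLinear f)
    (hg : IsLinear g) (x : A⟦X⟧) (y : A'⟦X⟧) :
    tensorMap f g (mixedTmul R x y) = mixedTmul R (f x) (g y) := by
  revert x
  refine ((isLinear_tensorMap f g).preservesSeries.comp (preservesSeries_mixedTmul_left y)).congr
    ((preservesSeries_mixedTmul_left _).comp hf.preservesSeries) fun a => ?_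
  revert y
  refine ((isLinear_tensorMap f g).preservesSeries.comp (preservesSeries_mixedTmul_right _)).congr
    ((preservesSeries_mixedTmul_right _).comp hg.preservesSeries) fun b => ?_
  rw [mixedTmul_C, tensorMap, ofComponents_C]
  ext n
  rw [coeff_mk, coeff_mixedTmul, LinearMap.sum_apply]
  rfl

theorem extend_mul_mixedTmul (x y : A⟦X⟧) :
    extend (LinearMap.mul' R A) (mixedTmul R x y) = x * y := by
  ext n
  simp only [extend, LinearMap.coe_mk, AddHom.coe_mk, coeff_mk, coeff_mixedTmul, map_sum, coeff_mul,
    LinearMap.mul'_apply]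

/-- Maps on `(A ⊗ B)⟦t⟧` that agree on the pure tensors are equal. -/
theorem PreservesSeries.congr_tmul {S : Type*} [Ring S] {F G : (A ⊗[R] B)⟦X⟧ → S⟦X⟧}
    (hF : PreservesSeries F) (hG : PreservesSeries G) (hF' : ∀ x y, F (x + y) = F x + F y)
    (hG' : ∀ x y, G (x + y) = G x + G y)
    (h : ∀ a b, F (mixedTmul R (C a) (C b)) = G (mixedTmul R (C a) (C b))) (z : (A ⊗[R] B)⟦X⟧) :
    F z = G z := by
  refine hF.congr hG (fun y => ?_) z
  induction y with
  | zero =>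
    rw [map_zero]
    exact (AddMonoidHom.mk' F hF').map_zero.trans (AddMonoidHom.mk' G hG').map_zero.symm
  | tmul a b => rw [← mixedTmul_C]; exact h a b
  | add a b ha hb => rw [map_add, hF', hG', ha, hb]

theorem tensorMap_comp {f' : B⟦X⟧ →ₗ[R] B''⟦X⟧} {g' : B'⟦X⟧ →ₗ[R] A''⟦X⟧}
    {f : A⟦X⟧ →ₗ[R] B⟦X⟧} {g : A'⟦X⟧ →ₗ[R] B'⟦X⟧} (hf' : IsLinear f') (hg' : IsLinear g')
    (hf : IsLinear f) (hg : IsLinear g) (z : (A ⊗[R] A')⟦X⟧) :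
    tensorMap f' g' (tensorMap f g z) = tensorMap (f' ∘ₗ f) (g' ∘ₗ g) z := by
  refine PreservesSeries.congr_tmul
    ((isLinear_tensorMap _ _).preservesSeries.comp (isLinear_tensorMap _ _).preservesSeries)
    (isLinear_tensorMap _ _).preservesSeries (by simp) (by simp) (fun a b => ?_) z
  rw [tensorMap_mixedTmul hf hg, tensorMap_mixedTmul hf' hg',
    tensorMap_mixedTmul (hf'.comp hf) (hg'.comp hg)]
  rfl

/-- Multiplicativity of a map on `(A ⊗ B)⟦t⟧` can be checked on pure tensors. -/
theorem mul_of_tmul {S : Type*} [Ring S] {F : (A ⊗[R] B)⟦X⟧ → S⟦X⟧} (hF : PreservesSeries F)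
    (hF' : ∀ x y, F (x + y) = F x + F y)
    (h : ∀ a b a' b', F (mixedTmul R (C a) (C b) * mixedTmul R (C a') (C b')) =
      F (mixedTmul R (C a) (C b)) * F (mixedTmul R (C a') (C b'))) (z z' : (A ⊗[R] B)⟦X⟧) :
    F (z * z') = F z * F z' := by
  revert z
  refine PreservesSeries.congr_tmul (hF.comp (preservesSeries_id.mul_right z'))
    (hF.mul_right _) (by simp [add_mul, hF']) (by simp [add_mul, hF']) fun a b => ?_
  revert z'
  exact PreservesSeries.congr_tmul (hF.comp (preservesSeries_id.mul_left _)) (hF.mul_left _)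
    (by simp [mul_add, hF']) (by simp [mul_add, hF']) fun a' b' => h a b a' b'

theorem tensorMap_mul {f : A⟦X⟧ →ₗ[R] B⟦X⟧} {g : A'⟦X⟧ →ₗ[R] B'⟦X⟧} (hf : IsLinear f)
    (hg : IsLinear g) (hf' : ∀ x y, f (x * y) = f x * f y) (hg' : ∀ x y, g (x * y) = g x * g y)
    (z z' : (A ⊗[R] A')⟦X⟧) : tensorMap f g (z * z') = tensorMap f g z * tensorMap f g z' := by
  refine mul_of_tmul 
    (isLinear_tensorMap _ _).preservesSeries (by simp) (fun a b a' b' => ?_) z z'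
  rw [mixedTmul_mul, tensorMap_mixedTmul hf hg, tensorMap_mixedTmul hf hg,
    tensorMap_mixedTmul hf hg, mixedTmul_mul, hf', hg']

theorem map_assoc_mixedTmul (x : A⟦X⟧) (y : B⟦X⟧) (z : A'⟦X⟧) :
    PowerSeries.map (Algebra.TensorProduct.assoc R R R A B A').toRingEquiv.toRingHom
      (mixedTmul R (mixedTmul R x y) z) = mixedTmul R x (mixedTmul R y z) := by
  ext n
  rw [coeff_map, coeff_mixedTmul, coeff_mixedTmul]
  simp only [coeff_mixedTmul, TensorProduct.sum_tmul, TensorProduct.tmul_sum, map_sum]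
  exact sum_antidiagonal_assoc (fun i j k => coeff i x ⊗ₜ[R] (coeff j y ⊗ₜ[R] coeff k z)) n

theorem map_lid_mixedTmul (c : R⟦X⟧) (x : A⟦X⟧) :
    PowerSeries.map (Algebra.TensorProduct.lid R A).toRingEquiv.toRingHom (mixedTmul R c x) =
      scalar R A c * x := by
  ext n
  rw [coeff_map, coeff_mixedTmul, coeff_mul, map_sum]
  exact Finset.sum_congr rfl fun p _ => by simp [scalar, Algebra.smul_def]

theorem map_rid_mixedTmul (x : A⟦X⟧) (c : R⟦X⟧) :
    PowerSeries.map (Algebra.TensorProduct.rid R R A).toRingEquiv.toRingHom (mixedTmul R x c) =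
      x * scalar R A c := by
  ext n
  rw [coeff_map, coeff_mixedTmul, coeff_mul, map_sum]
  exact Finset.sum_congr rfl fun p _ => by
    simp [scalar, Algebra.smul_def, Algebra.commutes]

/-- The extension of a linear map `A → B⟦t⟧` to `A⟦t⟧`. -/
noncomputable def extendLinear (g : A →ₗ[R] B⟦X⟧) : A⟦X⟧ →ₗ[R] B⟦X⟧ where
  toFun x := series fun l => g (coeff l x)
  map_add' x y := by simp only [map_add, series_add]
  map_smul' c x := by
    rw [RingHom.id_apply, smul_eq_C_algebraMap_mul, smul_eq_C_algebraMap_mul, mul_series]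
    simp only [coeff_C_mul, ← Algebra.smul_def, map_smul, smul_eq_C_algebraMap_mul]

theorem extendLinear_apply (g : A →ₗ[R] B⟦X⟧) (x : A⟦X⟧) :
    extendLinear g x = series fun l => g (coeff l x) := rfl

theorem extendLinear_C (g : A →ₗ[R] B⟦X⟧) (a : A) : extendLinear g (C a) = g a := by
  rw [extendLinear_apply, series_eq_zeroth]
  · simp
  · intro l; simp

theorem isLinear_extendLinear (g : A →ₗ[R] B⟦X⟧) : IsLinear (extendLinear g) := fun c x => by
  conv_rhs => rw [← series_coeff c, preservesSeries_scalar]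
  rw [extendLinear_apply, extendLinear_apply, series_mul_series]
  congr 1; funext n
  rw [coeff_mul, map_sum]
  refine Finset.sum_congr rfl fun p _ => ?_
  rw [scalar_C, ← smul_eq_C_algebraMap_mul, ← map_smul, scalar, coeff_map, Algebra.smul_def]

/-- The extension of an algebra map `A → B⟦t⟧` to `A⟦t⟧`. -/
noncomputable def extendAlgHom (g : A →ₐ[R] B⟦X⟧) : A⟦X⟧ →ₐ[R] B⟦X⟧ :=
  AlgHom.ofLinearMap (extendLinear g.toLinearMap)
    (by rw [← map_one C, extendLinear_C]; exact map_one g)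
    (fun x y => by
      simp only [extendLinear_apply, series_mul_series, coeff_mul, map_sum]
      simp)

theorem extendAlgHom_C (g : A →ₐ[R] B⟦X⟧) (a : A) : extendAlgHom g (C a) = g a :=
  extendLinear_C _ a

theorem isLinear_extendAlgHom (g : A →ₐ[R] B⟦X⟧) : IsLinear (extendAlgHom g).toLinearMap :=
  isLinear_extendLinear _

end Linear

/-! ### Uniqueness of the antipode. -/

section Antipode

variable {R A : Type*} [CommRing R] [Ring A] [Algebra R A]

/-- Two topological Hopf structures with the same coproduct and counit have the same antipode. -/
theorem HopfStructure.antipode_unique {Q Q' : HopfStructure R A} (hΔ : Q.comul = Q'.comul)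
    (hε : Q.counit = Q'.counit) : Q.antipode = Q'.antipode := by
  have hm : IsLinear (extend (LinearMap.mul' R A)) := isLinear_extend _
  have hs : IsLinear (extend (Algebra.linearMap R A)) := isLinear_extend _
  have hsc : ∀ c, extend (Algebra.linearMap R A) c = scalar R A c := fun c => by
    ext n; simp [extend, scalar]
  set S := Q.antipode
  set S' := Q'.antipode
  have hS : IsLinear S := Q.antipode_linear
  have hS' : IsLinear S' := Q'.antipode_linear
  set η : A⟦X⟧ →ₗ[R] A⟦X⟧ := extend (Algebra.linearMap R A) ∘ₗ Q.counit.toLinearMap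
  have hη : IsLinear η := hs.comp Q.counit_linear
  have hid : IsLinear (LinearMap.id : A⟦X⟧ →ₗ[R] A⟦X⟧) := isLinear_id
  -- The classical convolution argument S = S ∗ (Id ∗ S') = (S ∗ Id) ∗ S' = S'. Composed with Δ, the
  -- maps M and N become Id ∗ S' and S ∗ Id, both equal to the convolution unit η.
  set M := extend (LinearMap.mul' R A) ∘ₗ tensorMap LinearMap.id S'
  have hM : IsLinear M := hm.comp (isLinear_tensorMap _ _)
  set N := extend (LinearMap.mul' R A) ∘ₗ tensorMap S LinearMap.id
  have hN : IsLinear N := hm.comp (isLinear_tensorMap _ _)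
  have hMΔ : M ∘ₗ Q.comul.toLinearMap = η := LinearMap.ext fun x => by
    simp only [η, M, LinearMap.comp_apply, hsc]
    rw [hΔ, hε]; exact Q'.antipode_right x
  have hNΔ : N ∘ₗ Q.comul.toLinearMap = η := LinearMap.ext fun x => by
    simp only [η, N, LinearMap.comp_apply, hsc]
    exact Q.antipode_left x
  -- Associativity of the product, read on triple tensors: a ⊗ b ⊗ c goes to S(a) b S'(c) with
  -- either bracketing.
  have link : ∀ z, extend (LinearMap.mul' R A) (tensorMap S M
      (PowerSeries.map (Algebra.TensorProduct.assoc R R R A A A).toRingEquiv.toRingHom z)) =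
      extend (LinearMap.mul' R A) (tensorMap N S' z) := by
    refine PreservesSeries.congr_tmul
      (hm.preservesSeries.comp ((isLinear_tensorMap _ _).preservesSeries.comp
        (preservesSeries_map _)))
      (hm.preservesSeries.comp (isLinear_tensorMap _ _).preservesSeries)
      (by simp) (by simp) fun y c => ?_
    induction y with
    | zero => simp [mixedTmul]
    | add y y' h h' =>
      rw [map_add C y y', mixedTmul_add_left]
      simp only [map_add, h, h']
    | tmul a b =>
      rw [← mixedTmul_C, map_assoc_mixedTmul, tensorMap_mixedTmul hS hM, tensorMap_mixedTmul hN hS']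
      simp only [M, N, LinearMap.comp_apply]
      rw [tensorMap_mixedTmul hid hS', tensorMap_mixedTmul hS hid]
      simp only [extend_mul_mixedTmul, LinearMap.id_apply, mul_assoc]
  have right : ∀ z, extend (LinearMap.mul' R A) (tensorMap S η z) =
      S (PowerSeries.map (Algebra.TensorProduct.rid R R A).toRingEquiv.toRingHom
        (tensorMap LinearMap.id Q.counit.toLinearMap z)) := by
    refine PreservesSeries.congr_tmul
      (hm.preservesSeries.comp (isLinear_tensorMap _ _).preservesSeries)
      (hS.preservesSeries.comp ((preservesSeries_map _).comp
        (isLinear_tensorMap _ _).preservesSeries)) (by simp) (by simp) fun a b => ?_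
    rw [tensorMap_mixedTmul hS hη, tensorMap_mixedTmul hid Q.counit_linear, map_rid_mixedTmul,
      extend_mul_mixedTmul, ← scalar_commute, hS, scalar_commute]
    simp only [η, LinearMap.comp_apply, hsc, LinearMap.id_apply]
  have left : ∀ z, extend (LinearMap.mul' R A) (tensorMap η S' z) =
      S' (PowerSeries.map (Algebra.TensorProduct.lid R A).toRingEquiv.toRingHom
        (tensorMap Q.counit.toLinearMap LinearMap.id z)) := by
    refine PreservesSeries.congr_tmul
      (hm.preservesSeries.comp (isLinear_tensorMap _ _).preservesSeries)
      (hS'.preservesSeries.comp ((preservesSeries_map _).comp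
        (isLinear_tensorMap _ _).preservesSeries)) (by simp) (by simp) fun a b => ?_
    rw [tensorMap_mixedTmul hη hS', tensorMap_mixedTmul Q.counit_linear hid, map_lid_mixedTmul,
      extend_mul_mixedTmul, hS']
    simp only [η, LinearMap.comp_apply, hsc, LinearMap.id_apply]
  ext1 x
  -- By coassociativity, evaluating on the iterated coproduct turns the two sides into S ∗ η and η ∗
  -- S'.
  have h := link (tensorMap Q.comul.toLinearMap LinearMap.id (Q.comul x))
  rw [Q.coassoc, tensorMap_comp hS hM hid Q.comul_linear,
    tensorMap_comp hN hS' Q.comul_linear hid, hMΔ, hNΔ, LinearMap.comp_id, LinearMap.comp_id,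
    right, left, Q.counit_right, Q.counit_left] at h
  exact h

end Antipode

/-! ### Consequences of [h, e] = e for factorials and powers of 1 - et. -/

section Weights

variable {A : Type*} [Ring A]

theorem conjSeries_mul_C {H E x : A} {m : ℤ} {d : ℕ → A} (hx : H * x = x * H + m * x)
    (hE : Commute x E) (hd : ∀ l, Commute x (d l)) (c : ℤ) :
    conjSeries H E c d * C x = C x * conjSeries H E (c + m) d := by
  rw [conjSeries, conjSeries, series_mul_right, mul_series]
  congr 1; funext l
  have h1 : C (rising H c l) * C x = C x * C (rising H (c + m) l) := by
    rw [← map_mul, ← map_mul, rising_mul_of_weight hx]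
  have h2 : Commute (C x) (oneSubPow E (-(l : ℤ)) * C (d l)) :=
    (Commute.oneSubPow_right (hE.map C) _).mul_right ((hd l).map C)
  rw [mul_assoc, mul_assoc (C (rising H c l)), ← h2.eq, ← mul_assoc (C (rising H c l)), h1,
    mul_assoc (C x), ← mul_assoc, ← neg_one_pow_comm, mul_assoc]

/-- The derivation [h, ·] sends u = 1 - et to -et = u - 1, hence u^m to m u^{m-1} (u - 1). -/
theorem C_mul_oneSubPow_of_weight {h e : A} (he : h * e = e * h + e) (m : ℤ) :
    C h * oneSubPow e m =
      oneSubPow e m * C h + (m : A⟦X⟧) * (oneSubPow e m - oneSubPow e (m - 1)) := by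
  have h1 : C h * oneSubPow e 1 = oneSubPow e 1 * C h + (oneSubPow e 1 - 1) := by
    rw [oneSubPow_one, mul_sub, ← mul_assoc, ← map_mul, he, map_add, map_mul, sub_mul,
      mul_assoc (C e), (PowerSeries.commute_X (C h)).symm.eq]
    noncomm_ring
  have hm1 : C h * oneSubPow e (-1) = oneSubPow e (-1) * C h -
      (oneSubPow e (-1) - oneSubPow e (-1) * oneSubPow e (-1)) := by
    calc C h * oneSubPow e (-1)
        = oneSubPow e (-1) * (oneSubPow e 1 * C h) * oneSubPow e (-1) := by
          rw [← mul_assoc, oneSubPow_neg_mul, one_mul]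
      _ = oneSubPow e (-1) * (C h * oneSubPow e 1 - (oneSubPow e 1 - 1)) * oneSubPow e (-1) := by
          rw [h1]; abel_nf
      _ = oneSubPow e (-1) * C h * (oneSubPow e 1 * oneSubPow e (-1)) -
          ((oneSubPow e (-1) * oneSubPow e 1) * oneSubPow e (-1) -
            oneSubPow e (-1) * oneSubPow e (-1)) := by noncomm_ring
      _ = _ := by rw [oneSubPow_mul_neg, oneSubPow_neg_mul, mul_one, one_mul]
  induction m with
  | zero => simp [oneSubPow_zero]
  | succ m ih =>
    have e1 : oneSubPow e (m + 1 - 1) = oneSubPow e m := by congr 1; ring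
    have e2 : oneSubPow e m = oneSubPow e (m - 1) * oneSubPow e 1 := by
      rw [← oneSubPow_add]; congr 1; ring
    rw [e1, oneSubPow_add, ← mul_assoc, ih, add_mul, mul_assoc _ (C h), h1, mul_assoc (_ : A⟦X⟧),
      sub_mul, ← e2]
    push_cast
    noncomm_ring
  | pred m ih =>
    have e1 : oneSubPow e (-m - 1) = oneSubPow e (-m) * oneSubPow e (-1) := by
      rw [← oneSubPow_add]; congr 1
    have e2 : oneSubPow e (-m - 1 - 1) = oneSubPow e (-m) * (oneSubPow e (-1) * oneSubPow e (-1)) := by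
      rw [← oneSubPow_add, ← oneSubPow_add]; congr 1; ring
    rw [e2, e1, ← mul_assoc, ih, add_mul, mul_assoc _ (C h), hm1, mul_assoc (_ : A⟦X⟧), e1]
    push_cast
    noncomm_ring

/-- `(h u)^{[l]} = h^{[l]} u^l` for `u = 1 - e t`. -/
theorem falling_C_mul_oneSubPow {h e : A} (he : h * e = e * h + e) (l : ℕ) :
    falling (C h * oneSubPow e 1) 0 l = C (falling h 0 l) * oneSubPow e l := by
  induction l with
  | zero => simp [falling, oneSubPow_zero]
  | succ l ih =>
    have h1 := C_mul_oneSubPow_of_weight he l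
    have e2 : oneSubPow e l = oneSubPow e (l - 1) * oneSubPow e 1 := by
      rw [← oneSubPow_add]; congr 1; ring
    -- For u = 1 - et this reads u^l h u = (h - l) u^{l+1} + l u^l. The last term cancels against
    -- the -l in the next factor h u - l.
    have h2 : oneSubPow e l * (C h * oneSubPow e 1) =
        (C h - (l : A⟦X⟧)) * (oneSubPow e l * oneSubPow e 1) + l * oneSubPow e l := by
      rw [← mul_assoc, eq_sub_of_add_eq h1.symm]
      conv_rhs => rw [e2]
      simp only [sub_mul, mul_sub, Int.cast_natCast]
      conv_lhs => rw [mul_assoc (l : A⟦X⟧) (oneSubPow e (l - 1)), ← e2]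
      rw [← e2]
      noncomm_ring
    rw [falling, ih, falling, mul_assoc, mul_sub, mul_add, h2]
    push_cast
    rw [oneSubPow_add, map_mul, mul_assoc, map_sub, map_natCast, (Nat.cast_commute l _).eq]
    simp

/-- `(y + x v)^{⟨n⟩} = ∑ (n choose i) v^i y^{⟨j⟩} x^{⟨i⟩}` when `y v = v y - v + v^2`. -/
theorem rising_add_mul {x y v : A} (hxy : Commute x y) (hxv : Commute x v)
    (hyv : y * v = v * y - v + v * v) (n : ℕ) :
    rising (y + x * v) 0 n = ∑ p ∈ Finset.HasAntidiagonal.antidiagonal n,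
      (n.choose p.1 : A) * (v ^ p.1 * rising y 0 p.2 * rising x 0 p.1) := by
  -- The derivation [y, ·] sends v to v^2 - v, hence v^l to l (v^{l+1} - v^l).
  have hpow : ∀ l : ℕ, y * v ^ l = v ^ l * (y - l + l * v) := by
    intro l
    induction l with
    | zero => simp
    | succ l ih =>
      rw [pow_succ, ← mul_assoc, ih, mul_assoc, mul_assoc]
      congr 1
      rw [add_mul, sub_mul, hyv]
      push_cast
      have : (l : A) * v = v * l := (Nat.cast_commute l v).eq
      rw [mul_add, mul_sub, mul_add, add_mul, mul_add, one_mul, this, mul_assoc v (l : A) v, this]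
      noncomm_ring
  induction n with
  | zero => simp [rising]
  | succ n ih =>
    have hcomm : rising (y + x * v) 0 (n + 1) = (y + x * v + n) * rising (y + x * v) 0 n := by
      rw [rising]
      have := (Commute.rising_right (Commute.refl (y + x * v)) 0 n).eq
      rw [mul_add, mul_add, ← this]
      simp [add_mul, (Nat.cast_commute n (rising (y + x * v) 0 n)).eq]
    rw [hcomm, ih, Finset.sum_antidiagonal_choose_succ_mul
      (fun i j => v ^ i * rising y 0 j * rising x 0 i), Finset.mul_sum, ← Finset.sum_add_distrib]
    refine Finset.sum_congr rfl fun p hp => ?_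
    have hn : (n : A) = p.1 + p.2 := by
      rw [← Finset.HasAntidiagonal.mem_antidiagonal.1 hp]; push_cast; rfl
    have hc : n.choose p.2 = n.choose p.1 := by
      rw [Nat.choose_symm_of_eq_add]
      rw [← Finset.HasAntidiagonal.mem_antidiagonal.1 hp, add_comm]
    obtain ⟨i, j⟩ := p
    dsimp only at hn hc ⊢
    have hxv' : x * v ^ i = v ^ i * x := (hxv.pow_right i).eq
    have hv : v * v ^ i = v ^ (i + 1) := (pow_succ' v i).symm
    have hxr : x * rising y 0 j = rising y 0 j * x := (Commute.rising_right hxy 0 j).eq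
    have hxr' : x * rising x 0 i = rising x 0 i * x := (Commute.rising_right (Commute.refl x) 0 i).eq
    have hyr : y * rising y 0 j = rising y 0 j * y := (Commute.rising_right (Commute.refl y) 0 j).eq
    -- Since n = i + j, the new factor becomes, to the right of v^i, the sum of y + j, which extends
    -- the factorial of y, and v (x + i), which extends that of x.
    have key : (y + x * v + n) * (v ^ i * rising y 0 j * rising x 0 i) =
        v ^ i * rising y 0 (j + 1) * rising x 0 i + v ^ (i + 1) * rising y 0 j * rising x 0 (i + 1) := by
      have e1 : (x * v) * v ^ i = v ^ (i + 1) * x := by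
        rw [mul_assoc, hv, (hxv.pow_right (i + 1)).eq]
      have e2 : (y + x * v + n) * v ^ i = v ^ i * (y + j) + v ^ (i + 1) * (x + i) := by
        rw [add_mul, add_mul, hpow, e1, hn, add_mul, (Nat.cast_commute i (v ^ i)).eq,
          (Nat.cast_commute j (v ^ i)).eq, (Nat.cast_commute i v).eq, mul_add, mul_sub, ← mul_assoc,
          ← pow_succ]
        noncomm_ring
      have e3 : (y + j) * rising y 0 j = rising y 0 (j + 1) := by
        rw [rising, add_mul, hyr, (Nat.cast_commute j (rising y 0 j)).eq]; simp [mul_add]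
      have e4 : (x + i) * rising y 0 j * rising x 0 i = rising y 0 j * rising x 0 (i + 1) := by
        rw [rising, add_mul, hxr, (Nat.cast_commute i (rising y 0 j)).eq, ← mul_add, mul_assoc,
          add_mul, hxr', (Nat.cast_commute i (rising x 0 i)).eq]; simp [mul_add]
      rw [mul_assoc (v ^ i), ← mul_assoc, e2, add_mul, ← mul_assoc, mul_assoc (v ^ i) (y + j), e3,
        mul_assoc (v ^ (i + 1)), ← mul_assoc (x + i : A), e4]
      noncomm_ring
    rw [hc, ← mul_assoc, ← (Nat.cast_commute _ _).eq, mul_assoc, key, mul_add]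

theorem op_rising (x : A) (a : ℤ) (l : ℕ) :
    rising (MulOpposite.op x) a l = MulOpposite.op (rising x a l) := by
  induction l with
  | zero => rfl
  | succ l ih =>
    rw [rising, ih, rising]
    have : Commute (rising x a l) (x + a + l) :=
      ((Commute.rising_right (Commute.refl x) a l).symm.add_right
        (Int.commute_cast _ a)).add_right (Nat.commute_cast _ l)
    rw [this.eq, MulOpposite.op_mul]
    simp

end Weights

end Topological

/-! ### Lie algebras with integral weights and divided powers of ad e. -/

/-- Elements `h, e` of a torsion free Lie algebra with `[h, e] = e` such that `ad h` is
diagonalizable with integral weights and `ad e` has divided powers `D_l`. -/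
structure JordanianData (R L : Type*) [CommRing R] [LieRing L] [LieAlgebra R L] where
  h : L
  e : L
  /-- The divided power `(ad e)^l / l!`. -/
  D : ℕ → L →ₗ[R] L
  /-- The decomposition into weight vectors. -/
  decomp : L →ₗ[R] (ℤ →₀ L)
  lie_h_e : ⁅h, e⁆ = e
  torsionFree : ∀ (n : ℕ) (x : L), n ≠ 0 → n • x = 0 → x = 0
  factorial_smul_D : ∀ l x, l.factorial • D l x = (LieDerivation.ad R L e)^[l] x
  decomp_of_weight : ∀ (m : ℤ) (x : L), ⁅h, x⁆ = m • x → decomp x = Finsupp.single m x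
  span_weights : Submodule.span R {x : L | ∃ m : ℤ, ⁅h, x⁆ = m • x} = ⊤

namespace JordanianData

variable {R L : Type*} [CommRing R] [LieRing L] [LieAlgebra R L]

theorem smul_cancel (T : JordanianData R L) {n : ℕ} (hn : n ≠ 0) {x y : L} (h : n • x = n • y) : x = y :=
  sub_eq_zero.1 (T.torsionFree n _ hn (by rw [smul_sub, h, sub_self]))

variable (T : JordanianData R L)

theorem D_zero (x : L) : T.D 0 x = x := by simpa using T.factorial_smul_D 0 x

/-- After multiplication by factorials an identity between divided powers becomes one between
iterates of ad e; torsion-freeness removes the factorials again. `D_D` and `D_lie` are obtained in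
the same way. -/
theorem lie_e_D (l : ℕ) (x : L) : ⁅T.e, T.D l x⁆ = (l + 1) • T.D (l + 1) x := by
  refine T.smul_cancel (Nat.factorial_ne_zero l) ?_
  rw [smul_smul, mul_comm, ← Nat.factorial_succ, T.factorial_smul_D, Function.iterate_succ_apply',
    ← T.factorial_smul_D, map_nsmul, LieDerivation.ad_apply_apply]

theorem D_D (i j : ℕ) (x : L) : T.D i (T.D j x) = (i + j).choose i • T.D (i + j) x := by
  refine T.smul_cancel (Nat.factorial_ne_zero i) (T.smul_cancel (Nat.factorial_ne_zero j) ?_)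
  have hj : ∀ z, j.factorial • (T.D i z) = T.D i (j.factorial • z) := fun z => (map_nsmul _ _ _).symm
  rw [smul_comm, hj, T.factorial_smul_D, T.factorial_smul_D, ← Function.iterate_add_apply,
    ← T.factorial_smul_D, smul_smul, smul_smul]
  congr 1
  rw [← Nat.add_choose_mul_factorial_mul_factorial i j, Nat.choose_symm_add]; ring

theorem D_lie (n : ℕ) (x y : L) : T.D n ⁅x, y⁆ =
    ∑ p ∈ Finset.HasAntidiagonal.antidiagonal n, ⁅T.D p.1 x, T.D p.2 y⁆ := by
  refine T.smul_cancel (Nat.factorial_ne_zero n) ?_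
  rw [T.factorial_smul_D, LieDerivation.iterate_apply_lie, Finset.smul_sum]
  refine Finset.sum_congr rfl fun p hp => ?_
  rw [← T.factorial_smul_D, ← T.factorial_smul_D, nsmul_lie, lie_nsmul, smul_smul, smul_smul,
    ← Finset.HasAntidiagonal.mem_antidiagonal.1 hp, ← Nat.add_choose_mul_factorial_mul_factorial,
    Nat.choose_symm_add]

variable {T} in
-- As e has weight 1, each application of ad e raises the weight by 1.
theorem lie_h_D {m : ℤ} {x : L} (hx : ⁅T.h, x⁆ = m • x) (l : ℕ) :
    ⁅T.h, T.D l x⁆ = (m + l) • T.D l x := by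
  induction l with
  | zero => simpa [D_zero] using hx
  | succ l ih =>
    refine T.smul_cancel (Nat.succ_ne_zero l) ?_
    rw [← lie_nsmul, ← lie_e_D, leibniz_lie, T.lie_h_e, ih, lie_zsmul, lie_e_D]
    push_cast
    module

theorem D_e (l : ℕ) : T.D (l + 1) T.e = 0 := by
  refine T.torsionFree _ _ (Nat.factorial_ne_zero (l + 1)) ?_
  rw [T.factorial_smul_D, Function.iterate_succ_apply]
  simp only [LieDerivation.ad_apply_apply, lie_self]
  exact iterate_map_zero _ l

theorem D_one (x : L) : T.D 1 x = ⁅T.e, x⁆ := by simpa using T.factorial_smul_D 1 x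

theorem D_one_h : T.D 1 T.h = -T.e := by rw [D_one, ← lie_skew, T.lie_h_e]

/-- Since ad e sends h to -e and e to 0, the series for Δ(h) and S(h) stop after the term of degree
1. -/
theorem D_h (l : ℕ) : T.D (l + 2) T.h = 0 := by
  refine T.torsionFree (l + 2) _ (by omega) ?_
  have := T.lie_e_D (l + 1) T.h
  rw [← this]
  induction l with
  | zero => rw [zero_add, D_one_h, lie_neg, lie_self, neg_zero]
  | succ l ih =>
    rw [T.torsionFree (l + 2) _ (by omega) ((T.lie_e_D (l + 1) T.h).symm.trans
      (ih (T.lie_e_D (l + 1) T.h))), lie_zero]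

end JordanianData

/-! ### The deformed coproduct and antipode on generators, extended to U(L). -/

namespace JordanianData

section

attribute [local instance 100] LieRing.ofAssociativeRing
attribute [local instance 2000] Algebra.toModule

variable {R L : Type*} [CommRing R] [LieRing L] [LieAlgebra R L] (T : JordanianData R L)

open UniversalEnvelopingAlgebra (ι)

local notation "𝔘" => UniversalEnvelopingAlgebra R L

/-- A linear map is a Lie algebra map if it is one on a spanning set. -/
theorem lie_of_span {A : Type*} [Ring A] [Algebra R A] (f : L →ₗ[R] A) {s : Set L}
    (hs : Submodule.span R s = ⊤)
    (hf : ∀ x ∈ s, ∀ y ∈ s, f ⁅x, y⁆ = f x * f y - f y * f x) (x y : L) :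
    f ⁅x, y⁆ = f x * f y - f y * f x := by
  have hx : x ∈ Submodule.span R s := hs ▸ Submodule.mem_top
  have hy : y ∈ Submodule.span R s := hs ▸ Submodule.mem_top
  induction hx using Submodule.span_induction with
  | zero => simp
  | add x x' _ _ h h' => rw [add_lie, map_add, map_add, h, h', add_mul, mul_add]; abel
  | smul c x _ h => rw [smul_lie, map_smul, map_smul, h, smul_mul_assoc, mul_smul_comm, smul_sub]
  | mem x hx =>
    induction hy using Submodule.span_induction with
    | zero => simp
    | add x x' _ _ h h' => rw [lie_add, map_add, map_add, h, h', add_mul, mul_add]; abel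
    | smul c x _ h => rw [lie_smul, map_smul, map_smul, h, smul_mul_assoc, mul_smul_comm, smul_sub]
    | mem y hy => exact hf x hx y hy

theorem ι_lie (x y : L) : ι R ⁅x, y⁆ = ι R x * ι R y - ι R y * ι R x := by
  rw [LieHom.map_lie, LieRing.of_associative_ring_bracket]

/-- `h` as an element of the enveloping algebra. -/
noncomputable def hU : 𝔘 := ι R T.h

/-- `e` as an element of the enveloping algebra. -/
noncomputable def eU : 𝔘 := ι R T.e

/-- `D_l x` as an element of the enveloping algebra. -/
noncomputable def dU (x : L) (l : ℕ) : 𝔘 := ι R (T.D l x)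

theorem hU_mul_eU : T.hU * T.eU = T.eU * T.hU + T.eU := by
  have := ι_lie (R := R) T.h T.e
  rw [T.lie_h_e] at this
  exact (add_eq_of_eq_sub' this).symm

theorem eU_mul_dU (x : L) (l : ℕ) :
    T.eU * T.dU x l - T.dU x l * T.eU = (l + 1 : 𝔘) * T.dU x (l + 1) := by
  have := ι_lie (R := R) T.e (T.D l x)
  rw [T.lie_e_D, map_nsmul, nsmul_eq_mul] at this
  rw [eU, dU, ← this, dU]
  push_cast
  rfl

variable {T} in
theorem hU_mul_ι {m : ℤ} {x : L} (hx : ⁅T.h, x⁆ = m • x) :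
    T.hU * ι R x = ι R x * T.hU + (m : 𝔘) * ι R x := by
  have := ι_lie (R := R) T.h x
  rw [hx, map_zsmul, zsmul_eq_mul] at this
  exact (add_eq_of_eq_sub' this).symm

variable {T} in
theorem hU_mul_dU {m : ℤ} {x : L} (hx : ⁅T.h, x⁆ = m • x) (l : ℕ) :
    T.hU * T.dU x l = T.dU x l * T.hU + (m + l : ℤ) * T.dU x l :=
  hU_mul_ι (lie_h_D hx l)

theorem dU_lie (x y : L) (n : ℕ) : T.dU ⁅x, y⁆ n =
    ∑ p ∈ Finset.HasAntidiagonal.antidiagonal n,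
      (T.dU x p.1 * T.dU y p.2 - T.dU y p.2 * T.dU x p.1) := by
  rw [dU, T.D_lie, map_sum]
  exact Finset.sum_congr rfl fun p _ => ι_lie _ _

theorem dU_D (x : L) (i j : ℕ) : T.dU (T.D j x) i = ((i + j).choose i : 𝔘) * T.dU x (i + j) := by
  rw [dU, T.D_D, map_nsmul, nsmul_eq_mul, dU]

theorem dU_zero (x : L) : T.dU x 0 = ι R x := by rw [dU, D_zero]

/-- `1 ⊗ a`. -/
noncomputable abbrev right : 𝔘 →+* 𝔘 ⊗[R] 𝔘 :=
  (Algebra.TensorProduct.includeRight (R := R) (A := 𝔘) (B := 𝔘)).toRingHom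

/-- `a ⊗ 1`. -/
noncomputable abbrev left : 𝔘 →+* 𝔘 ⊗[R] 𝔘 :=
  (Algebra.TensorProduct.includeLeft (R := R) (S := R) (A := 𝔘) (B := 𝔘)).toRingHom

theorem left_right_commute (a b : 𝔘) : Commute (left (R := R) (L := L) a) (right b) := by
  simp [commute_iff_eq]

/-- `(1 - e t)^h (1 ⊗ x) (1 - e t)^{-h}`, where `h` is in the first tensor factor and `e` in the
second. -/
noncomputable def conjRight : L →ₗ[R] (𝔘 ⊗[R] 𝔘)⟦X⟧ where
  toFun x := conjSeries (left T.hU) (right T.eU) 0 fun l => right (T.dU x l)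
  map_add' x y := by
    simp only [dU, map_add, conjSeries, mul_add, series_add]
  map_smul' c x := by
    have : ∀ l, right (T.dU (c • x) l) = algebraMap R (𝔘 ⊗[R] 𝔘) c * right (T.dU x l) := fun l => by
      simp only [dU, map_smul, Algebra.smul_def, map_mul]
      congr 1
      exact AlgHom.commutes (Algebra.TensorProduct.includeRight (R := R) (A := 𝔘) (B := 𝔘)) c
    rw [RingHom.id_apply, smul_eq_C_algebraMap_mul]
    simp only [this, map_mul, conjSeries, mul_series]
    congr 1; funext l
    have hc : ∀ z : (𝔘 ⊗[R] 𝔘)⟦X⟧, C (algebraMap R (𝔘 ⊗[R] 𝔘) c) * z = z * C (algebraMap R _ c) :=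
      fun z => by rw [← scalar_C, scalar_commute]
    simp only [← mul_assoc, hc]

theorem conjRight_apply (x : L) : T.conjRight x =
    conjSeries (left T.hU) (right T.eU) 0 fun l => right (T.dU x l) := rfl

/-- `(1 - e t)^h (x ⊗ 1) (1 - e t)^{-h}`, where `h` is in the first tensor factor and `e` in the
second. -/
noncomputable def conjLeft : L →ₗ[R] (𝔘 ⊗[R] 𝔘)⟦X⟧ :=
  -- The exponent of 1 - et is the weight of x, so a linear map can only be defined through the
  -- decomposition into weight components.
  Finsupp.lsum R (fun m : ℤ =>
    LinearMap.mk (AddHom.mk (fun x : L => C (left (ι R x)) * oneSubPow (right T.eU) m)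
      (fun x y => by simp only [map_add, add_mul]))
      (fun c x => by
        have : left (ι R (c • x)) = algebraMap R (𝔘 ⊗[R] 𝔘) c * left (ι R x) := by
          simp only [map_smul, Algebra.smul_def, map_mul]
          congr 1
        change C (left (ι R (c • x))) * _ = c • (C (left (ι R x)) * _)
        rw [smul_eq_C_algebraMap_mul, this, map_mul, mul_assoc])) ∘ₗ T.decomp

variable {T} in
theorem conjLeft_of_weight {m : ℤ} {x : L} (hx : ⁅T.h, x⁆ = m • x) :
    T.conjLeft x = C (left (ι R x)) * oneSubPow (right T.eU) m := by
  rw [conjLeft, LinearMap.comp_apply, T.decomp_of_weight m x hx, Finsupp.lsum_single]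
  rfl

theorem right_eU_dU (x : L) (l : ℕ) :
    right T.eU * right (T.dU x l) - right (T.dU x l) * right T.eU =
      (l + 1 : 𝔘 ⊗[R] 𝔘) * right (T.dU x (l + 1)) := by
  rw [← map_mul, ← map_mul, ← map_sub, T.eU_mul_dU, map_mul, map_add, map_natCast, map_one]

/-- Conjugation is multiplicative and D_n obeys the Leibniz rule. Multiplicativity comes from
`conjSeries_mul_conjSeries`, since (1 - et)^h itself has denominators and is not available over R.
-/
theorem conjRight_mul (x y : L) : T.conjRight x * T.conjRight y - T.conjRight y * T.conjRight x =
    T.conjRight ⁅x, y⁆ := by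
  have hHe := left_right_commute T.hU T.eU
  have hH : ∀ x l, Commute (left T.hU) (right (T.dU x l)) := fun x l => left_right_commute _ _
  rw [conjRight_apply, conjRight_apply, conjRight_apply,
    conjSeries_mul_conjSeries hHe (hH x) (T.right_eU_dU x),
    conjSeries_mul_conjSeries hHe (hH y) (T.right_eU_dU y), conjSeries, conjSeries, conjSeries,
    ← series_sub]
  congr 1; funext n
  rw [← mul_sub, ← mul_sub, ← mul_sub, ← map_sub, T.dU_lie]
  congr 4
  rw [← Finset.Nat.sum_antidiagonal_swap, ← Finset.sum_sub_distrib, map_sum]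
  refine Finset.sum_congr rfl fun p _ => ?_
  rw [map_sub, map_mul, map_mul]
  rfl

variable {T} in
-- The conjugates of x ⊗ 1 and 1 ⊗ y must commute. Passing x ⊗ 1 and passing (1 - et)^m shift the
-- exponent of the series by m in opposite directions.
theorem conjLeft_mul_conjRight {m : ℤ} {x : L} (hx : ⁅T.h, x⁆ = m • x) (y : L) :
    T.conjLeft x * T.conjRight y = T.conjRight y * T.conjLeft x := by
  have hw : left T.hU * left (ι R x) = left (ι R x) * left T.hU + (m : 𝔘 ⊗[R] 𝔘) * left (ι R x) := by
    rw [← map_mul, hU_mul_ι hx, map_add, map_mul, map_mul, map_intCast]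
  rw [conjLeft_of_weight hx, conjRight_apply, mul_assoc,
    oneSubPow_mul_conjSeries (left_right_commute _ _) (T.right_eU_dU y), ← mul_assoc, ← mul_assoc,
    conjSeries_mul_C hw (left_right_commute _ _) (fun l => left_right_commute _ _)]

variable {T} in
theorem conjLeft_mul {m m' : ℤ} {x y : L} (hx : ⁅T.h, x⁆ = m • x) (hy : ⁅T.h, y⁆ = m' • y) :
    T.conjLeft x * T.conjLeft y - T.conjLeft y * T.conjLeft x = T.conjLeft ⁅x, y⁆ := by
  have hxy : ⁅T.h, ⁅x, y⁆⁆ = (m + m') • ⁅x, y⁆ := by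
    rw [leibniz_lie, hx, hy, zsmul_lie, lie_zsmul, add_smul]
  have hc : ∀ (z : L) (m : ℤ), Commute (C (left (ι R z))) (oneSubPow (right T.eU) m) := fun z m =>
    Commute.oneSubPow_right ((left_right_commute _ _).map C) m
  rw [conjLeft_of_weight hx, conjLeft_of_weight hy, conjLeft_of_weight hxy, ι_lie, map_sub, map_sub,
    mul_assoc, ← mul_assoc (oneSubPow _ m), ← (hc y m).eq, mul_assoc, ← oneSubPow_add,
    mul_assoc, ← mul_assoc (oneSubPow _ m'), ← (hc x m').eq, mul_assoc, ← oneSubPow_add,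
    add_comm m', ← mul_assoc, ← mul_assoc, ← sub_mul]
  simp only [map_mul]

/-- The deformed coproduct on the Lie algebra. -/
noncomputable def comulL : L →ₗ[R] (𝔘 ⊗[R] 𝔘)⟦X⟧ := T.conjLeft + T.conjRight

theorem comulL_lie (x y : L) :
    T.comulL ⁅x, y⁆ = T.comulL x * T.comulL y - T.comulL y * T.comulL x := by
  refine lie_of_span T.comulL T.span_weights ?_ x y
  rintro x ⟨m, hx⟩ y ⟨m', hy⟩
  simp only [comulL, LinearMap.add_apply]
  rw [← conjLeft_mul hx hy, ← conjRight_mul, add_mul, add_mul, mul_add, mul_add, mul_add, mul_add,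
    conjLeft_mul_conjRight hx, conjLeft_mul_conjRight hy]
  abel

/-- The deformed coproduct on the enveloping algebra. -/
noncomputable def comulU : 𝔘 →ₐ[R] (𝔘 ⊗[R] 𝔘)⟦X⟧ :=
  UniversalEnvelopingAlgebra.lift R
    { T.comulL with
      map_lie' := fun {x y} => by
        rw [LieRing.of_associative_ring_bracket]; exact T.comulL_lie x y }

theorem comulU_ι (x : L) : T.comulU (ι R x) = T.comulL x :=
  UniversalEnvelopingAlgebra.lift_ι_apply R _ x

/-- The deformed antipode on the Lie algebra. -/
noncomputable def antipodeL : L →ₗ[R] 𝔘⟦X⟧ :=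
  -(Finsupp.lsum R (fun m : ℤ =>
    LinearMap.mk (AddHom.mk (fun x : L => oneSubPow T.eU (-m) * antiSeries T.hU 1 (T.dU x))
      (fun x y => by
        rw [← mul_add, antiSeries, antiSeries, antiSeries, ← series_add]
        simp only [dU, map_add, add_mul]))
      (fun c x => by
        have hc : ∀ z : 𝔘⟦X⟧, C (algebraMap R 𝔘 c) * z = z * C (algebraMap R 𝔘 c) :=
          fun z => by rw [← scalar_C, scalar_commute]
        have : antiSeries T.hU 1 (T.dU (c • x)) =
            C (algebraMap R 𝔘 c) * antiSeries T.hU 1 (T.dU x) := by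
          rw [antiSeries, antiSeries, mul_series]
          simp only [dU, map_smul, Algebra.smul_def, map_mul, mul_assoc]
        change oneSubPow T.eU (-m) * antiSeries T.hU 1 (T.dU (c • x)) =
          c • (oneSubPow T.eU (-m) * antiSeries T.hU 1 (T.dU x))
        rw [smul_eq_C_algebraMap_mul, this, ← mul_assoc, ← hc, mul_assoc])) ∘ₗ T.decomp)

variable {T} in
theorem antipodeL_of_weight {m : ℤ} {x : L} (hx : ⁅T.h, x⁆ = m • x) :
    T.antipodeL x = -(oneSubPow T.eU (-m) * antiSeries T.hU 1 (T.dU x)) := by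
  rw [antipodeL, LinearMap.neg_apply, LinearMap.comp_apply, T.decomp_of_weight m x hx,
    Finsupp.lsum_single]
  rfl

variable {T} in
-- Pulling (1 - et)^{-m'} to the left moves the starting point of the first factorial from 1 to 1 -
-- m', which is the one required by `antiSeries_mul_antiSeries`.
theorem antipodeL_mul {m m' : ℤ} {x y : L} (hx : ⁅T.h, x⁆ = m • x) (hy : ⁅T.h, y⁆ = m' • y) :
    T.antipodeL x * T.antipodeL y = oneSubPow T.eU (-(m + m')) *
      antiSeries T.hU 1 fun n => ∑ p ∈ Finset.HasAntidiagonal.antidiagonal n,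
        T.dU x p.1 * T.dU y p.2 := by
  rw [antipodeL_of_weight hx, antipodeL_of_weight hy, neg_mul_neg, mul_assoc,
    ← mul_assoc (antiSeries _ _ _), antiSeries_mul_oneSubPow T.hU_mul_eU (T.eU_mul_dU x),
    mul_assoc, ← sub_eq_add_neg, antiSeries_mul_antiSeries (hU_mul_dU hy), ← mul_assoc,
    ← oneSubPow_add, neg_add]

theorem antipodeL_lie (x y : L) :
    T.antipodeL ⁅x, y⁆ = T.antipodeL y * T.antipodeL x - T.antipodeL x * T.antipodeL y := by
  -- S reverses commutators exactly when -S preserves them, so the spanning criterion is applied to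
  -- -S.
  have key := lie_of_span (-T.antipodeL) T.span_weights (fun x hx y hy => ?_) x y
  · simpa [neg_eq_iff_eq_neg] using key
  obtain ⟨m, hx⟩ := hx
  obtain ⟨m', hy⟩ := hy
  have hxy : ⁅T.h, ⁅x, y⁆⁆ = (m + m') • ⁅x, y⁆ := by
    rw [leibniz_lie, hx, hy, zsmul_lie, lie_zsmul, add_smul]
  simp only [LinearMap.neg_apply, neg_mul_neg]
  rw [antipodeL_of_weight hxy, neg_neg, antipodeL_mul hx hy, antipodeL_mul hy hx, add_comm m' m,
    ← mul_sub, antiSeries, antiSeries, antiSeries, ← series_sub]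
  congr 2; funext n
  rw [← sub_mul, ← map_sub, T.dU_lie]
  congr 2
  rw [← Finset.Nat.sum_antidiagonal_swap (f := fun p => T.dU y p.1 * T.dU x p.2),
    ← Finset.sum_sub_distrib]
  rfl

/-- The deformed antipode on the enveloping algebra, as a map to the opposite algebra. -/
noncomputable def antipodeOpU : 𝔘 →ₐ[R] (𝔘⟦X⟧)ᵐᵒᵖ :=
  UniversalEnvelopingAlgebra.lift R
    { (MulOpposite.opLinearEquiv R).toLinearMap ∘ₗ T.antipodeL with
      map_lie' := fun {x y} => by
        rw [LieRing.of_associative_ring_bracket]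
        change MulOpposite.op (T.antipodeL ⁅x, y⁆) =
          MulOpposite.op (T.antipodeL x) * MulOpposite.op (T.antipodeL y) -
            MulOpposite.op (T.antipodeL y) * MulOpposite.op (T.antipodeL x)
        rw [antipodeL_lie, MulOpposite.op_sub, MulOpposite.op_mul, MulOpposite.op_mul] }

/-- The deformed antipode on the enveloping algebra. -/
noncomputable def antipodeU : 𝔘 →ₗ[R] 𝔘⟦X⟧ :=
  (MulOpposite.opLinearEquiv R).symm.toLinearMap ∘ₗ T.antipodeOpU.toLinearMap

theorem antipodeU_ι (x : L) : T.antipodeU (ι R x) = T.antipodeL x :=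
  congrArg MulOpposite.unop (UniversalEnvelopingAlgebra.lift_ι_apply R _ x)

theorem antipodeU_mul (a b : 𝔘) : T.antipodeU (a * b) = T.antipodeU b * T.antipodeU a := by
  simp [antipodeU]

theorem antipodeU_one : T.antipodeU 1 = 1 := by simp [antipodeU]

end

end JordanianData

/-! ### Algebra maps on completed tensor products, and bookkeeping for pure tensors. -/

namespace Topological

variable {R A B A' B' : Type*} [CommRing R] [Ring A] [Algebra R A] [Ring B] [Algebra R B]
  [Ring A'] [Algebra R A'] [Ring B'] [Algebra R B']

/-- Coefficientwise extension of an algebra map. -/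
noncomputable def mapAlg (φ : A →ₐ[R] B) : A⟦X⟧ →ₐ[R] B⟦X⟧ :=
  { PowerSeries.map φ.toRingHom with
    commutes' := fun r => by
      change PowerSeries.map φ.toRingHom (algebraMap R A⟦X⟧ r) = _
      rw [algebraMap_eq_C, algebraMap_eq_C, PowerSeries.map_C]
      simp }

theorem mapAlg_apply (φ : A →ₐ[R] B) (x : A⟦X⟧) :
    mapAlg φ x = PowerSeries.map φ.toRingHom x := rfl

theorem isLinear_mapAlg (φ : A →ₐ[R] B) : IsLinear (mapAlg φ).toLinearMap := fun c x => by
  ext n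
  simp [mapAlg_apply, coeff_mul, scalar]

theorem IsLinear.comp_algHom {g : B⟦X⟧ →ₐ[R] B'⟦X⟧} {f : A⟦X⟧ →ₐ[R] B⟦X⟧}
    (hg : IsLinear g.toLinearMap) (hf : IsLinear f.toLinearMap) :
    IsLinear (g.comp f).toLinearMap := hg.comp hf

/-- The constants of `A⟦t⟧`. -/
noncomputable def constAlg (R A : Type*) [CommRing R] [Ring A] [Algebra R A] : A →ₐ[R] A⟦X⟧ :=
  { (C : A →+* A⟦X⟧) with commutes' := fun r => (algebraMap_eq_C r).symm }

/-- The completed tensor product of two algebra maps. -/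
noncomputable def tensorAlg (f : A⟦X⟧ →ₐ[R] B⟦X⟧) (g : A'⟦X⟧ →ₐ[R] B'⟦X⟧)
    (hf : IsLinear f.toLinearMap) (hg : IsLinear g.toLinearMap) :
    (A ⊗[R] A')⟦X⟧ →ₐ[R] (B ⊗[R] B')⟦X⟧ :=
  AlgHom.ofLinearMap (tensorMap f.toLinearMap g.toLinearMap)
    (by
      rw [← mixedTmul_one_one (R := R) (A := A) (B := A'), tensorMap_mixedTmul hf hg]
      simp [mixedTmul_one_one])
    (tensorMap_mul hf hg (map_mul f) (map_mul g))

theorem isLinear_tensorAlg (f : A⟦X⟧ →ₐ[R] B⟦X⟧) (g : A'⟦X⟧ →ₐ[R] B'⟦X⟧)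
    (hf : IsLinear f.toLinearMap) (hg : IsLinear g.toLinearMap) :
    IsLinear (tensorAlg f g hf hg).toLinearMap := isLinear_tensorMap _ _

theorem map_neg_one_pow_mul {F : Type*} [FunLike F A B] [AddMonoidHomClass F A B] (f : F) (l : ℕ)
    (x : A) : f ((-1) ^ l * x) = (-1) ^ l * f x := by
  rcases Nat.even_or_odd l with h | h <;> simp [h.neg_one_pow]

theorem mixedTmul_sum_left {ι : Type*} (s : Finset ι) (x : ι → A⟦X⟧) (y : B⟦X⟧) :
    mixedTmul R (∑ i ∈ s, x i) y = ∑ i ∈ s, mixedTmul R (x i) y := by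
  simp [mixedTmul, Finset.sum_mul]

theorem mixedTmul_natCast_mul_left (n : ℕ) (x : A⟦X⟧) (y : B⟦X⟧) :
    mixedTmul R ((n : A⟦X⟧) * x) y = (n : (A ⊗[R] B)⟦X⟧) * mixedTmul R x y := by
  simp [mixedTmul, mul_assoc]

theorem mixedTmul_natCast_mul_right (n : ℕ) (x : A⟦X⟧) (y : B⟦X⟧) :
    mixedTmul R x ((n : B⟦X⟧) * y) = (n : (A ⊗[R] B)⟦X⟧) * mixedTmul R x y := by
  simp only [mixedTmul, map_mul, map_natCast]
  rw [← mul_assoc, ← mul_assoc, (Nat.cast_commute n _).eq]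

theorem mixedTmul_neg_one_pow_mul_left (n : ℕ) (x : A⟦X⟧) (y : B⟦X⟧) :
    mixedTmul R ((-1) ^ n * x) y = (-1) ^ n * mixedTmul R x y := by
  simp [mixedTmul, mul_assoc]

theorem mixedTmul_neg_one_pow_mul_right (n : ℕ) (x : A⟦X⟧) (y : B⟦X⟧) :
    mixedTmul R x ((-1) ^ n * y) = (-1) ^ n * mixedTmul R x y := by
  simp only [mixedTmul, map_mul, map_pow, map_neg, map_one]
  rw [← mul_assoc, ← mul_assoc, neg_one_pow_comm]

theorem mixedTmul_sub_right (x : A⟦X⟧) (y y' : B⟦X⟧) :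
    mixedTmul R x (y - y') = mixedTmul R x y - mixedTmul R x y' := by
  simp [mixedTmul, mul_sub]

theorem mixedTmul_series_left (f : ℕ → A⟦X⟧) (y : B⟦X⟧) :
    mixedTmul R (series f) y = series fun l => mixedTmul R (f l) y :=
  preservesSeries_mixedTmul_left y f

theorem mixedTmul_series_right (x : A⟦X⟧) (f : ℕ → B⟦X⟧) :
    mixedTmul R x (series f) = series fun l => mixedTmul R x (f l) :=
  preservesSeries_mixedTmul_right x f

theorem mixedTmul_mul_X (x : A⟦X⟧) (y : B⟦X⟧) :
    mixedTmul R x y * X = mixedTmul R x (y * X) := by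
  simp [mixedTmul, mul_assoc]

theorem oneSubPow_neg_one (e : A) : oneSubPow e (-1) = 1 + oneSubPow e (-1) * C e * X := by
  have := oneSubPow_neg_mul e 1
  rw [oneSubPow_one, mul_sub, mul_one, ← mul_assoc, sub_eq_iff_eq_add] at this
  exact this

theorem oneSubPow_neg_one_pow (e : A) (l : ℕ) :
    oneSubPow e (-1) ^ l = oneSubPow e (-l) := by
  induction l with
  | zero => simp [oneSubPow_zero]
  | succ l ih => rw [pow_succ, ih, ← oneSubPow_add]; congr 1; push_cast; ring

end Topological

/-! ### The coproduct on U(L)⟦t⟧ and its coassociativity. -/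

namespace JordanianData

section

attribute [local instance 100] LieRing.ofAssociativeRing
attribute [local instance 2000] Algebra.toModule

variable {R L : Type*} [CommRing R] [LieRing L] [LieAlgebra R L] (T : JordanianData R L)

open UniversalEnvelopingAlgebra (ι)

local notation "𝔘" => UniversalEnvelopingAlgebra R L

/-- Algebra maps on `U(L)⟦t⟧` that agree on a spanning set of `L` are equal. -/
theorem algHom_congr_of_span {S : Type*} [Ring S] [Algebra R S] {F G : 𝔘⟦X⟧ →ₐ[R] S⟦X⟧}
    (hF : IsLinear F.toLinearMap) (hG : IsLinear G.toLinearMap) {s : Set L}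
    (hs : Submodule.span R s = ⊤) (h : ∀ x ∈ s, F (C (ι R x)) = G (C (ι R x))) (z : 𝔘⟦X⟧) :
    F z = G z := by
  refine hF.preservesSeries.congr hG.preservesSeries (fun a => ?_) z
  have key : F.comp (constAlg R 𝔘) = G.comp (constAlg R 𝔘) := by
    refine UniversalEnvelopingAlgebra.alg_ext R L fun x => ?_
    have hx : x ∈ Submodule.span R s := hs ▸ Submodule.mem_top
    induction hx using Submodule.span_induction with
    | mem x hx => exact h x hx
    | zero => simp only [map_zero]
    | add x y _ _ hx hy => simp only [map_add, hx, hy]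
    | smul c x _ hx => simp only [map_smul, hx]
  exact DFunLike.congr_fun key a

/-- Algebra maps on `U(L)⟦t⟧` that agree on the weight vectors are equal. -/
theorem algHom_congr {S : Type*} [Ring S] [Algebra R S] {F G : 𝔘⟦X⟧ →ₐ[R] S⟦X⟧}
    (hF : IsLinear F.toLinearMap) (hG : IsLinear G.toLinearMap)
    (h : ∀ (m : ℤ) (x : L), ⁅T.h, x⁆ = m • x → F (C (ι R x)) = G (C (ι R x))) (z : 𝔘⟦X⟧) :
    F z = G z :=
  algHom_congr_of_span hF hG T.span_weights (fun x ⟨m, hx⟩ => h m x hx) z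

theorem conjRight_eq (x : L) : T.conjRight x = series fun l => (-1) ^ l *
    mixedTmul R (C (rising T.hU 0 l)) (oneSubPow T.eU (-(l : ℤ)) * C (T.dU x l)) := by
  rw [conjRight_apply, conjSeries]
  congr 1; funext l
  rw [mixedTmul, map_mul, PowerSeries.map_C, PowerSeries.map_C, map_oneSubPow, ← map_rising left]

variable {T} in
theorem conjLeft_eq {m : ℤ} {x : L} (hx : ⁅T.h, x⁆ = m • x) :
    T.conjLeft x = mixedTmul R (C (ι R x)) (oneSubPow T.eU m) := by
  rw [conjLeft_of_weight hx, mixedTmul, PowerSeries.map_C, map_oneSubPow]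

variable {T} in
theorem comulL_eq {m : ℤ} {x : L} (hx : ⁅T.h, x⁆ = m • x) :
    T.comulL x = mixedTmul R (C (ι R x)) (oneSubPow T.eU m) + series fun l => (-1) ^ l *
      mixedTmul R (C (rising T.hU 0 l)) (oneSubPow T.eU (-(l : ℤ)) * C (T.dU x l)) := by
  rw [comulL, LinearMap.add_apply, conjLeft_eq hx, conjRight_eq]

/-- The deformed coproduct on `U(L)⟦t⟧`. -/
noncomputable def comul : 𝔘⟦X⟧ →ₐ[R] (𝔘 ⊗[R] 𝔘)⟦X⟧ := extendAlgHom T.comulU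

theorem isLinear_comul : IsLinear T.comul.toLinearMap := isLinear_extendAlgHom _

theorem comul_C_ι (x : L) : T.comul (C (ι R x)) = T.comulL x := by
  rw [comul, extendAlgHom_C, comulU_ι]

theorem weight_e : ⁅T.h, T.e⁆ = (1 : ℤ) • T.e := by rw [T.lie_h_e, one_smul]

theorem weight_h : ⁅T.h, T.h⁆ = (0 : ℤ) • T.h := by rw [lie_self, zero_smul]

theorem comul_eU : T.comul (C T.eU) =
    mixedTmul R (C T.eU) (oneSubPow T.eU 1) + mixedTmul R 1 (C T.eU) := by
  rw [eU, comul_C_ι, comulL_eq T.weight_e, series_eq_zeroth]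
  · simp [dU_zero, rising, oneSubPow_zero]
    rfl
  · intro l
    rw [dU, T.D_e]
    simp [mixedTmul]

/-- Since Δ(e) = e ⊗ (1 - et) + 1 ⊗ e, the element 1 - et is grouplike, and so are its powers. -/
theorem comul_oneSubPow (m : ℤ) :
    T.comul (oneSubPow T.eU m) = mixedTmul R (oneSubPow T.eU m) (oneSubPow T.eU m) := by
  have hc : Commute (oneSub (left T.eU)) (oneSub (right T.eU)) :=
    Units.ext (by
      have := Commute.oneSubPow_right ((Commute.oneSubPow_right
        ((left_right_commute T.eU T.eU).symm.map C) 1).symm) 1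
      simpa only [oneSubPow, zpow_one, Units.val_mul] using this.eq)
  change T.comul.toRingHom (oneSubPow T.eU m) = _
  rw [map_units_zpow_oneSub T.comul.toRingHom T.eU (oneSub (left T.eU) * oneSub (right T.eU)) ?_ m,
    hc.mul_zpow, mixedTmul, map_oneSubPow, map_oneSubPow]
  · rfl
  · change T.comul.toLinearMap (1 - C T.eU * X) = _
    rw [map_sub, T.isLinear_comul.map_mul_X]
    simp only [AlgHom.toLinearMap_apply]
    rw [comul_eU, map_one, mixedTmul, mixedTmul, PowerSeries.map_C, PowerSeries.map_C, map_oneSubPow,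
      oneSubPow_one, map_one, one_mul]
    change _ = (1 - C (left T.eU) * X) * (1 - C (right T.eU) * X)
    change 1 - (C (left T.eU) * (1 - C (right T.eU) * X) + C (right T.eU)) * X = _
    have := (PowerSeries.commute_X (C (right T.eU) : (𝔘 ⊗[R] 𝔘)⟦X⟧)).eq
    rw [sub_mul, one_mul, mul_assoc _ X, mul_sub X, ← mul_assoc X, ← this, mul_one, mul_assoc _ X X]
    noncomm_ring

/-- Only the terms l = 0, 1 survive, with D_1 h = -e, so h ⊗ 1 is corrected by h ⊗ (1 - et)⁻¹ e t;
together they give h ⊗ (1 - et)⁻¹. -/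
theorem comul_hU : T.comul (C T.hU) =
    mixedTmul R 1 (C T.hU) +
      mixedTmul R (C T.hU) 1 * mixedTmul R (1 : 𝔘⟦X⟧) (oneSubPow T.eU (-1)) := by
  rw [hU, comul_C_ι, comulL_eq T.weight_h, series_succ, series_eq_zeroth]
  · rw [dU_zero, dU, D_one_h, map_neg]
    conv_rhs => rw [oneSubPow_neg_one]
    simp only [rising, pow_zero, one_mul, zero_add, pow_one, Nat.cast_zero, neg_zero, Nat.cast_one,
      oneSubPow_zero, mul_neg, map_neg, map_one, mul_assoc, mixedTmul_mul_X, Int.cast_zero,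
      add_zero, neg_mul]
    rw [mixedTmul_mul, mul_one, one_mul, mixedTmul_add_right]
    have : ∀ z : 𝔘⟦X⟧, mixedTmul R (C T.hU) (-z) = -mixedTmul R (C T.hU) z := fun z => by
      simp [mixedTmul]
    rw [this, neg_neg, hU, eU]
    abel
  · intro l
    rw [dU, T.D_h]
    simp [mixedTmul]

/-- This is `rising_add_mul` for y = 1 ⊗ h, x = h ⊗ 1 and v = 1 ⊗ (1 - et)⁻¹. The relation between y
and v is the case m = -1 of `C_mul_oneSubPow_of_weight`. -/
theorem comul_rising (n : ℕ) : T.comul (C (rising T.hU 0 n)) =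
    ∑ p ∈ Finset.HasAntidiagonal.antidiagonal n, (n.choose p.1 : (𝔘 ⊗[R] 𝔘)⟦X⟧) *
      mixedTmul R (C (rising T.hU 0 p.1)) (oneSubPow T.eU (-(p.1 : ℤ)) * C (rising T.hU 0 p.2)) := by
  have := map_rising (T.comul.toRingHom.comp C) T.hU 0 n
  simp only [RingHom.comp_apply] at this
  refine this.trans ?_
  change rising (T.comul (C T.hU)) 0 n = _
  rw [comul_hU, rising_add_mul]
  · refine Finset.sum_congr rfl fun p _ => ?_
    have e1 : rising (mixedTmul R (1 : 𝔘⟦X⟧) (C T.hU)) 0 p.2 = mixedTmul R 1 (C (rising T.hU 0 p.2)) := by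
      simp only [mixedTmul, map_one, one_mul, PowerSeries.map_C]
      exact (map_rising ((C : _ →+* (𝔘 ⊗[R] 𝔘)⟦X⟧).comp right) _ _ _).symm
    have e2 : rising (mixedTmul R (C T.hU) (1 : 𝔘⟦X⟧)) 0 p.1 = mixedTmul R (C (rising T.hU 0 p.1)) 1 := by
      simp only [mixedTmul, map_one, mul_one, PowerSeries.map_C]
      exact (map_rising ((C : _ →+* (𝔘 ⊗[R] 𝔘)⟦X⟧).comp left) _ _ _).symm
    have e3 : mixedTmul R (1 : 𝔘⟦X⟧) (oneSubPow T.eU (-1)) ^ p.1 =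
        mixedTmul R 1 (oneSubPow T.eU (-p.1)) := by
      simp only [mixedTmul, map_one, one_mul]
      rw [← map_pow, oneSubPow_neg_one_pow]
    rw [e1, e2, e3, mixedTmul_mul, mixedTmul_mul]
    simp
  · rw [commute_iff_eq, mixedTmul_mul, mixedTmul_mul]; simp
  · rw [commute_iff_eq, mixedTmul_mul, mixedTmul_mul]; simp
  · rw [mixedTmul_mul, mixedTmul_mul, mixedTmul_mul, mul_one, ← mixedTmul_sub_right,
      ← mixedTmul_add_right,
      C_mul_oneSubPow_of_weight T.hU_mul_eU, ← oneSubPow_add]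
    congr 1
    simp; abel

/-- It suffices to treat a weight vector x. With u = 1 - et, both sides consist of x ⊗ u^m ⊗ u^m, a
single series in h^{⟨l⟩} ⊗ u^{-l} D_l x ⊗ u^m, and a double series. In the latter the binomial
coefficients come from Δ(h^{⟨n⟩}) on one side and from D_i D_j = ((i + j) choose i) D_{i+j} on the
other. -/
theorem coassoc (z : 𝔘⟦X⟧) : PowerSeries.map (Algebra.TensorProduct.assoc R R R 𝔘 𝔘 𝔘).toRingEquiv.toRingHom
      (tensorMap T.comul.toLinearMap LinearMap.id (T.comul z)) =
    tensorMap LinearMap.id T.comul.toLinearMap (T.comul z) := by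
  have hid : IsLinear (AlgHom.id R 𝔘⟦X⟧).toLinearMap := isLinear_id
  have hid' : IsLinear (LinearMap.id : 𝔘⟦X⟧ →ₗ[R] 𝔘⟦X⟧) := isLinear_id
  have hΔ := T.isLinear_comul
  refine T.algHom_congr
    (F := (mapAlg (Algebra.TensorProduct.assoc R R R 𝔘 𝔘 𝔘).toAlgHom).comp
      ((tensorAlg T.comul (AlgHom.id R _) hΔ hid).comp T.comul))
    (G := (tensorAlg (AlgHom.id R _) T.comul hid hΔ).comp T.comul)
    ((isLinear_mapAlg _).comp_algHom ((isLinear_tensorAlg _ _ hΔ hid).comp_algHom hΔ))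
    ((isLinear_tensorAlg _ _ hid hΔ).comp_algHom hΔ) (fun m x hx => ?_) z
  change PowerSeries.map (Algebra.TensorProduct.assoc R R R 𝔘 𝔘 𝔘).toRingEquiv.toRingHom
      (tensorMap T.comul.toLinearMap LinearMap.id (T.comul _)) =
    tensorMap LinearMap.id T.comul.toLinearMap (T.comul _)
  rw [comul_C_ι, comulL_eq hx, map_add, map_add, map_add, tensorMap_mixedTmul hΔ hid',
    tensorMap_mixedTmul hid' hΔ, (isLinear_tensorMap _ _).preservesSeries, map_series,
    (isLinear_tensorMap _ _).preservesSeries]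
  simp only [map_neg_one_pow_mul, tensorMap_mixedTmul hΔ hid', tensorMap_mixedTmul hid' hΔ,
    AlgHom.toLinearMap_apply, LinearMap.id_apply, comul_C_ι, map_mul]
  have h1 : PowerSeries.map (Algebra.TensorProduct.assoc R R R 𝔘 𝔘 𝔘).toRingEquiv.toRingHom
      (mixedTmul R (T.comulL x) (oneSubPow T.eU m)) =
      mixedTmul R (C (ι R x)) (mixedTmul R (oneSubPow T.eU m) (oneSubPow T.eU m)) +
      series fun l => (-1) ^ l * mixedTmul R (C (rising T.hU 0 l))
        (mixedTmul R (oneSubPow T.eU (-(l : ℤ)) * C (T.dU x l)) (oneSubPow T.eU m)) := by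
    rw [comulL_eq hx, mixedTmul_add_left, map_add, map_assoc_mixedTmul,
      mixedTmul_series_left, map_series]
    simp only [mixedTmul_neg_one_pow_mul_left, map_neg_one_pow_mul, map_assoc_mixedTmul]
  -- As D_l x has weight m + l, the grouplike factor (1 - et)^{-l} brings the exponent in the last
  -- leg back to m.
  have h2 : ∀ l : ℕ, T.comul (oneSubPow T.eU (-(l : ℤ))) * T.comul (C (T.dU x l)) =
      mixedTmul R (oneSubPow T.eU (-(l : ℤ)) * C (T.dU x l)) (oneSubPow T.eU m) +
      series fun p => (-1) ^ p *
        mixedTmul R (oneSubPow T.eU (-(l : ℤ)) * C (rising T.hU 0 p))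
          (oneSubPow T.eU (-((l + p : ℕ) : ℤ)) * C (T.dU (T.D l x) p)) := fun l => by
    rw [comul_oneSubPow, dU, comul_C_ι, comulL_eq (lie_h_D hx l), mul_add, mixedTmul_mul,
      ← oneSubPow_add, show (-l + (m + l) : ℤ) = m by ring, mul_series]
    congr 2; funext p
    rw [← mul_assoc, neg_one_pow_comm, mul_assoc, mixedTmul_mul, ← mul_assoc (oneSubPow _ _),
      ← oneSubPow_add]
    push_cast
    rw [neg_add]
  have h3 : ∀ l : ℕ, PowerSeries.map (Algebra.TensorProduct.assoc R R R 𝔘 𝔘 𝔘).toRingEquiv.toRingHom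
      (mixedTmul R (T.comul (C (rising T.hU 0 l))) (oneSubPow T.eU (-(l : ℤ)) * C (T.dU x l))) =
      ∑ p ∈ Finset.HasAntidiagonal.antidiagonal l, (l.choose p.1 : (𝔘 ⊗[R] (𝔘 ⊗[R] 𝔘))⟦X⟧) *
        mixedTmul R (C (rising T.hU 0 p.1))
          (mixedTmul R (oneSubPow T.eU (-(p.1 : ℤ)) * C (rising T.hU 0 p.2))
            (oneSubPow T.eU (-(l : ℤ)) * C (T.dU x l))) := fun l => by
    rw [comul_rising, mixedTmul_sum_left, map_sum]
    refine Finset.sum_congr rfl fun p _ => ?_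
    rw [mixedTmul_natCast_mul_left, map_mul, map_natCast, map_assoc_mixedTmul]
  rw [h1, comul_oneSubPow, add_assoc]
  simp only [h2, h3, mixedTmul_add_right, mul_add, series_add]
  congr 2
  simp only [mixedTmul_series_right, mul_series, mixedTmul_neg_one_pow_mul_right]
  rw [series_series]
  congr 1; funext n
  rw [Finset.mul_sum]
  refine Finset.sum_congr rfl fun p hp => ?_
  have hn := Finset.HasAntidiagonal.mem_antidiagonal.1 hp
  rw [dU_D, add_comm p.2, hn, map_mul, map_natCast, ← mul_assoc (oneSubPow _ _),
    ← (Nat.cast_commute _ (oneSubPow T.eU _)).eq, mul_assoc, mixedTmul_natCast_mul_right,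
    mixedTmul_natCast_mul_right, ← mul_assoc ((-1) ^ p.1), ← pow_add, hn]
  congr 3
  · simp
  · exact Nat.choose_symm_of_eq_add hn.symm

end

/-! ### The counit and antipode axioms on U(L)⟦t⟧. -/

section

attribute [local instance 100] LieRing.ofAssociativeRing
attribute [local instance 2000] Algebra.toModule

variable {R L : Type*} [CommRing R] [LieRing L] [LieAlgebra R L] (T : JordanianData R L)

open UniversalEnvelopingAlgebra (ι)

local notation "𝔘" => UniversalEnvelopingAlgebra R L

/-- The undeformed counit on `U(L)⟦t⟧`. -/
noncomputable def counit (R L : Type*) [CommRing R] [LieRing L] [LieAlgebra R L] :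
    (UniversalEnvelopingAlgebra R L)⟦X⟧ →ₐ[R] R⟦X⟧ :=
  mapAlg (Bialgebra.counitAlgHom R (UniversalEnvelopingAlgebra R L))

theorem isLinear_counit : IsLinear (counit R L).toLinearMap := isLinear_mapAlg _

theorem counit_ι (x : L) : Bialgebra.counitAlgHom R 𝔘 (ι R x) = 0 :=
  UniversalEnvelopingAlgebra.counit₀_ι R L x

theorem counit_C (a : 𝔘) : counit R L (C a) = C (Bialgebra.counitAlgHom R 𝔘 a) :=
  PowerSeries.map_C _ _

theorem counit_C_ι (x : L) : counit R L (C (ι R x)) = 0 := by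
  rw [counit_C, counit_ι, map_zero]

theorem counit_rising_succ (l : ℕ) : counit R L (C (rising T.hU 0 (l + 1))) = 0 := by
  have := map_rising (Bialgebra.counitAlgHom R 𝔘).toRingHom T.hU 0 (l + 1)
  rw [counit_C]
  refine (congrArg C (this.trans ?_)).trans (map_zero _)
  change rising (Bialgebra.counitAlgHom R 𝔘 (ι R T.h)) 0 (l + 1) = 0
  rw [counit_ι, rising_zero_zero_succ]

theorem counit_oneSubPow (m : ℤ) : counit R L (oneSubPow T.eU m) = 1 := by
  refine (map_oneSubPow (Bialgebra.counitAlgHom R 𝔘).toRingHom T.eU m).trans ?_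
  change oneSubPow (Bialgebra.counitAlgHom R 𝔘 (ι R T.e)) m = 1
  rw [counit_ι]
  exact (map_units_zpow_oneSub (RingHom.id R⟦X⟧) 0 1 (by simp) m).trans (by simp)

theorem counit_left (z : 𝔘⟦X⟧) :
    PowerSeries.map (Algebra.TensorProduct.lid R 𝔘).toRingEquiv.toRingHom
      (tensorMap (counit R L).toLinearMap LinearMap.id (T.comul z)) = z := by
  have hid : IsLinear (AlgHom.id R 𝔘⟦X⟧).toLinearMap := isLinear_id
  have hε : IsLinear (counit R L).toLinearMap := isLinear_counit
  refine T.algHom_congr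
    (F := (mapAlg (Algebra.TensorProduct.lid R 𝔘).toAlgHom).comp
      ((tensorAlg (counit R L) (AlgHom.id R _) hε hid).comp T.comul))
    (G := AlgHom.id R _)
    ((isLinear_mapAlg _).comp_algHom ((isLinear_tensorAlg _ _ hε hid).comp_algHom T.isLinear_comul))
    isLinear_id (fun m x hx => ?_) z
  change PowerSeries.map (Algebra.TensorProduct.lid R 𝔘).toRingEquiv.toRingHom
      (tensorMap (counit R L).toLinearMap LinearMap.id (T.comul _)) = C (ι R x)
  rw [comul_C_ι, comulL_eq hx, map_add, map_add, tensorMap_mixedTmul hε isLinear_id,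
    (isLinear_tensorMap _ _).preservesSeries, map_series, map_lid_mixedTmul]
  simp only [map_neg_one_pow_mul, tensorMap_mixedTmul hε isLinear_id,
    AlgHom.toLinearMap_apply, LinearMap.id_apply, map_lid_mixedTmul, counit_C_ι]
  rw [series_eq_zeroth]
  · simp [rising, oneSubPow_zero, dU_zero]
  · intro l
    rw [counit_rising_succ]
    simp

theorem counit_right (z : 𝔘⟦X⟧) :
    PowerSeries.map (Algebra.TensorProduct.rid R R 𝔘).toRingEquiv.toRingHom
      (tensorMap LinearMap.id (counit R L).toLinearMap (T.comul z)) = z := by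
  have hid : IsLinear (AlgHom.id R 𝔘⟦X⟧).toLinearMap := isLinear_id
  have hε : IsLinear (counit R L).toLinearMap := isLinear_counit
  refine T.algHom_congr
    (F := (mapAlg (Algebra.TensorProduct.rid R R 𝔘).toAlgHom).comp
      ((tensorAlg (AlgHom.id R _) (counit R L) hid hε).comp T.comul))
    (G := AlgHom.id R _)
    ((isLinear_mapAlg _).comp_algHom ((isLinear_tensorAlg _ _ hid hε).comp_algHom T.isLinear_comul))
    isLinear_id (fun m x hx => ?_) z
  change PowerSeries.map (Algebra.TensorProduct.rid R R 𝔘).toRingEquiv.toRingHom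
      (tensorMap LinearMap.id (counit R L).toLinearMap (T.comul _)) = C (ι R x)
  rw [comul_C_ι, comulL_eq hx, map_add, map_add, tensorMap_mixedTmul isLinear_id hε,
    (isLinear_tensorMap _ _).preservesSeries, map_series, map_rid_mixedTmul]
  simp only [map_neg_one_pow_mul, tensorMap_mixedTmul isLinear_id hε,
    AlgHom.toLinearMap_apply, LinearMap.id_apply, map_rid_mixedTmul, map_mul, dU, counit_C_ι,
    counit_oneSubPow]
  rw [series_eq_zeroth] <;> simp

/-- The deformed antipode on `U(L)⟦t⟧`. -/
noncomputable def antipode : 𝔘⟦X⟧ →ₗ[R] 𝔘⟦X⟧ := extendLinear T.antipodeU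

theorem isLinear_antipode : IsLinear T.antipode := isLinear_extendLinear _

theorem antipode_C (a : 𝔘) : T.antipode (C a) = T.antipodeU a := extendLinear_C _ _

theorem antipode_C_ι (x : L) : T.antipode (C (ι R x)) = T.antipodeL x := by
  rw [antipode_C, antipodeU_ι]

theorem antipode_mul (x y : 𝔘⟦X⟧) : T.antipode (x * y) = T.antipode y * T.antipode x := by
  simp only [antipode, extendLinear_apply, series_mul_series, coeff_mul, map_sum, antipodeU_mul]
  congr 1; funext n
  exact (Finset.Nat.sum_antidiagonal_swap (f := fun p => T.antipodeU (coeff p.1 y) *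
    T.antipodeU (coeff p.2 x)))

theorem antipode_one : T.antipode 1 = 1 := by
  rw [← map_one C, antipode_C, antipodeU_one, map_one]

theorem antipode_eU : T.antipode (C T.eU) = -(oneSubPow T.eU (-1) * C T.eU) := by
  rw [eU, antipode_C_ι, antipodeL_of_weight T.weight_e, antiSeries, series_eq_zeroth]
  · simp [dU_zero, rising, eU]
  · intro l; rw [dU, T.D_e]; simp

/-- The series for S(h) stops at degree 1 and equals h - e (h + 1) t up to sign, where e (h + 1) = h
e. -/
theorem antipode_hU : T.antipode (C T.hU) = -(C T.hU * oneSubPow T.eU 1) := by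
  have h1 : antiSeries T.hU 1 (T.dU T.h) = C T.hU - C (T.eU * (T.hU + 1)) * X := by
    rw [antiSeries, series_succ, series_eq_zeroth]
    · rw [dU_zero, dU, D_one_h, map_neg]
      simp [rising, hU, eU, -UniversalEnvelopingAlgebra.ι_apply, sub_eq_add_neg]
    · intro l; rw [dU, T.D_h]; simp
  conv_lhs => rw [hU]
  rw [antipode_C_ι, antipodeL_of_weight T.weight_h, h1, oneSubPow_one, neg_zero, oneSubPow_zero,
    one_mul, mul_sub, mul_one, ← mul_assoc, ← map_mul, hU_mul_eU, mul_add, mul_one]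

theorem antipode_oneSubPow_one : T.antipode (oneSubPow T.eU 1) = oneSubPow T.eU (-1) := by
  conv_rhs => rw [oneSubPow_neg_one]
  rw [oneSubPow_one, map_sub, antipode_one, T.isLinear_antipode.map_mul_X, antipode_eU]
  noncomm_ring

theorem antipode_oneSubPow (m : ℤ) : T.antipode (oneSubPow T.eU m) = oneSubPow T.eU (-m) := by
  have hneg : T.antipode (oneSubPow T.eU (-1)) = oneSubPow T.eU 1 := by
    have := congrArg T.antipode (oneSubPow_neg_mul T.eU 1)
    rw [antipode_mul, antipode_oneSubPow_one, antipode_one] at this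
    rw [← one_mul (T.antipode _), ← oneSubPow_mul_neg T.eU 1, mul_assoc, this, mul_one]
  induction m with
  | zero => simp [oneSubPow_zero, antipode_one]
  | succ m ih =>
    rw [oneSubPow_add, antipode_mul, ih, antipode_oneSubPow_one, ← oneSubPow_add]; congr 1; ring
  | pred m ih =>
    rw [sub_eq_add_neg, oneSubPow_add, antipode_mul, ih, hneg, ← oneSubPow_add]; congr 1; ring

/-- As S(h) = -h u with u = 1 - et, the signed rising factorial of S(h) is the falling factorial (h
u)^{[l]} = h^{[l]} u^l. That S reverses products is harmless here, since the factors commute. -/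
theorem antipode_rising (l : ℕ) : (-1) ^ l * T.antipode (C (rising T.hU 0 l)) =
    C (falling T.hU 0 l) * oneSubPow T.eU l := by
  have h1 : T.antipode (C (rising T.hU 0 l)) = rising (T.antipode (C T.hU)) 0 l := by
    rw [antipode_C, antipode_C]
    have := map_rising T.antipodeOpU.toRingHom T.hU 0 l
    have h2 : T.antipodeOpU T.hU = MulOpposite.op (T.antipodeU T.hU) := rfl
    change MulOpposite.unop (T.antipodeOpU (rising T.hU 0 l)) = _
    refine (congrArg MulOpposite.unop this).trans ?_
    change MulOpposite.unop (rising (T.antipodeOpU T.hU) 0 l) = _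
    rw [h2, op_rising]; rfl
  rw [h1, neg_one_pow_mul_rising, antipode_hU, neg_neg, neg_zero,
    falling_C_mul_oneSubPow T.hU_mul_eU]

/-- `m (S ⊗ Id)`. -/
noncomputable def mulAntipodeLeft : (𝔘 ⊗[R] 𝔘)⟦X⟧ →ₗ[R] 𝔘⟦X⟧ :=
  extend (LinearMap.mul' R 𝔘) ∘ₗ tensorMap T.antipode LinearMap.id

/-- `m (Id ⊗ S)`. -/
noncomputable def mulAntipodeRight : (𝔘 ⊗[R] 𝔘)⟦X⟧ →ₗ[R] 𝔘⟦X⟧ :=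
  extend (LinearMap.mul' R 𝔘) ∘ₗ tensorMap LinearMap.id T.antipode

theorem isLinear_mulAntipodeLeft : IsLinear T.mulAntipodeLeft :=
  (isLinear_extend _).comp (isLinear_tensorMap _ _)

theorem isLinear_mulAntipodeRight : IsLinear T.mulAntipodeRight :=
  (isLinear_extend _).comp (isLinear_tensorMap _ _)

theorem mulAntipodeLeft_mixedTmul (x y : 𝔘⟦X⟧) :
    T.mulAntipodeLeft (mixedTmul R x y) = T.antipode x * y := by
  rw [mulAntipodeLeft, LinearMap.comp_apply, tensorMap_mixedTmul T.isLinear_antipode isLinear_id,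
    extend_mul_mixedTmul, LinearMap.id_apply]

theorem mulAntipodeRight_mixedTmul (x y : 𝔘⟦X⟧) :
    T.mulAntipodeRight (mixedTmul R x y) = x * T.antipode y := by
  rw [mulAntipodeRight, LinearMap.comp_apply, tensorMap_mixedTmul isLinear_id T.isLinear_antipode,
    extend_mul_mixedTmul, LinearMap.id_apply]

/-- Right multiplication by a ⊗ b turns m(S ⊗ Id)(z) into S(a) m(S ⊗ Id)(z) b. Since elements of
U(L) are built up by left multiplication by L, the antipode axiom reduces to L. -/
theorem mulAntipodeLeft_mul (z w : (𝔘 ⊗[R] 𝔘)⟦X⟧) (hz : T.mulAntipodeLeft z = 0) :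
    T.mulAntipodeLeft (z * w) = 0 := by
  have hM := T.isLinear_mulAntipodeLeft.preservesSeries
  have h0 : PreservesSeries fun _ : (𝔘 ⊗[R] 𝔘)⟦X⟧ => (0 : 𝔘⟦X⟧) := fun s => by
    ext n; simp [coeff_series]
  refine PreservesSeries.congr_tmul (hM.comp (preservesSeries_id.mul_left z)) h0
    (by simp [mul_add]) (by simp) (fun a b => ?_) w
  have key : T.mulAntipodeLeft (z * mixedTmul R (C a) (C b)) =
      T.antipode (C a) * T.mulAntipodeLeft z * C b := by
    refine PreservesSeries.congr_tmul (hM.comp (preservesSeries_id.mul_right _))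
      ((hM.mul_left _).mul_right _) (by simp [add_mul]) (by simp [add_mul, mul_add])
      (fun a' b' => ?_) z
    rw [mixedTmul_mul, mulAntipodeLeft_mixedTmul, mulAntipodeLeft_mixedTmul, antipode_mul]
    simp only [mul_assoc]
  rw [key, hz]; simp

/-- In m(Id ⊗ S)((a ⊗ b) w) = a m(Id ⊗ S)(w) S(b) the middle factor is the central scalar c, so it
can be taken out. In the induction over U(L), `hw` is the induction hypothesis. -/
theorem mulAntipodeRight_mul (z w : (𝔘 ⊗[R] 𝔘)⟦X⟧) (hz : T.mulAntipodeRight z = 0) (c : R⟦X⟧)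
    (hw : T.mulAntipodeRight w = scalar R 𝔘 c) : T.mulAntipodeRight (z * w) = 0 := by
  have hM := T.isLinear_mulAntipodeRight.preservesSeries
  have key : ∀ a b : 𝔘, T.mulAntipodeRight (mixedTmul R (C a) (C b) * w) =
      C a * T.mulAntipodeRight w * T.antipode (C b) := fun a b => by
    refine PreservesSeries.congr_tmul (hM.comp (preservesSeries_id.mul_left _))
      ((hM.mul_left _).mul_right _) (by simp [mul_add]) (by simp [add_mul, mul_add])
      (fun a' b' => ?_) w
    rw [mixedTmul_mul, mulAntipodeRight_mixedTmul, mulAntipodeRight_mixedTmul, antipode_mul]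
    simp only [mul_assoc]
  have : T.mulAntipodeRight (z * w) = scalar R 𝔘 c * T.mulAntipodeRight z := by
    refine PreservesSeries.congr_tmul (hM.comp (preservesSeries_id.mul_right _))
      (hM.mul_left _) (by simp [add_mul]) (by simp [mul_add]) (fun a b => ?_) z
    rw [key, hw, mulAntipodeRight_mixedTmul, ← scalar_commute, mul_assoc]
  rw [this, hz, mul_zero]

/-- For x of weight m and u = 1 - et, the factor u^l of S(h^{⟨l⟩}) cancels u^{-l}, leaving ∑ h^{[l]}
D_l(x) t^l = ∑ D_l(x) h_{1+m}^{⟨l⟩} t^l. Moving u^m to the left in S(x) u^m gives the negative of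
the same series. -/
theorem mulAntipodeLeft_comulL (x : L) : T.mulAntipodeLeft (T.comulL x) = 0 := by
  have hx : x ∈ Submodule.span R {x : L | ∃ m : ℤ, ⁅T.h, x⁆ = m • x} :=
    T.span_weights ▸ Submodule.mem_top
  induction hx using Submodule.span_induction with
  | zero => simp
  | add x y _ _ hx hy => rw [map_add, map_add, hx, hy, add_zero]
  | smul c x _ hx => rw [map_smul, map_smul, hx, smul_zero]
  | mem x hx =>
  obtain ⟨m, hx⟩ := hx
  rw [comulL_eq hx, map_add, mulAntipodeLeft_mixedTmul, T.isLinear_mulAntipodeLeft.preservesSeries]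
  have h1 : ∀ l : ℕ, (-1) ^ l * (T.antipode (C (rising T.hU 0 l)) *
      (oneSubPow T.eU (-(l : ℤ)) * C (T.dU x l))) = C (falling T.hU 0 l * T.dU x l) := fun l => by
    rw [← mul_assoc, antipode_rising, mul_assoc, ← mul_assoc (oneSubPow _ _), oneSubPow_mul_neg,
      one_mul, map_mul]
  simp only [map_neg_one_pow_mul, mulAntipodeLeft_mixedTmul, h1]
  rw [← antiSeries_eq_falling (hU_mul_dU hx), antipode_C_ι, antipodeL_of_weight hx, neg_mul,
    mul_assoc, antiSeries_mul_oneSubPow T.hU_mul_eU (T.eU_mul_dU x), ← mul_assoc,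
    oneSubPow_neg_mul, one_mul, zero_add, neg_add_cancel]

/-- The coefficients of D_n(x) for n ≥ 1 are the alternating sums of `sum_rising_mul_falling`, hence
vanish; the remaining term -x (1 - et)^{-m} cancels the contribution of x ⊗ (1 - et)^m. -/
theorem mulAntipodeRight_comulL (x : L) : T.mulAntipodeRight (T.comulL x) = 0 := by
  have hx : x ∈ Submodule.span R {x : L | ∃ m : ℤ, ⁅T.h, x⁆ = m • x} :=
    T.span_weights ▸ Submodule.mem_top
  induction hx using Submodule.span_induction with
  | zero => simp
  | add x y _ _ hx hy => rw [map_add, map_add, hx, hy, add_zero]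
  | smul c x _ hx => rw [map_smul, map_smul, hx, smul_zero]
  | mem x hx =>
  obtain ⟨m, hx⟩ := hx
  rw [comulL_eq hx, map_add, mulAntipodeRight_mixedTmul, T.isLinear_mulAntipodeRight.preservesSeries,
    antipode_oneSubPow]
  have h1 : ∀ l : ℕ, (-1) ^ l * (C (rising T.hU 0 l) *
      T.antipode (oneSubPow T.eU (-(l : ℤ)) * C (T.dU x l))) =
      -(series fun p => C ((((l + p).choose l : 𝔘) * ((-1) ^ l * rising T.hU 0 l *
        falling T.hU 0 p)) * T.dU x (l + p))) * oneSubPow T.eU (-m) := fun l => by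
    have hw := lie_h_D hx l
    have h2 : antiSeries T.hU (1 + l) (T.dU (T.D l x)) * oneSubPow T.eU (-m) =
        oneSubPow T.eU (-m) * antiSeries T.hU (1 + l + -m) (T.dU (T.D l x)) :=
      antiSeries_mul_oneSubPow T.hU_mul_eU (T.eU_mul_dU _) _ _
    have h3 : antiSeries T.hU (1 + l + m) (T.dU (T.D l x)) * oneSubPow T.eU (-m) =
        oneSubPow T.eU (-m) * antiSeries T.hU (1 + l) (T.dU (T.D l x)) := by
      rw [antiSeries_mul_oneSubPow T.hU_mul_eU (T.eU_mul_dU _), add_neg_cancel_right]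
    -- With u = 1 - et: S(D_l x) u^l = -u^{-(m+l)} ∑_p D_p(D_l x) h_1^{⟨p⟩} t^p u^l. Moving u^l to
    -- the left and u^{-m} to the right makes the factorials start at 1 + (m + l), the value at
    -- which they cross D_p D_l x as h^{[p]}.
    rw [antipode_mul, antipode_oneSubPow, neg_neg, dU, antipode_C_ι, antipodeL_of_weight hw, neg_mul,
      mul_assoc, antiSeries_mul_oneSubPow T.hU_mul_eU (T.eU_mul_dU _), ← mul_assoc (oneSubPow _ _),
      ← oneSubPow_add, show (-(m + l) + l : ℤ) = -m by ring, ← h3,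
      show (1 + l + m : ℤ) = 0 + 1 + (m + l) by ring, antiSeries_eq_falling (hU_mul_dU hw), mul_neg,
      mul_neg, neg_mul, ← mul_assoc, ← mul_assoc, mul_series]
    congr 3; funext p
    have hs : ((-1) ^ l : 𝔘⟦X⟧) = C ((-1) ^ l) := by simp
    rw [hs, ← map_mul, ← map_mul, dU_D]
    congr 1
    have hch : (p + l).choose p = (l + p).choose l := by
      rw [add_comm, ← Nat.choose_symm_add]
    rw [hch, add_comm p l, (Nat.cast_commute ((l + p).choose l) (_ : 𝔘)).eq,
      (Nat.cast_commute ((l + p).choose l) (_ : 𝔘)).eq]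
    simp only [mul_assoc]
    rw [(Nat.cast_commute ((l + p).choose l) (_ : 𝔘)).eq]
  simp only [map_neg_one_pow_mul, mulAntipodeRight_mixedTmul, h1]
  rw [← series_mul_right, series_neg, series_series, series_eq_zeroth]
  · simp [rising, falling, dU_zero]
  · intro n
    rw [← map_sum]
    have := sum_rising_mul_falling T.hU (n + 1)
    rw [if_neg (Nat.succ_ne_zero n)] at this
    refine (congrArg C ?_).trans (map_zero C)
    rw [← zero_mul (T.dU x (n + 1)), ← this, Finset.sum_mul]
    refine Finset.sum_congr rfl fun p hp => ?_
    rw [Finset.HasAntidiagonal.mem_antidiagonal.1 hp]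

theorem antipode_left (z : 𝔘⟦X⟧) : T.mulAntipodeLeft (T.comul z) = scalar R 𝔘 (counit R L z) := by
  refine (T.isLinear_mulAntipodeLeft.preservesSeries.comp T.isLinear_comul.preservesSeries).congr
    (preservesSeries_scalar.comp isLinear_counit.preservesSeries) (fun a => ?_) z
  simp only [AlgHom.toLinearMap_apply]
  induction a using UniversalEnvelopingAlgebra.induct with
  | h1 =>
    rw [map_one C, map_one T.comul, map_one (counit R L), map_one (scalar R 𝔘), ← mixedTmul_one_one (R := R), mulAntipodeLeft_mixedTmul,
      antipode_one, one_mul]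
  | hadd a b ha hb => simp only [map_add, ha, hb]
  | hs c a ha =>
    rw [C_smul, map_smul, map_smul, map_smul, ha, smul_eq_C_algebraMap_mul,
      smul_eq_C_algebraMap_mul, map_mul, scalar_C]
    rfl
  | hι x a _ =>
    rw [map_mul C, map_mul T.comul, map_mul (counit R L), comul_C_ι, mulAntipodeLeft_mul _ _ _ (T.mulAntipodeLeft_comulL x),
      counit_C_ι, zero_mul, map_zero]

theorem antipode_right (z : 𝔘⟦X⟧) : T.mulAntipodeRight (T.comul z) = scalar R 𝔘 (counit R L z) := by
  refine (T.isLinear_mulAntipodeRight.preservesSeries.comp T.isLinear_comul.preservesSeries).congr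
    (preservesSeries_scalar.comp isLinear_counit.preservesSeries) (fun a => ?_) z
  simp only [AlgHom.toLinearMap_apply]
  induction a using UniversalEnvelopingAlgebra.induct with
  | h1 =>
    rw [map_one C, map_one T.comul, map_one (counit R L), map_one (scalar R 𝔘), ← mixedTmul_one_one (R := R),
      mulAntipodeRight_mixedTmul, antipode_one, one_mul]
  | hadd a b ha hb => simp only [map_add, ha, hb]
  | hs c a ha =>
    rw [C_smul, map_smul, map_smul, map_smul, ha, smul_eq_C_algebraMap_mul,
      smul_eq_C_algebraMap_mul, map_mul, scalar_C]
    rfl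
  | hι x a ha =>
    rw [map_mul C, map_mul T.comul, map_mul (counit R L), comul_C_ι,
      mulAntipodeRight_mul _ _ _ (T.mulAntipodeRight_comulL x) _ ha,
      counit_C_ι, zero_mul, map_zero]

/-- The deformed Hopf structure on `U(L)⟦t⟧`. -/
noncomputable def hopf : HopfStructure R 𝔘 where
  comul := T.comul
  counit := counit R L
  antipode := T.antipode
  comul_linear := T.isLinear_comul
  counit_linear := isLinear_counit
  antipode_linear := T.isLinear_antipode
  coassoc := T.coassoc
  counit_left := T.counit_left
  counit_right := T.counit_right
  antipode_left := T.antipode_left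
  antipode_right := T.antipode_right

end

end JordanianData

/-! ### Binomial series over a field: inverses, conjugation and the cocycle identity. -/

namespace Topological

section ExpSeries

variable (K : Type*) [Field K] {A B : Type*} [Ring A] [Algebra K A] [Ring B]
  [Algebra K B]

theorem inv_factorial_mul_choose [CharZero K] (i j : ℕ) :
    ((i + j).factorial : K)⁻¹ * ((i + j).choose i : K) =
      (i.factorial : K)⁻¹ * (j.factorial : K)⁻¹ := by
  have hi : (i.factorial : K) ≠ 0 := Nat.cast_ne_zero.2 (Nat.factorial_ne_zero i)
  have hj : (j.factorial : K) ≠ 0 := Nat.cast_ne_zero.2 (Nat.factorial_ne_zero j)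
  have hij : ((i + j).factorial : K) ≠ 0 := Nat.cast_ne_zero.2 (Nat.factorial_ne_zero _)
  rw [Nat.choose_symm_add]
  field_simp
  rw [← Nat.add_choose_mul_factorial_mul_factorial i j]
  push_cast
  ring

/-- `(1 - E t)^{-(H + c)} = ∑ (1 / r!) (H + c)^{⟨r⟩} E^r t^r`. -/
noncomputable def risingSeries (H E : A) (c : ℤ) : A⟦X⟧ :=
  mk fun r => (r.factorial : K)⁻¹ • (rising H c r * E ^ r)

/-- `∑ (1 / r!) (H + c)^{[r]} E^r t^r`. -/
noncomputable def fallingSeries (H E : A) (c : ℤ) : A⟦X⟧ :=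
  mk fun r => (r.factorial : K)⁻¹ • (falling H c r * E ^ r)

/-- `(1 - E t)^{H + c} = ∑ ((-1)^r / r!) (H + c)^{[r]} E^r t^r`. -/
noncomputable def twistSeries (H E : A) (c : ℤ) : A⟦X⟧ :=
  mk fun r => ((-1) ^ r / (r.factorial : K)) • (falling H c r * E ^ r)

theorem map_twistSeries (φ : A →ₐ[K] B) (H E : A) (c : ℤ) :
    PowerSeries.map φ.toRingHom (twistSeries K H E c) = twistSeries K (φ H) (φ E) c := by
  ext r
  have := map_falling φ.toRingHom H c r
  rw [coeff_map, twistSeries, twistSeries, coeff_mk, coeff_mk]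
  change φ _ = _
  rw [map_smul, map_mul, map_pow]
  congr 2

theorem twistSeries_eq_risingSeries (H E : A) (c : ℤ) :
    twistSeries K H E c = risingSeries K (-H) E (-c) := by
  ext r
  rw [twistSeries, risingSeries, coeff_mk, coeff_mk, div_eq_mul_inv, mul_comm, mul_smul]
  have := neg_one_pow_mul_rising (-H) (-c) r
  rw [neg_neg, neg_neg] at this
  rw [← this]
  rcases neg_one_pow_eq_or K r with h | h <;> rcases neg_one_pow_eq_or A r with h' | h' <;>
    rcases Nat.even_or_odd r with hr | hr <;> simp [hr.neg_one_pow]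

variable {K}

theorem constantCoeff_twistSeries (H E : A) (c : ℤ) :
    constantCoeff (twistSeries K H E c) = 1 := by
  rw [← coeff_zero_eq_constantCoeff_apply, twistSeries, coeff_mk]
  simp [falling]

theorem isUnit_of_constantCoeff_eq_one {x : A⟦X⟧} (hx : constantCoeff x = 1) : IsUnit x :=
  isUnit_iff_constantCoeff.2 (by rw [hx]; exact isUnit_one)

variable [CharZero K] {H E : A}

/-- A family of binomial series is compatible with all integral powers of 1 - Et once it is
compatible with 1 - Et itself. -/
theorem oneSubPow_mul_of_step {f : ℤ → A⟦X⟧} (hf : ∀ c, oneSubPow E 1 * f (c + 1) = f c) (m c : ℤ) :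
    oneSubPow E m * f (c + m) = f c := by
  induction m with
  | zero => simp [oneSubPow_zero]
  | succ m ih => rw [oneSubPow_add, ← add_assoc, mul_assoc, hf, ih]
  | pred m ih =>
    have h1 := hf (c + (-m - 1))
    rw [show (c + (-m - 1 : ℤ) + 1) = c + -m by ring] at h1
    rw [← h1, sub_eq_add_neg, oneSubPow_add, mul_assoc, ← mul_assoc (oneSubPow E (-1)),
      oneSubPow_neg_mul, one_mul, ih]

theorem oneSubPow_one_mul_risingSeries (hHE : Commute H E) (c : ℤ) :
    oneSubPow E 1 * risingSeries K H E (c + 1) = risingSeries K H E c := by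
  rw [oneSubPow_one, sub_mul, one_mul, mul_assoc, ← PowerSeries.commute_X, ← mul_assoc]
  ext r
  rw [map_sub]
  cases r with
  | zero => simp [risingSeries, rising]
  | succ r =>
    rw [coeff_succ_mul_X, coeff_C_mul, risingSeries, risingSeries, coeff_mk, coeff_mk, coeff_mk]
    have hE : E * rising H (c + 1) r = rising H (c + 1) r * E :=
      (Commute.rising_right hHE.symm _ _).eq
    have hf : (r.factorial : K)⁻¹ = ((r + 1).factorial : K)⁻¹ * (r + 1 : ℕ) := by
      rw [Nat.factorial_succ, Nat.cast_mul, mul_inv, mul_comm, ← mul_assoc,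
        mul_inv_cancel₀ (Nat.cast_ne_zero.2 (Nat.succ_ne_zero r)), one_mul]
    have hs := rising_shift_sub H c r
    rw [mul_smul_comm, ← mul_assoc, hE, mul_assoc, ← pow_succ', hf, mul_smul, ← smul_sub,
      eq_sub_of_add_eq' (sub_eq_iff_eq_add.1 hs).symm, sub_mul, Nat.cast_smul_eq_nsmul,
      nsmul_eq_mul]
    push_cast
    rw [mul_assoc]

/-- Now e does not commute with h: crossing (h + c + 1)^{[r]} turns it into (h + c)^{[r]}, which is
the discrete derivative of the falling factorial of order r + 1 up to the factor r + 1. -/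
theorem oneSubPow_one_mul_fallingSeries {h e : A} (he : h * e = e * h + e) (c : ℤ) :
    oneSubPow e 1 * fallingSeries K h e (c + 1) = fallingSeries K h e c := by
  rw [oneSubPow_one, sub_mul, one_mul, mul_assoc, ← PowerSeries.commute_X, ← mul_assoc]
  ext r
  rw [map_sub]
  cases r with
  | zero => simp [fallingSeries, falling]
  | succ r =>
    rw [coeff_succ_mul_X, coeff_C_mul, fallingSeries, fallingSeries, coeff_mk, coeff_mk, coeff_mk]
    have hE : e * falling h (c + 1) r = falling h c r * e :=
      (falling_mul_of_weight (m := 1) (by simpa using he) c r).symm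
    have hf : (r.factorial : K)⁻¹ = ((r + 1).factorial : K)⁻¹ * (r + 1 : ℕ) := by
      rw [Nat.factorial_succ, Nat.cast_mul, mul_inv, mul_comm, ← mul_assoc,
        mul_inv_cancel₀ (Nat.cast_ne_zero.2 (Nat.succ_ne_zero r)), one_mul]
    have hs := rising_shift_sub h (c - r) r
    have h1 : falling h (c + 1) (r + 1) = rising h (c - r + 1) (r + 1) := by
      rw [falling_eq_rising]; congr 1; push_cast; ring
    have h2 : falling h c (r + 1) = rising h (c - r) (r + 1) := by
      rw [falling_eq_rising]; congr 1; push_cast; ring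
    have h3 : falling h c r = rising h (c - r + 1) r := falling_eq_rising _ _ _
    rw [mul_smul_comm, ← mul_assoc, hE, mul_assoc, ← pow_succ', hf, mul_smul, ← smul_sub, h1, h2, h3,
      eq_sub_of_add_eq' (sub_eq_iff_eq_add.1 hs).symm, sub_mul, Nat.cast_smul_eq_nsmul,
      nsmul_eq_mul]
    push_cast
    rw [mul_assoc]

theorem twistSeries_add (hHE : Commute H E) (c m : ℤ) :
    twistSeries K H E (c + m) = oneSubPow E m * twistSeries K H E c := by
  have := oneSubPow_mul_of_step (E := E)
    (fun c => oneSubPow_one_mul_risingSeries (K := K) hHE.neg_left c) m (-(c + m))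
  rw [twistSeries_eq_risingSeries, twistSeries_eq_risingSeries, ← this]
  congr 2; ring

/-- `(1 - E t)^H (1 - E t)^{-H} = 1`. -/
theorem twistSeries_mul_risingSeries (hHE : Commute H E) :
    twistSeries K H E 0 * risingSeries K H E 0 = 1 := by
  ext n
  rw [coeff_mul, coeff_one]
  have key : ∀ p ∈ Finset.HasAntidiagonal.antidiagonal n,
      coeff p.1 (twistSeries K H E 0) * coeff p.2 (risingSeries K H E 0) =
      (n.factorial : K)⁻¹ • ((((n.choose p.2 : ℕ) : A) *
        (rising H 0 p.2 * ((-1) ^ p.1 * falling H 0 p.1))) * E ^ n) := by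
    intro p hp
    have hn := Finset.HasAntidiagonal.mem_antidiagonal.1 hp
    have hc : n.choose p.2 = n.choose p.1 := by
      rw [Nat.choose_symm_of_eq_add]; rw [← hn, add_comm]
    have hE : E ^ p.1 * rising H 0 p.2 = rising H 0 p.2 * E ^ p.1 :=
      (Commute.rising_right (hHE.symm.pow_left p.1) _ _).eq
    have hHH : falling H 0 p.1 * rising H 0 p.2 = rising H 0 p.2 * falling H 0 p.1 :=
      (Commute.rising_right (Commute.falling_right (Commute.refl H) _ _).symm _ _).eq
    have hs := inv_factorial_mul_choose K p.1 p.2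
    rw [hn] at hs
    have hneg : ((-1 : A) ^ p.1) = algebraMap K A ((-1) ^ p.1) := by simp
    rw [twistSeries, risingSeries, coeff_mk, coeff_mk, smul_mul_smul_comm, mul_assoc (falling _ _ _),
      ← mul_assoc (E ^ _), hE, mul_assoc (rising _ _ _), ← pow_add, hn, ← mul_assoc, hHH, hc,
      mul_assoc (n.choose p.1 : A), ← nsmul_eq_mul, ← Nat.cast_smul_eq_nsmul K, smul_smul, hs,
      div_eq_mul_inv, hneg, ← Algebra.smul_def, mul_smul_comm, smul_mul_assoc, smul_smul]
    congr 1; ring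
  rw [Finset.sum_congr rfl key, ← Finset.smul_sum, ← Finset.sum_mul,
    ← Finset.Nat.sum_antidiagonal_swap]
  simp only [Prod.fst_swap, Prod.snd_swap]
  rw [sum_rising_mul_falling']
  split_ifs with h <;> simp [h]

/-- Conjugating `x ⊗ 1` by the twist. -/
theorem twistSeries_mul_C (hHE : Commute H E) {x : A} {m : ℤ} (hx : H * x = x * H + m * x)
    (hxE : Commute x E) :
    twistSeries K H E 0 * C x = C x * oneSubPow E m * twistSeries K H E 0 := by
  rw [mul_assoc, ← twistSeries_add hHE]
  ext r
  rw [coeff_mul_C, coeff_C_mul, twistSeries, twistSeries, coeff_mk, coeff_mk, smul_mul_assoc,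
    mul_smul_comm, mul_assoc, ← (hxE.pow_right r).eq, ← mul_assoc, falling_mul_of_weight hx, mul_assoc]

variable {d : ℕ → A}

/-- Here i! d_i = (ad E)^i d_0, and right multiplication by E is left multiplication minus ad E;
since these two commute, the binomial theorem applies. -/
theorem mul_pow_eq_sum (hd : ∀ l, E * d l - d l * E = (l + 1 : A) * d (l + 1)) (r : ℕ) :
    d 0 * E ^ r = ∑ p ∈ Finset.HasAntidiagonal.antidiagonal r,
      (r.choose p.1 : A) * ((-1) ^ p.1 * (E ^ p.2 * ((p.1.factorial : A) * d p.1))) := by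
  induction r with
  | zero => simp
  | succ r ih =>
    rw [Finset.sum_antidiagonal_choose_succ_mul
      (fun i j => (-1) ^ i * (E ^ j * ((i.factorial : A) * d i))), pow_succ, ← mul_assoc, ih,
      Finset.sum_mul, ← Finset.sum_add_distrib]
    refine Finset.sum_congr rfl fun p hp => ?_
    have hc : r.choose p.2 = r.choose p.1 := by
      rw [Nat.choose_symm_of_eq_add]
      rw [← Finset.HasAntidiagonal.mem_antidiagonal.1 hp, add_comm]
    have h1 : ((p.1.factorial : A) * d p.1) * E = E * ((p.1.factorial : A) * d p.1) -
        (((p.1 + 1).factorial : A) * d (p.1 + 1)) := by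
      rw [mul_assoc, eq_sub_of_add_eq' (sub_eq_iff_eq_add.1 (hd p.1)).symm, mul_sub, ← mul_assoc,
        (Nat.cast_commute _ E).eq, mul_assoc, Nat.factorial_succ, Nat.mul_comm]
      push_cast
      rw [mul_assoc]
    rw [hc, mul_assoc, mul_assoc, mul_assoc, h1, ← mul_add]
    congr 1
    rw [pow_succ, pow_succ]
    noncomm_ring

theorem pow_mul_eq_sum (hd : ∀ l, E * d l - d l * E = (l + 1 : A) * d (l + 1)) (r : ℕ) :
    E ^ r * d 0 = ∑ p ∈ Finset.HasAntidiagonal.antidiagonal r,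
      (r.choose p.1 : A) * (((p.1.factorial : A) * d p.1) * E ^ p.2) := by
  induction r with
  | zero => simp
  | succ r ih =>
    rw [Finset.sum_antidiagonal_choose_succ_mul
      (fun i j => ((i.factorial : A) * d i) * E ^ j), pow_succ', mul_assoc, ih,
      Finset.mul_sum, ← Finset.sum_add_distrib]
    refine Finset.sum_congr rfl fun p hp => ?_
    have hc : r.choose p.2 = r.choose p.1 := by
      rw [Nat.choose_symm_of_eq_add]
      rw [← Finset.HasAntidiagonal.mem_antidiagonal.1 hp, add_comm]
    have h1 : E * ((p.1.factorial : A) * d p.1) = ((p.1.factorial : A) * d p.1) * E +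
        (((p.1 + 1).factorial : A) * d (p.1 + 1)) := by
      rw [← mul_assoc, ← (Nat.cast_commute _ E).eq, mul_assoc, sub_eq_iff_eq_add.1 (hd p.1), mul_add,
        add_comm, mul_assoc, Nat.factorial_succ, Nat.mul_comm]
      push_cast
      rw [mul_assoc]
    rw [hc, ← mul_assoc E, ← (Nat.cast_commute _ E).eq, mul_assoc, ← mul_assoc E, h1, ← mul_add]
    congr 1
    rw [pow_succ', add_mul, mul_assoc]

theorem inv_factorial_smul_choose (i j : ℕ) (x : A) :
    ((i + j).factorial : K)⁻¹ • (((i + j).choose i : A) * ((i.factorial : A) * x)) =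
      (j.factorial : K)⁻¹ • x := by
  have hi : (i.factorial : K) ≠ 0 := Nat.cast_ne_zero.2 (Nat.factorial_ne_zero i)
  rw [← nsmul_eq_mul, ← nsmul_eq_mul, ← Nat.cast_smul_eq_nsmul K, ← Nat.cast_smul_eq_nsmul K,
    smul_smul, smul_smul, inv_factorial_mul_choose, mul_right_comm, inv_mul_cancel₀ hi, one_mul]

/-- Conjugating `1 ⊗ x` by the twist. -/
theorem C_mul_risingSeries (hHE : Commute H E) (hHd : ∀ l, Commute H (d l))
    (hd : ∀ l, E * d l - d l * E = (l + 1 : A) * d (l + 1)) :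
    C (d 0) * risingSeries K H E 0 = risingSeries K H E 0 * conjSeries H E 0 d := by
  have hG : ∀ l : ℕ, risingSeries K H E 0 * oneSubPow E (-(l : ℤ)) = risingSeries K H E l := by
    intro l
    have h1 := oneSubPow_mul_of_step (E := E)
      (fun c => oneSubPow_one_mul_risingSeries (K := K) hHE c) (-l) l
    rw [add_neg_cancel] at h1
    rw [← h1]
    refine (Commute.oneSubPow_right ?_ _).eq
    rw [commute_iff_eq]
    ext r
    rw [coeff_mul_C, coeff_C_mul, risingSeries, coeff_mk, smul_mul_assoc, mul_smul_comm, mul_assoc,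
      ← pow_succ, pow_succ', ← mul_assoc, ← mul_assoc,
      (Commute.rising_right hHE.symm 0 r).eq]
  have hR : ∀ l : ℕ, risingSeries K H E 0 * ((-1) ^ l * (C (rising H 0 l) *
      (oneSubPow E (-(l : ℤ)) * C (d l)))) = series fun s =>
      C ((s.factorial : K)⁻¹ • ((-1) ^ l * (rising H 0 (l + s) * E ^ s * d l))) := fun l => by
    have h1 : risingSeries K H E 0 * C (rising H 0 l) = C (rising H 0 l) * risingSeries K H E 0 := by
      ext r
      rw [coeff_mul_C, coeff_C_mul, risingSeries, coeff_mk, smul_mul_assoc, mul_smul_comm, mul_assoc,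
        ← (Commute.rising_right (hHE.symm.pow_left r).symm.symm 0 l).eq.symm, ← mul_assoc,
        ← mul_assoc,
        (Commute.rising_right (Commute.rising_right (Commute.refl H) 0 l).symm 0 r).eq]
    rw [← mul_assoc, neg_one_pow_comm, mul_assoc, ← mul_assoc (risingSeries K H E 0), h1, mul_assoc,
      ← mul_assoc (risingSeries K H E 0), hG, series_C]
    ext s
    have hs : ((-1) ^ l : A⟦X⟧) = C ((-1) ^ l) := by simp
    rw [hs, coeff_C_mul, coeff_C_mul, coeff_mul_C, coeff_mk, risingSeries, coeff_mk, smul_mul_assoc,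
      mul_smul_comm, mul_smul_comm, rising_add, zero_add]
    simp only [mul_assoc]
  -- In degree r the right side becomes a sum over l + s = r with common factor H^{⟨r⟩}, which is
  -- the expansion of d_0 E^r with all powers of E moved to the left.
  rw [conjSeries, mul_series]
  simp only [hR]
  rw [series_series]
  simp only [← map_sum]
  rw [series_C]
  ext r
  rw [coeff_C_mul, risingSeries, coeff_mk, coeff_mk, mul_smul_comm, ← mul_assoc,
    ← (Commute.rising_right (hHd 0).symm 0 r).eq.symm, mul_assoc, mul_pow_eq_sum hd, Finset.mul_sum,
    Finset.smul_sum]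
  refine Finset.sum_congr rfl fun p hp => ?_
  rw [← Finset.HasAntidiagonal.mem_antidiagonal.1 hp,
    ← inv_factorial_smul_choose (K := K) p.1 p.2]
  congr 1
  have e1 : ∀ z : A, ((p.1.factorial : A)) * z = z * p.1.factorial := fun z => (Nat.cast_commute _ z).eq
  have e2 : ∀ z : A, ((p.1 + p.2).choose p.1 : A) * z = z * (p.1 + p.2).choose p.1 :=
    fun z => (Nat.cast_commute _ z).eq
  simp only [e1, e2, neg_one_pow_comm, ← mul_assoc]

/-- Conjugating by `∑ (1 / r!) h^{[r]} e^r t^r`. -/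
theorem fallingSeries_mul_C {h e : A} {m : ℤ} (he : h * e = e * h + e)
    (hd : ∀ l, e * d l - d l * e = (l + 1 : A) * d (l + 1))
    (hw : ∀ l : ℕ, h * d l = d l * h + (m + l : ℤ) * d l) :
    fallingSeries K h e 0 * C (d 0) =
      oneSubPow e (-m) * antiSeries h 1 d * fallingSeries K h e 0 := by
  -- Exchanging (1 - et)^{-m} with the series moves the factorials to starting point 1 + m, where
  -- they cross d_l as h^{[l]}. The power is then absorbed into the binomial series, whose shift
  -- becomes m; as d_l has weight m + l, the two factorials join into h^{[l+s]}.
  have h1 : antiSeries h (0 + 1 + m) d * oneSubPow e (-m) = oneSubPow e (-m) * antiSeries h 1 d := by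
    rw [antiSeries_mul_oneSubPow he hd]; congr 2; ring
  have h2 := oneSubPow_mul_of_step (E := e)
      (fun c => oneSubPow_one_mul_fallingSeries (K := K) he c) (-m) m
  rw [add_neg_cancel] at h2
  rw [← h1, mul_assoc, h2, antiSeries_eq_falling hw, series_mul_right]
  have h3 : ∀ l, C (falling h 0 l * d l) * fallingSeries K h e m = series fun s =>
      C ((s.factorial : K)⁻¹ • (falling h 0 (l + s) * (d l * e ^ s))) := fun l => by
    rw [series_C]
    ext s
    have := falling_mul_of_weight (hw l) (-l) s
    rw [show (-l + (m + l) : ℤ) = m by ring] at this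
    rw [coeff_C_mul, fallingSeries, coeff_mk, coeff_mk, mul_smul_comm, ← mul_assoc, mul_assoc _ (d l),
      ← this, falling_add, zero_sub]
    simp only [mul_assoc]
  simp only [h3]
  rw [series_series]
  simp only [← map_sum]
  rw [series_C]
  ext r
  rw [coeff_mul_C, fallingSeries, coeff_mk, coeff_mk, smul_mul_assoc, mul_assoc, pow_mul_eq_sum hd,
    Finset.mul_sum, Finset.smul_sum]
  refine Finset.sum_congr rfl fun p hp => ?_
  rw [← Finset.HasAntidiagonal.mem_antidiagonal.1 hp, ← mul_assoc, ← (Nat.cast_commute _ _).eq,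
    mul_assoc, mul_assoc (p.1.factorial : A), ← mul_assoc _ (p.1.factorial : A),
    ← (Nat.cast_commute _ (falling h 0 _)).eq, mul_assoc (p.1.factorial : A),
    inv_factorial_smul_choose]

/-- The cocycle identity for `(1 - e t)^h`. -/
theorem twistSeries_cocycle {h₁ h₂ e₂ e₃ : A} (h12 : Commute h₁ h₂) (he12 : Commute h₁ e₂)
    (he13 : Commute h₁ e₃) (hee : Commute e₂ e₃)
    (he : h₂ * e₂ = e₂ * h₂ + e₂) :
    twistSeries K h₁ e₂ 0 * twistSeries K (h₁ + h₂) e₃ 0 =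
      twistSeries K h₂ e₃ 0 * twistSeries K h₁ (e₂ + e₃) 0 := by
  have hpow : ∀ r : ℕ, h₂ * e₂ ^ r = e₂ ^ r * h₂ + (r : ℤ) * e₂ ^ r := by
    intro r
    induction r with
    | zero => simp
    | succ r ih =>
      rw [pow_succ, ← mul_assoc, ih, add_mul, mul_assoc, he]
      push_cast
      noncomm_ring
  -- Common triple sum: the left side reaches it by Chu–Vandermonde for h₁ + h₂, the right side by
  -- the binomial theorem for e₂ + e₃.
  set t : ℕ → ℕ → ℕ → A := fun r i j =>
    ((-1) ^ (r + i + j) * ((r.factorial : K)⁻¹ * (i.factorial : K)⁻¹ * (j.factorial : K)⁻¹)) •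
      (falling h₁ 0 (r + i) * falling h₂ 0 j * e₂ ^ r * e₃ ^ (i + j)) with ht
  ext n
  rw [coeff_mul, coeff_mul]
  trans ∑ p ∈ Finset.HasAntidiagonal.antidiagonal n,
    ∑ q ∈ Finset.HasAntidiagonal.antidiagonal p.2, t p.1 q.1 q.2
  · refine Finset.sum_congr rfl fun p _ => ?_
    obtain ⟨r, s⟩ := p
    -- The shift 0 is split as -r + r. Then (h₁ - r)^{[i]} continues h₁^{[r]}, while (h₂ + r)^{[j]}
    -- becomes h₂^{[j]} on crossing e₂^r, of weight r under h₂.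
    have hv := falling_vandermonde h12 (-r) r s
    rw [neg_add_cancel] at hv
    dsimp only
    rw [twistSeries, twistSeries, coeff_mk, coeff_mk, hv, Finset.sum_mul, smul_mul_smul_comm,
      Finset.mul_sum, Finset.smul_sum]
    refine Finset.sum_congr rfl fun q hq => ?_
    obtain ⟨i, j⟩ := q
    have hs : i + j = s := Finset.HasAntidiagonal.mem_antidiagonal.1 hq
    subst hs
    have c1 : e₂ ^ r * falling h₁ (-r) i = falling h₁ (-r) i * e₂ ^ r :=
      (Commute.falling_right (he12.pow_right r).symm _ _).eq
    have c2 : e₂ ^ r * falling h₂ r j = falling h₂ 0 j * e₂ ^ r := by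
      rw [falling_mul_of_weight (hpow r), zero_add]
    have c3 : falling h₁ 0 (r + i) = falling h₁ 0 r * falling h₁ (-r) i := by
      rw [falling_add, zero_sub]
    have hsc := inv_factorial_mul_choose K i j
    dsimp only [ht]
    have e1 : falling h₁ 0 r * e₂ ^ r * (((i + j).choose i : A) *
        (falling h₁ (-r) i * falling h₂ r j) * e₃ ^ (i + j)) = ((i + j).choose i : K) •
        (falling h₁ 0 (r + i) * falling h₂ 0 j * e₂ ^ r * e₃ ^ (i + j)) := by
      rw [Nat.cast_smul_eq_nsmul, nsmul_eq_mul, c3]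
      rw [mul_assoc ((i + j).choose i : A), ← mul_assoc _ ((i + j).choose i : A),
        ← (Nat.cast_commute _ (_ * _)).eq, mul_assoc ((i + j).choose i : A)]
      congr 1
      simp only [mul_assoc]
      rw [← mul_assoc (e₂ ^ r) (falling h₁ _ _), c1, mul_assoc (falling h₁ (-r) i),
        ← mul_assoc (e₂ ^ r) (falling h₂ _ _), c2]
      simp only [mul_assoc]
    rw [e1, smul_smul]
    congr 1
    rw [div_eq_mul_inv, div_eq_mul_inv, pow_add _ (r + i), pow_add _ r, pow_add _ i,
      show (-1 : K) ^ r * (r.factorial : K)⁻¹ * ((-1) ^ i * (-1) ^ j * ((i + j).factorial : K)⁻¹) *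
        ((i + j).choose i : K) = (-1 : K) ^ r * (r.factorial : K)⁻¹ * ((-1) ^ i * (-1) ^ j) *
        (((i + j).factorial : K)⁻¹ * ((i + j).choose i : K)) by ring, hsc]
    ring
  · rw [← sum_antidiagonal_assoc, ← Finset.Nat.sum_antidiagonal_swap]
    refine Finset.sum_congr rfl fun p _ => ?_
    obtain ⟨j, s⟩ := p
    dsimp only [Prod.swap]
    rw [twistSeries, twistSeries, coeff_mk, coeff_mk, hee.add_pow', smul_mul_smul_comm,
      Finset.mul_sum, Finset.mul_sum, Finset.smul_sum]
    refine (Finset.sum_congr rfl fun q hq => ?_)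
    obtain ⟨r, i⟩ := q
    have hs : r + i = s := Finset.HasAntidiagonal.mem_antidiagonal.1 hq
    subst hs
    have hsc := inv_factorial_mul_choose K r i
    have c1 : e₃ ^ j * falling h₁ 0 (r + i) = falling h₁ 0 (r + i) * e₃ ^ j :=
      (Commute.falling_right (he13.pow_right j).symm _ _).eq
    have c2 : falling h₂ 0 j * falling h₁ 0 (r + i) = falling h₁ 0 (r + i) * falling h₂ 0 j :=
      (Commute.falling_right (Commute.falling_right h12 0 j).symm _ _).eq
    have c3 : e₃ ^ j * e₂ ^ r = e₂ ^ r * e₃ ^ j := (hee.symm.pow_pow j r).eq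
    dsimp only [ht]
    have e1 : falling h₂ 0 j * e₃ ^ j * (falling h₁ 0 (r + i) *
        ((r + i).choose r • (e₂ ^ r * e₃ ^ i))) = ((r + i).choose r : K) •
        (falling h₁ 0 (r + i) * falling h₂ 0 j * e₂ ^ r * e₃ ^ (i + j)) := by
      rw [Nat.cast_smul_eq_nsmul, mul_smul_comm, mul_smul_comm]
      congr 1
      rw [mul_assoc (falling h₂ 0 j), ← mul_assoc (e₃ ^ j), c1, mul_assoc (falling h₁ _ _),
        ← mul_assoc (e₃ ^ j), c3, ← mul_assoc (falling h₂ 0 j), c2, mul_assoc (e₂ ^ r), ← pow_add,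
        add_comm j i]
      simp only [mul_assoc]
    rw [e1, smul_smul]
    change _ • _ = _ • _
    congr 1
    rw [div_eq_mul_inv, div_eq_mul_inv, pow_add _ (r + i), pow_add _ r,
      show (-1 : K) ^ j * (j.factorial : K)⁻¹ * ((-1) ^ r * (-1) ^ i * ((r + i).factorial : K)⁻¹) *
        ((r + i).choose r : K) = (-1 : K) ^ j * (j.factorial : K)⁻¹ * ((-1) ^ r * (-1) ^ i) *
        (((r + i).factorial : K)⁻¹ * ((r + i).choose r : K)) by ring, hsc]
    ring

end ExpSeries

end Topological

/-! ### The Jordanian twist on the enveloping algebra of a Lie algebra with [h, e] = e. -/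

namespace JordanianTwist

section

attribute [local instance 100] LieRing.ofAssociativeRing
attribute [local instance 2000] Algebra.toModule

variable (K : Type*) {L : Type*} [Field K] [LieRing L] [LieAlgebra K L]

open UniversalEnvelopingAlgebra (ι)

local notation "𝔘" => UniversalEnvelopingAlgebra K L

/-- The Jordanian twist `∑ ((-1)^r / r!) h^{[r]} ⊗ e^r t^r` for `h, e` with `[h, e] = e`. -/
noncomputable def twist (h e : L) : (𝔘 ⊗[K] 𝔘)⟦X⟧ :=
  PowerSeries.mk fun r => ((-1 : K) ^ r / (r.factorial : K)) •
    (falling (ι K h) 0 r ⊗ₜ[K] (ι K e ^ r) : 𝔘 ⊗[K] 𝔘)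

variable (h e : L)

theorem twist_eq : twist K h e = twistSeries K (ι K h ⊗ₜ[K] 1 : 𝔘 ⊗[K] 𝔘) (1 ⊗ₜ ι K e) 0 := by
  ext r
  have := map_falling (Algebra.TensorProduct.includeLeft (R := K) (S := K) (A := 𝔘)
    (B := 𝔘)).toRingHom (ι K h) 0 r
  change falling (ι K h) 0 r ⊗ₜ[K] 1 = falling (ι K h ⊗ₜ[K] 1) 0 r at this
  rw [twist, twistSeries, coeff_mk, coeff_mk, ← this, Algebra.TensorProduct.tmul_pow,
    Algebra.TensorProduct.tmul_mul_tmul, one_pow, mul_one, one_mul]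

theorem commute_tmul (x y : 𝔘) : Commute (x ⊗ₜ[K] 1 : 𝔘 ⊗[K] 𝔘) (1 ⊗ₜ y) := by
  simp [commute_iff_eq]

theorem constantCoeff_twist : constantCoeff (twist K h e) = 1 := by
  rw [twist_eq]; exact constantCoeff_twistSeries _ _ _

theorem isUnit_twist : IsUnit (twist K h e) :=
  isUnit_of_constantCoeff_eq_one (constantCoeff_twist K h e)

theorem coeff_one_twist : coeff 1 (twist K h e) = - (ι K h ⊗ₜ[K] ι K e : 𝔘 ⊗[K] 𝔘) := by
  rw [twist, coeff_mk]
  simp [falling]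

theorem map_twist_eq_one {B : Type*} [Ring B] [Algebra K B] (f : 𝔘 ⊗[K] 𝔘 →ₐ[K] B)
    (hf : f (ι K h ⊗ₜ 1) = 0 ∨ f (1 ⊗ₜ ι K e) = 0) :
    PowerSeries.map f.toRingHom (twist K h e) = 1 := by
  ext r
  rw [twist_eq, map_twistSeries, twistSeries, coeff_mk, coeff_one]
  cases r with
  | zero => simp [falling]
  | succ r =>
    rcases hf with hf | hf
    · rw [hf, falling_zero_zero_succ]; simp
    · rw [hf]; simp

variable {h e}

theorem lie_ι (he : ⁅h, e⁆ = e) : ι K h * ι K e = ι K e * ι K h + ι K e := by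
  have := LieHom.map_lie (ι K) h e
  rw [he, LieRing.of_associative_ring_bracket] at this
  exact (eq_add_of_sub_eq' this.symm)

theorem isDrinfeldTwist [CharZero K] (he : ⁅h, e⁆ = e) : IsDrinfeldTwist K (twist K h e) where
  isUnit := isUnit_twist K h e
  cocycle := by
    have hc : ∀ x : L, Bialgebra.comulAlgHom K 𝔘 (ι K x) = ι K x ⊗ₜ[K] 1 + 1 ⊗ₜ[K] ι K x :=
      UniversalEnvelopingAlgebra.comul₀_ι K L
    have hu := lie_ι K he
    -- Subscripts give the leg of the triple tensor product. Since h and e are primitive, Δ₀ ⊗ Id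
    -- replaces h by h₁ + h₂, and Id ⊗ Δ₀ replaces e by e₂ + e₃.
    have key := twistSeries_cocycle (K := K) (h₁ := (ι K h ⊗ₜ[K] (1 : 𝔘 ⊗[K] 𝔘)))
      (h₂ := (1 : 𝔘) ⊗ₜ[K] (ι K h ⊗ₜ[K] (1 : 𝔘)))
      (e₂ := (1 : 𝔘) ⊗ₜ[K] (ι K e ⊗ₜ[K] (1 : 𝔘))) (e₃ := (1 : 𝔘) ⊗ₜ[K] ((1 : 𝔘) ⊗ₜ[K] ι K e))
      (by simp [commute_iff_eq]) (by simp [commute_iff_eq]) (by simp [commute_iff_eq])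
      (by simp [commute_iff_eq])
      (by rw [Algebra.TensorProduct.tmul_mul_tmul, Algebra.TensorProduct.tmul_mul_tmul,
        Algebra.TensorProduct.tmul_mul_tmul, Algebra.TensorProduct.tmul_mul_tmul, hu,
        TensorProduct.add_tmul, TensorProduct.tmul_add]; simp only [mul_one])
    rw [twist_eq, map_twistSeries, map_twistSeries, map_twistSeries, map_twistSeries, map_mul]
    have h1 := map_twistSeries K (Algebra.TensorProduct.assoc K K K 𝔘 𝔘 𝔘).toAlgHom
    change ∀ H E c, PowerSeries.map (Algebra.TensorProduct.assoc K K K 𝔘 𝔘 𝔘).toRingEquiv.toRingHom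
      (twistSeries K H E c) = _ at h1
    rw [h1, h1]
    convert key using 3
    all_goals first
      | rfl
      | simp [-UniversalEnvelopingAlgebra.ι_apply, Algebra.TensorProduct.one_def, hc,
          TensorProduct.add_tmul, TensorProduct.tmul_add]
  counit_left := map_twist_eq_one K h e _ (Or.inl (by
    have : Bialgebra.counitAlgHom K 𝔘 (ι K h) = 0 := UniversalEnvelopingAlgebra.counit₀_ι K L h
    change (Algebra.TensorProduct.lid K 𝔘) (Algebra.TensorProduct.map _ _ _) = 0
    rw [Algebra.TensorProduct.map_tmul, this, TensorProduct.zero_tmul, map_zero]))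
  counit_right := map_twist_eq_one K h e _ (Or.inr (by
    have : Bialgebra.counitAlgHom K 𝔘 (ι K e) = 0 := UniversalEnvelopingAlgebra.counit₀_ι K L e
    change (Algebra.TensorProduct.rid K K 𝔘) (Algebra.TensorProduct.map _ _ _) = 0
    rw [Algebra.TensorProduct.map_tmul, this, TensorProduct.tmul_zero, map_zero]))

theorem antipode_pow (x : L) (r : ℕ) :
    HopfAlgebra.antipode K ((ι K x : 𝔘) ^ r) = (-1) ^ r * ι K x ^ r := by
  change UniversalEnvelopingAlgebra.antipode₀ K L _ = _
  induction r with
  | zero => simp [UniversalEnvelopingAlgebra.antipode₀_one]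
  | succ r ih =>
    rw [pow_succ, UniversalEnvelopingAlgebra.antipode₀_mul, ih,
      UniversalEnvelopingAlgebra.antipode₀_ι, neg_mul, ← mul_assoc, neg_one_pow_comm, mul_assoc,
      ← pow_succ', ← pow_succ, pow_succ (-1 : 𝔘), mul_neg_one, neg_mul]

/-- The sign of S₀(e^r) = (-1)^r e^r cancels that of the twist. -/
theorem twistElement_twist : twistElement K (twist K h e) = fallingSeries K (ι K h) (ι K e) 0 := by
  ext r
  rw [twistElement, fallingSeries, coeff_mk, twist, extend]
  simp only [LinearMap.coe_mk, AddHom.coe_mk, coeff_mk]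
  rw [map_smul, LinearMap.comp_apply, LinearMap.lTensor_tmul, LinearMap.mul'_apply,
    antipode_pow, ← mul_assoc, neg_one_pow_comm, mul_assoc, div_eq_mul_inv, mul_comm, mul_smul]
  congr 1
  have hneg : ((-1 : 𝔘) ^ r) = algebraMap K 𝔘 ((-1) ^ r) := by simp
  rw [hneg, ← Algebra.smul_def, smul_smul, ← mul_pow]
  simp

theorem isUnit_twistElement : IsUnit (twistElement K (twist K h e)) :=
  isUnit_of_constantCoeff_eq_one (by
    rw [twistElement_twist, ← coeff_zero_eq_constantCoeff_apply, fallingSeries, coeff_mk]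
    simp [falling])

theorem twist_classical : Algebra.TensorProduct.comm K 𝔘 𝔘 (coeff 1 (twist K h e)) -
    coeff 1 (twist K h e) = ι K h ⊗ₜ[K] ι K e - ι K e ⊗ₜ[K] ι K h := by
  rw [coeff_one_twist, map_neg, Algebra.TensorProduct.comm_tmul]
  abel

end

end JordanianTwist

/-! ### Reduction modulo t and the classical limit. -/

namespace JordanianData

section

attribute [local instance 100] LieRing.ofAssociativeRing
attribute [local instance 2000] Algebra.toModule

variable {R L : Type*} [CommRing R] [LieRing L] [LieAlgebra R L] (T : JordanianData R L)

open UniversalEnvelopingAlgebra (ι)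

local notation "𝔘" => UniversalEnvelopingAlgebra R L

theorem induct {p : 𝔘 → Prop} (halg : ∀ c, p (algebraMap R 𝔘 c))
    (hadd : ∀ a b, p a → p b → p (a + b)) (hmul : ∀ a b, p a → p b → p (a * b))
    (hι : ∀ (m : ℤ) (x : L), ⁅T.h, x⁆ = m • x → p (ι R x)) (a : 𝔘) : p a := by
  induction a using UniversalEnvelopingAlgebra.induct with
  | h1 => rw [← map_one (algebraMap R 𝔘)]; exact halg 1
  | hadd a b ha hb => exact hadd a b ha hb
  | hs c a ha => rw [Algebra.smul_def]; exact hmul _ _ (halg c) ha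
  | hι x a ha =>
    refine hmul _ _ ?_ ha
    have hx : x ∈ Submodule.span R {x : L | ∃ m : ℤ, ⁅T.h, x⁆ = m • x} :=
      T.span_weights ▸ Submodule.mem_top
    induction hx using Submodule.span_induction with
    | mem x hx => obtain ⟨m, hx⟩ := hx; exact hι m x hx
    | zero => rw [map_zero, ← map_zero (algebraMap R 𝔘)]; exact halg 0
    | add x y _ _ hx hy => rw [map_add]; exact hadd _ _ hx hy
    | smul c x _ hx => rw [map_smul, Algebra.smul_def]; exact hmul _ _ (halg c) hx

theorem comul_C_algebraMap (c : R) :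
    T.comul (C (algebraMap R 𝔘 c)) = C (algebraMap R (𝔘 ⊗[R] 𝔘) c) := by
  rw [← algebraMap_eq_C, AlgHom.commutes, algebraMap_eq_C]

theorem antipode_C_algebraMap (c : R) :
    T.antipode (C (algebraMap R 𝔘 c)) = C (algebraMap R 𝔘 c) := by
  rw [Algebra.algebraMap_eq_smul_one, C_smul, map_smul, map_one, T.antipode_one]

theorem antipode₀_algebraMap (c : R) :
    HopfAlgebra.antipode R (algebraMap R 𝔘 c) = algebraMap R 𝔘 c := by
  rw [Algebra.algebraMap_eq_smul_one, map_smul]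
  congr 1
  exact UniversalEnvelopingAlgebra.antipode₀_one R L

theorem comulAlgHom_ι (x : L) :
    Bialgebra.comulAlgHom R 𝔘 (ι R x) = ι R x ⊗ₜ[R] 1 + 1 ⊗ₜ[R] ι R x :=
  UniversalEnvelopingAlgebra.comul₀_ι R L x

theorem antipode₀_ι (x : L) : HopfAlgebra.antipode R (ι R x) = - ι R x :=
  UniversalEnvelopingAlgebra.antipode₀_ι R L x

theorem antipode₀_mul (a b : 𝔘) : HopfAlgebra.antipode R (a * b) =
    HopfAlgebra.antipode R b * HopfAlgebra.antipode R a :=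
  UniversalEnvelopingAlgebra.antipode₀_mul R L a b

theorem constantCoeff_series {A : Type*} [Ring A] (f : ℕ → A⟦X⟧) :
    constantCoeff (series f) = constantCoeff (f 0) := by
  rw [← coeff_zero_eq_constantCoeff_apply, series, coeff_mk]
  simp

theorem coeff_one_series {A : Type*} [Ring A] (f : ℕ → A⟦X⟧) :
    coeff 1 (series f) = coeff 1 (f 0) + constantCoeff (f 1) := by
  simp [series, Finset.Nat.antidiagonal_succ]

theorem constantCoeff_conjRight (x : L) : constantCoeff (T.conjRight x) = right (ι R x) := by
  rw [conjRight_apply, conjSeries, constantCoeff_series]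
  simp [rising, oneSubPow_zero, dU_zero]

theorem coeff_one_conjRight (x : L) :
    coeff 1 (T.conjRight x) = - (left T.hU * right (T.dU x 1)) := by
  rw [conjRight_apply, conjSeries, coeff_one_series]
  simp [rising, oneSubPow_zero, constantCoeff_oneSubPow]

variable {T} in
theorem constantCoeff_comulL {m : ℤ} {x : L} (hx : ⁅T.h, x⁆ = m • x) :
    constantCoeff (T.comulL x) = ι R x ⊗ₜ[R] 1 + 1 ⊗ₜ[R] ι R x := by
  rw [comulL, LinearMap.add_apply, conjLeft_of_weight hx, map_add, constantCoeff_conjRight, map_mul,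
    constantCoeff_oneSubPow, mul_one, constantCoeff_C]
  rfl

variable {T} in
theorem coeff_one_comulL {m : ℤ} {x : L} (hx : ⁅T.h, x⁆ = m • x) :
    coeff 1 (T.comulL x) =
      - (ι R ⁅T.h, x⁆ ⊗ₜ[R] T.eU) - T.hU ⊗ₜ[R] ι R ⁅T.e, x⁆ := by
  rw [comulL, LinearMap.add_apply, conjLeft_of_weight hx, map_add, coeff_one_conjRight, coeff_C_mul,
    coeff_one_oneSubPow, hx, dU, D_one, map_zsmul, ← sub_eq_add_neg, ← zsmul_eq_mul,
    mul_neg, mul_smul_comm]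
  simp only [left, right, AlgHom.toRingHom_eq_coe, RingHom.coe_coe,
    Algebra.TensorProduct.includeLeft_apply, Algebra.TensorProduct.includeRight_apply,
    Algebra.TensorProduct.tmul_mul_tmul, one_mul, mul_one]
  rw [TensorProduct.smul_tmul']

theorem constantCoeff_comul (z : 𝔘⟦X⟧) :
    constantCoeff (T.comul z) = Bialgebra.comulAlgHom R 𝔘 (constantCoeff z) := by
  have key : ∀ a : 𝔘, constantCoeff (T.comul (C a)) = Bialgebra.comulAlgHom R 𝔘 a := fun a => by
    induction a using T.induct with
    | halg c => rw [comul_C_algebraMap, AlgHom.commutes]; simp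
    | hadd a b ha hb => simp only [map_add, ha, hb]
    | hmul a b ha hb => simp only [map_mul, ha, hb]
    | hι m x hx => rw [comul_C_ι, constantCoeff_comulL hx, comulAlgHom_ι]
  conv_lhs => rw [eq_shift_mul_X_add_const z]
  rw [map_add, map_add, key]
  have := T.isLinear_comul.map_mul_X (PowerSeries.mk (fun n => coeff (n + 1) z))
  rw [AlgHom.toLinearMap_apply] at this
  rw [this]
  simp

theorem constantCoeff_antipode (z : 𝔘⟦X⟧) :
    constantCoeff (T.antipode z) = HopfAlgebra.antipode R (constantCoeff z) := by
  have key : ∀ a : 𝔘, constantCoeff (T.antipode (C a)) = HopfAlgebra.antipode R a := fun a => by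
    induction a using T.induct with
    | halg c => rw [antipode_C_algebraMap, antipode₀_algebraMap]; simp
    | hadd a b ha hb => simp only [map_add, ha, hb]
    | hmul a b ha hb => simp only [map_mul, ha, hb, antipode_mul, antipode₀_mul]
    | hι m x hx =>
      rw [antipode_C_ι, antipodeL_of_weight hx, antipode₀_ι, antiSeries, map_neg, map_mul,
        constantCoeff_oneSubPow, constantCoeff_series]
      simp [rising, dU_zero]
  conv_lhs => rw [eq_shift_mul_X_add_const z]
  rw [map_add, map_add, key]
  have := T.isLinear_antipode.map_mul_X (PowerSeries.mk (fun n => coeff (n + 1) z))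
  rw [this]
  simp

/-- The classical `r`-matrix. -/
noncomputable def rMatrix : 𝔘 ⊗[R] 𝔘 := T.hU ⊗ₜ T.eU - T.eU ⊗ₜ T.hU

/-- As functions of a, both sides are derivations along Δ₀: the left one because Δ₀ is cocommutative
and Δ is multiplicative, the right one because it is a commutator. Hence weight vectors suffice. -/
theorem comul_classical (a : 𝔘) : coeff 1 (T.comul (C a)) -
      Algebra.TensorProduct.comm R 𝔘 𝔘 (coeff 1 (T.comul (C a))) =
    Bialgebra.comulAlgHom R 𝔘 a * T.rMatrix - T.rMatrix * Bialgebra.comulAlgHom R 𝔘 a := by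
  have hcc : ∀ a : 𝔘, Algebra.TensorProduct.comm R 𝔘 𝔘 (Bialgebra.comulAlgHom R 𝔘 a) =
      Bialgebra.comulAlgHom R 𝔘 a := fun a => by
    induction a using T.induct with
    | halg c => rw [AlgHom.commutes, AlgEquiv.commutes]
    | hadd a b ha hb => simp only [map_add, ha, hb]
    | hmul a b ha hb => simp only [map_mul, ha, hb]
    | hι m x hx => 
      rw [comulAlgHom_ι, map_add, Algebra.TensorProduct.comm_tmul, Algebra.TensorProduct.comm_tmul,
        add_comm]
  induction a using T.induct with
  | halg c =>
    rw [comul_C_algebraMap, AlgHom.commutes, (Algebra.commutes c T.rMatrix), coeff_C]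
    simp
  | hadd a b ha hb =>
    simp only [map_add, add_mul, mul_add]
    rw [add_sub_add_comm, add_sub_add_comm, ha, hb]
  | hmul a b ha hb =>
    have h1 : ∀ x y : (𝔘 ⊗[R] 𝔘)⟦X⟧, coeff 1 (x * y) =
        constantCoeff x * coeff 1 y + coeff 1 x * constantCoeff y := fun x y => by
      rw [coeff_mul]; simp [Finset.Nat.antidiagonal_succ]
    simp only [map_mul, h1, map_add, constantCoeff_comul, constantCoeff_C, hcc]
    rw [add_sub_add_comm, ← mul_sub, ← sub_mul, ha, hb]
    noncomm_ring
  | hι m x hx =>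
    rw [comul_C_ι, coeff_one_comulL hx, comulAlgHom_ι, rMatrix, ι_lie, ι_lie]
    simp only [map_sub, map_neg, Algebra.TensorProduct.comm_tmul, add_mul, mul_add, mul_sub, sub_mul,
      Algebra.TensorProduct.tmul_mul_tmul, one_mul, mul_one, TensorProduct.sub_tmul,
      TensorProduct.tmul_sub, hU, eU]
    abel

end

/-! ### Comparison with the twisted Hopf structure over the field. -/

section

attribute [local instance 100] LieRing.ofAssociativeRing
attribute [local instance 2000] Algebra.toModule

variable {R L : Type*} [CommRing R] [LieRing L] [LieAlgebra R L] (T : JordanianData R L)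
  {K L' : Type*} [Field K] [Algebra R K] [LieRing L'] [LieAlgebra K L']

open UniversalEnvelopingAlgebra (ι)
open JordanianTwist

local notation "𝔘" => UniversalEnvelopingAlgebra R L
local notation "𝔙" => UniversalEnvelopingAlgebra K L'

theorem tensorBaseChange_algebraMap {φ : 𝔘 →+* 𝔙}
    (hφ : ∀ r, φ (algebraMap R 𝔘 r) = algebraMap K 𝔙 (algebraMap R K r)) (c : R) :
    tensorBaseChange φ hφ (algebraMap R (𝔘 ⊗[R] 𝔘) c) =
      algebraMap K (𝔙 ⊗[K] 𝔙) (algebraMap R K c) := by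
  rw [Algebra.TensorProduct.algebraMap_apply, tensorBaseChange_tmul, hφ, map_one,
    Algebra.TensorProduct.algebraMap_apply]

theorem map_scalar_commute (c : R) (z : (𝔙 ⊗[K] 𝔙)⟦X⟧) :
    C (algebraMap K (𝔙 ⊗[K] 𝔙) (algebraMap R K c)) * z =
      z * C (algebraMap K (𝔙 ⊗[K] 𝔙) (algebraMap R K c)) := by
  rw [← scalar_C, scalar_commute]

/-- In the intertwining form Δ F = F Δ₀ the relation passes from a and b to ab, so only weight
vectors x remain. There x ⊗ 1 is `twistSeries_mul_C` and 1 ⊗ x is `C_mul_risingSeries`. -/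
theorem comul_mul_twist [CharZero K] {φ : 𝔘 →+* 𝔙}
    (hφ : ∀ r, φ (algebraMap R 𝔘 r) = algebraMap K 𝔙 (algebraMap R K r))
    {f : L → L'} (hf : ∀ x, φ (ι R x) = ι K (f x)) (z : 𝔘⟦X⟧) :
    PowerSeries.map (tensorBaseChange φ hφ) (T.comul z) * twist K (f T.h) (f T.e) =
      twist K (f T.h) (f T.e) * Topological.comul₀ K (PowerSeries.map φ z) := by
  set F := twist K (f T.h) (f T.e) with hF
  have hFG : F * risingSeries K (ι K (f T.h) ⊗ₜ[K] 1 : 𝔙 ⊗[K] 𝔙) (1 ⊗ₜ ι K (f T.e)) 0 = 1 := by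
    rw [hF, twist_eq, twistSeries_mul_risingSeries (commute_tmul K _ _)]
  have hGF : risingSeries K (ι K (f T.h) ⊗ₜ[K] 1 : 𝔙 ⊗[K] 𝔙) (1 ⊗ₜ ι K (f T.e)) 0 * F = 1 := by
    have hu : IsUnit F := isUnit_twist K _ _
    rw [← hu.mul_right_inj, ← mul_assoc, hFG, one_mul, mul_one]
  refine PreservesSeries.congr
    (((preservesSeries_map _).comp T.isLinear_comul.preservesSeries).mul_right F)
    (((preservesSeries_map _).comp (preservesSeries_map _)).mul_left F) (fun a => ?_) z
  change PowerSeries.map (tensorBaseChange φ hφ) (T.comul (C a)) * F = F * Topological.comul₀ K _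
  induction a using T.induct with
  | halg c =>
    rw [comul_C_algebraMap, PowerSeries.map_C, PowerSeries.map_C, hφ, tensorBaseChange_algebraMap,
      Topological.comul₀, PowerSeries.map_C]
    change _ = F * C (Bialgebra.comulAlgHom K 𝔙 _)
    rw [AlgHom.commutes, map_scalar_commute]
  | hadd a b ha hb => simp only [map_add, add_mul, mul_add, ha, hb]
  | hmul a b ha hb =>
    simp only [map_mul]
    rw [mul_assoc, hb, ← mul_assoc, ha, mul_assoc]
  | hι m x hx =>
    rw [comul_C_ι, comulL, LinearMap.add_apply, conjLeft_of_weight hx, conjRight_apply, map_add,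
      map_mul, map_conjSeries, map_oneSubPow, PowerSeries.map_C, PowerSeries.map_C,
      Topological.comul₀, PowerSeries.map_C]
    have hl : ∀ a, tensorBaseChange φ hφ (left a) = φ a ⊗ₜ 1 := fun a => by
      change tensorBaseChange φ hφ (a ⊗ₜ 1) = _
      rw [tensorBaseChange_tmul, map_one]
    have hr : ∀ a, tensorBaseChange φ hφ (right a) = 1 ⊗ₜ φ a := fun a => by
      change tensorBaseChange φ hφ (1 ⊗ₜ a) = _
      rw [tensorBaseChange_tmul, map_one]
    change _ = F * C (Bialgebra.comulAlgHom K 𝔙 _)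
    rw [hf, comulAlgHom_ι, map_add, mul_add, add_mul]
    simp only [hl, hr, hU, eU, hf]
    congr 1
    · rw [hF, twist_eq]
      refine (twistSeries_mul_C (commute_tmul K _ _) ?_ (commute_tmul K _ _)).symm
      have := congrArg φ (hU_mul_ι hx)
      rw [map_add, map_mul, map_mul, map_mul, hU, hf, hf, map_intCast] at this
      rw [Algebra.TensorProduct.tmul_mul_tmul, Algebra.TensorProduct.tmul_mul_tmul, this, mul_one,
        TensorProduct.add_tmul, ← zsmul_eq_mul, ← zsmul_eq_mul, TensorProduct.smul_tmul']
    · have key := C_mul_risingSeries (K := K) (H := (ι K (f T.h) ⊗ₜ[K] 1 : 𝔙 ⊗[K] 𝔙))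
        (E := 1 ⊗ₜ ι K (f T.e)) (d := fun l => 1 ⊗ₜ φ (T.dU x l)) (commute_tmul K _ _)
        (fun l => commute_tmul K _ _) (fun l => by
          have := congrArg φ (T.eU_mul_dU x l)
          rw [map_sub, map_mul, map_mul, eU, hf, map_mul, map_add, map_natCast, map_one] at this
          rw [Algebra.TensorProduct.tmul_mul_tmul, Algebra.TensorProduct.tmul_mul_tmul,
            ← TensorProduct.tmul_sub, this, mul_one]
          have h2 : ((l : 𝔙 ⊗[K] 𝔙) + 1) = 1 ⊗ₜ ((l : 𝔙) + 1) := by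
            rw [TensorProduct.tmul_add, ← Algebra.TensorProduct.one_def,
              Algebra.TensorProduct.natCast_def']
          rw [h2, Algebra.TensorProduct.tmul_mul_tmul, mul_one])
      have h3 : F * C (1 ⊗ₜ[K] ι K (f x)) = F * (C (1 ⊗ₜ[K] φ (T.dU x 0)) *
          risingSeries K (ι K (f T.h) ⊗ₜ[K] 1 : 𝔙 ⊗[K] 𝔙) (1 ⊗ₜ ι K (f T.e)) 0) * F := by
        rw [mul_assoc, mul_assoc, hGF, mul_one, dU_zero, hf]
      rw [h3, key, ← mul_assoc, hFG, one_mul]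

/-- Both S and S₀ reverse products, so the relation S w = w S₀ is again multiplicative and reduces
to weight vectors, where it is `fallingSeries_mul_C`. -/
theorem antipode_mul_twistElement [CharZero K] {φ : 𝔘 →+* 𝔙}
    (hφ : ∀ r, φ (algebraMap R 𝔘 r) = algebraMap K 𝔙 (algebraMap R K r))
    {f : L → L'} (hf : ∀ x, φ (ι R x) = ι K (f x)) (z : 𝔘⟦X⟧) :
    PowerSeries.map φ (T.antipode z) * twistElement K (twist K (f T.h) (f T.e)) =
      twistElement K (twist K (f T.h) (f T.e)) *
        Topological.antipode₀ K (PowerSeries.map φ z) := by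
  set w := twistElement K (twist K (f T.h) (f T.e)) with hw
  refine PreservesSeries.congr
    (((preservesSeries_map _).comp T.isLinear_antipode.preservesSeries).mul_right w)
    (((isLinear_extend _).preservesSeries.comp (preservesSeries_map _)).mul_left w) (fun a => ?_) z
  rw [PowerSeries.map_C, extend_C]
  induction a using T.induct with
  | halg c =>
    rw [antipode_C_algebraMap, PowerSeries.map_C, hφ, antipode₀_algebraMap, ← scalar_C,
      scalar_commute]
  | hadd a b ha hb => simp only [map_add, add_mul, mul_add, ha, hb]
  | hmul a b ha hb =>
    simp only [map_mul, antipode_mul, antipode₀_mul]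
    rw [mul_assoc, ha, ← mul_assoc, hb, mul_assoc]
  | hι m x hx =>
    have he : ι K (f T.h) * ι K (f T.e) = ι K (f T.e) * ι K (f T.h) + ι K (f T.e) := by
      have := congrArg φ T.hU_mul_eU
      simpa only [map_add, map_mul, hU, eU, hf] using this
    have key := fallingSeries_mul_C (K := K) (h := ι K (f T.h)) (e := ι K (f T.e))
      (d := fun l => φ (T.dU x l)) (m := m) he (fun l => by
          have := congrArg φ (T.eU_mul_dU x l)
          rwa [map_sub, map_mul, map_mul, eU, hf, map_mul, map_add, map_natCast, map_one] at this)
        (fun l => by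
          have := congrArg φ (hU_mul_dU hx l)
          rwa [map_add, map_mul, map_mul, map_mul, hU, hf, map_intCast] at this)
    rw [antipode_C_ι, antipodeL_of_weight hx, hf, antipode₀_ι, hw, twistElement_twist, map_neg,
      map_neg, mul_neg, neg_mul, map_mul, map_oneSubPow, eU, hf, antiSeries, map_series]
    simp only [map_mul, PowerSeries.map_C, map_rising, hU, hf]
    rw [dU_zero, hf] at key
    rw [key, antiSeries]
    simp only [map_rising]

end

end JordanianData

/-! ### Divided powers of ad e on the Witt algebra. -/

namespace Witt

variable {R : Type*} [CommRing R] {n : ℕ}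

theorem ext_comp {f g : Witt R n} (h : ∀ α, comp α f = comp α g) : f = g := Finsupp.ext h

theorem lie_mono_zero (b : Fin n → R) (f : Witt R n) (α : Fin n → ℤ) :
    comp α ⁅mono 0 b, f⁆ = pair b α • comp α f := by
  induction f using Witt.induction with
  | h0 => simp
  | hadd f g hf hg => rw [lie_add, map_add, map_add, hf, hg, smul_add]
  | hs β a =>
    have : pair a 0 = 0 := by simp [pair]
    rw [lie_mono, comp_mono, comp_mono, zero_add, this, zero_smul, sub_zero]
    split_ifs with h
    · rw [h]
    · rw [smul_zero]

theorem pair_del (i : Fin n) (β : Fin n → ℤ) : pair (del R i) β = β i := by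
  simp [pair, del, Pi.single_apply]

theorem pair_del_sub (i j : Fin n) (c : R) (β : Fin n → ℤ) :
    pair (del R i - c • del R j) β = β i - c * β j := by
  have := pair_sub_smul (del R i) (del R j) 1 c β
  rwa [one_smul, one_mul, pair_del, pair_del] at this

/-- The part of `f` of weight `m` with respect to a grading of the exponents. -/
noncomputable def gradedPart (wt : (Fin n → ℤ) → ℤ) (m : ℤ) : Witt R n →ₗ[R] Witt R n :=
  (Finsupp.supported (Fin n → R) R {α | wt α = m}).subtype ∘ₗ
    Finsupp.restrictDom (Fin n → R) R {α | wt α = m}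

theorem comp_gradedPart (wt : (Fin n → ℤ) → ℤ) (m : ℤ) (f : Witt R n) (α : Fin n → ℤ) :
    comp α (gradedPart wt m f) = if wt α = m then comp α f else 0 := by
  exact Finsupp.filter_apply (M := Fin n → R) (· ∈ {α | wt α = m}) f α

/-- `(1 / (l - 1)!) c (c + 1) ⋯ (c + l - 2)`, which is `0` for `l = 0`. -/
def predMultichoose (c : ℤ) : ℕ → ℤ
  | 0 => 0
  | l + 1 => Ring.multichoose c l

theorem factorial_mul_multichoose (c : ℤ) (l : ℕ) :
    (l.factorial : ℤ) * Ring.multichoose c l = ∏ j ∈ Finset.range l, (c + j) := by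
  have h := Ring.factorial_nsmul_multichoose_eq_ascPochhammer c l
  rw [Polynomial.ascPochhammer_smeval_eq_eval, nsmul_eq_mul] at h
  rw [h]
  clear h
  induction l with
  | zero => simp
  | succ l ih => rw [ascPochhammer_succ_eval, ih, Finset.prod_range_succ]

theorem succ_mul_multichoose (c : ℤ) (l : ℕ) :
    ((l : ℤ) + 1) * Ring.multichoose c (l + 1) = (c + l) * Ring.multichoose c l := by
  have h1 := factorial_mul_multichoose c (l + 1)
  rw [Finset.prod_range_succ, ← factorial_mul_multichoose, Nat.factorial_succ] at h1
  have h2 : (l.factorial : ℤ) ≠ 0 := Nat.cast_ne_zero.2 (Nat.factorial_ne_zero l)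
  refine mul_left_cancel₀ h2 ?_
  push_cast at h1
  linear_combination h1

theorem mul_multichoose_eq (c : ℤ) (l : ℕ) :
    (l : ℤ) * Ring.multichoose c l = (c + l - 1) * predMultichoose c l := by
  cases l with
  | zero => simp [predMultichoose]
  | succ l =>
    have := succ_mul_multichoose c l
    push_cast
    rw [this, predMultichoose]
    ring

variable (R) in
/-- `(1 / l!) (ad x^{ε_k} (∂_k - 2 ∂_{k'}))^l`. -/
noncomputable def dividedAd (k k' : Fin n) (l : ℕ) : Witt R n →ₗ[R] Witt R n :=
  Finsupp.lsum (M := Fin n → R) R fun α => mono (α + l • eps k) ∘ₗ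
    LinearMap.mk (AddHom.mk (fun a => ((Ring.multichoose (α k - 2 * α k') l : ℤ) : R) • a -
      (pair a (eps k) * (predMultichoose (α k - 2 * α k') l : R)) •
        (del R k - (2 : R) • del R k'))
      (fun a b => by
        have : pair (a + b) (eps k) = pair a (eps k) + pair b (eps k) := by
          simp [pair, add_mul, Finset.sum_add_distrib]
        rw [this]; module))
      (fun c a => by
        have : pair (c • a) (eps k) = c * pair a (eps k) := by
          simp [pair, mul_assoc, Finset.mul_sum]
        simp only [this, RingHom.id_apply]; module)

theorem dividedAd_mono (k k' : Fin n) (l : ℕ) (α : Fin n → ℤ) (a : Fin n → R) :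
    dividedAd R k k' l (mono α a) = mono (α + l • eps k)
      (((Ring.multichoose (α k - 2 * α k') l : ℤ) : R) • a -
      (pair a (eps k) * (predMultichoose (α k - 2 * α k') l : R)) •
        (del R k - (2 : R) • del R k')) := by
  unfold dividedAd mono
  erw [Finsupp.lsum_single]
  rfl

/-- Put d = ∂_k - 2 ∂_{k'} and c = α_k - 2 α_{k'}, so d(ε_k) = 1 and d(α + l ε_k) = c + l. The
bracket multiplies A_l by c + l and replaces B_l by (c + l - 1) B_l + ∂(ε_k) A_l; these are the
recursions `succ_mul_multichoose` and `mul_multichoose_eq`. -/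
theorem succ_smul_dividedAd {k k' : Fin n} (hk : k ≠ k') (l : ℕ) (f : Witt R n) :
    (l + 1) • dividedAd R k k' (l + 1) f =
      ⁅(mono (eps k) (del R k - (2 : R) • del R k') : Witt R n), dividedAd R k k' l f⁆ := by
  induction f using Witt.induction with
  | h0 => simp
  | hadd f g hf hg => rw [map_add, smul_add, hf, hg, map_add, lie_add]
  | hs α a =>
    rw [dividedAd_mono, dividedAd_mono, lie_mono]
    set c := α k - 2 * α k' with hc
    set d := del R k - (2 : R) • del R k' with hd
    have hd1 : pair d (eps k) = 1 := by
      rw [hd, pair_del_sub]; simp [eps, hk]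
    have hdα : pair d (α + l • eps k) = ((c + l : ℤ) : R) := by
      rw [hd, pair_del_sub]; simp [eps, hk, hc]; ring
    have h1 := congrArg (Int.cast : ℤ → R) (succ_mul_multichoose c l)
    have h2 := congrArg (Int.cast : ℤ → R) (mul_multichoose_eq c l)
    push_cast at h1 h2
    rw [pair_sub_smul, hd1, hdα, ← map_nsmul]
    rw [show eps k + (α + l • eps k) = α + (l + 1) • eps k by rw [add_smul, one_smul]; abel]
    rw [show predMultichoose c (l + 1) = Ring.multichoose c l from rfl]
    congr 1
    ext i
    simp only [Pi.smul_apply, Pi.sub_apply, smul_eq_mul, nsmul_eq_mul]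
    push_cast
    linear_combination (a i) * h1 - pair a (eps k) * d i * h2

theorem factorial_smul_dividedAd {k k' : Fin n} (hk : k ≠ k') (l : ℕ) (f : Witt R n) :
    l.factorial • dividedAd R k k' l f =
      (fun g => ⁅(mono (eps k) (del R k - (2 : R) • del R k') : Witt R n), g⁆)^[l] f := by
  induction l with
  | zero =>
    rw [Nat.factorial_zero, one_smul, Function.iterate_zero, id]
    induction f using Witt.induction with
    | h0 => simp
    | hadd f g hf hg => rw [map_add, hf, hg]
    | hs α a => rw [dividedAd_mono]; simp [predMultichoose]
  | succ l ih =>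
    rw [Function.iterate_succ', Function.comp_apply, ← ih, Nat.factorial_succ, mul_comm, mul_smul,
      succ_smul_dividedAd hk, lie_nsmul]

end Witt

/-! ### Weights and divided powers on S⁺. -/

namespace SPlus

variable {R : Type*} [CommRing R] {n : ℕ}

theorem mem_iff (f : Witt R n) : f ∈ SPlus R n ↔ ∀ α, Witt.Adm α (Witt.comp α f) := Witt.adm_iff f

theorem mono_comp_mem {f : Witt R n} (hf : f ∈ SPlus R n) (α : Fin n → ℤ) :
    Witt.mono α (Witt.comp α f) ∈ SPlus R n :=
  mono_mem R ((mem_iff f).1 hf α)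

theorem span_mono :
    Submodule.span R {x : SPlus R n | ∃ α a, (x : Witt R n) = Witt.mono α a} = ⊤ := by
  refine Submodule.eq_top_iff'.2 fun x => ?_
  have hx : x = ∑ α ∈ (Finsupp.support (M := Fin n → R) (x : Witt R n)),
      ⟨Witt.mono α (Witt.comp α x.1), mono_comp_mem x.2 α⟩ := by
    refine Subtype.ext ?_
    rw [AddSubmonoidClass.coe_finsetSum]
    exact (Finsupp.sum_single (M := Fin n → R) (x : Witt R n)).symm
  rw [hx]
  exact Submodule.sum_mem _ fun α _ => Submodule.subset_span ⟨α, _, rfl⟩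

theorem lie_h (k k' : Fin n) (x : SPlus R n) (α : Fin n → ℤ) :
    Witt.comp α (⁅h R k k', x⁆ : SPlus R n).1 = ((α k - α k' : ℤ) : R) • Witt.comp α x.1 := by
  have := Witt.lie_mono_zero (del R k - del R k') x.1 α
  have h1 := Witt.pair_del_sub (R := R) k k' 1 α
  rw [one_smul, one_mul] at h1
  rw [h1] at this
  push_cast
  exact this

theorem lie_h_mono (k k' : Fin n) {x : SPlus R n} {α : Fin n → ℤ} {a : Fin n → R}
    (hx : (x : Witt R n) = Witt.mono α a) : ⁅h R k k', x⁆ = (α k - α k') • x := by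
  refine Subtype.ext (Witt.ext_comp fun β => ?_)
  rw [lie_h, ← Int.cast_smul_eq_zsmul R]
  change _ = Witt.comp β (_ • x.1)
  rw [map_smul, hx, Witt.comp_mono]
  split_ifs with h
  · rw [h]
  · rw [smul_zero, smul_zero]

theorem lie_h_e {k k' : Fin n} (hk : k ≠ k') : ⁅h R k k', e R hk⁆ = e R hk := by
  rw [lie_h_mono k k' (x := e R hk) rfl]
  simp [eps, hk]

theorem gradedPart_mem (wt : (Fin n → ℤ) → ℤ) (m : ℤ) (x : SPlus R n) :
    Witt.gradedPart wt m x.1 ∈ SPlus R n := by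
  rw [mem_iff]
  intro α
  rw [Witt.comp_gradedPart]
  split_ifs
  · exact (mem_iff _).1 x.2 α
  · exact Witt.Adm.zero α

/-- The decomposition into homogeneous parts with respect to a grading of the exponents. -/
noncomputable def decomp (wt : (Fin n → ℤ) → ℤ) : SPlus R n →ₗ[R] (ℤ →₀ SPlus R n) where
  toFun x := Finsupp.onFinset ((Finsupp.support (M := Fin n → R) (x : Witt R n)).image wt)
    (fun m => ⟨Witt.gradedPart wt m x.1, gradedPart_mem wt m x⟩) fun m hm => by
      by_contra h
      refine hm (Subtype.ext (Witt.ext_comp fun α => ?_))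
      change Witt.comp α (Witt.gradedPart wt m x.1) = 0
      rw [Witt.comp_gradedPart]
      split_ifs with hα
      · by_contra hne
        exact h (Finset.mem_image.2 ⟨α, Finsupp.mem_support_iff.2 hne, hα⟩)
      · rfl
  map_add' x y := Finsupp.ext fun m => Subtype.ext (map_add (Witt.gradedPart wt m) x.1 y.1)
  map_smul' c x := Finsupp.ext fun m => Subtype.ext (map_smul (Witt.gradedPart wt m) c x.1)

theorem iterate_ad {k k' : Fin n} (hk : k ≠ k') (l : ℕ) (x : SPlus R n) :
    (((LieDerivation.ad R (SPlus R n) (e R hk))^[l] x : SPlus R n) : Witt R n) =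
      l.factorial • Witt.dividedAd R k k' l x.1 := by
  rw [Witt.factorial_smul_dividedAd hk]
  induction l with
  | zero => rfl
  | succ l ih => rw [Function.iterate_succ', Function.iterate_succ', Function.comp_apply,
      Function.comp_apply, ← ih, LieDerivation.ad_apply_apply]; rfl

variable [IsDomain R] [CharZero R]

/-- Neither the support condition nor the vanishing of the divergence is affected by a nonzero
integer factor. So S⁺ is saturated in W, and the divided powers of ad e inherit stability of S⁺ from
ad e. -/
theorem mem_of_nsmul_mem {m : ℕ} (hm : m ≠ 0) {f : Witt R n} (hf : m • f ∈ SPlus R n) :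
    f ∈ SPlus R n := by
  have hm' : (m : R) ≠ 0 := Nat.cast_ne_zero.2 hm
  rw [mem_iff] at hf ⊢
  intro α
  have h := hf α
  rw [map_nsmul, ← Nat.cast_smul_eq_nsmul R] at h
  refine ⟨fun i hi => h.1 i ?_, ?_⟩
  · rw [Pi.smul_apply, smul_eq_mul]; exact mul_ne_zero hm' hi
  · have := h.2
    simp only [Pi.smul_apply, smul_eq_mul, mul_assoc, ← Finset.mul_sum] at this
    exact (mul_eq_zero.1 this).resolve_left hm'

theorem eq_zero_of_nsmul {m : ℕ} {x : SPlus R n} (hm : m ≠ 0) (hx : m • x = 0) : x = 0 := by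
  have hm' : (m : R) ≠ 0 := Nat.cast_ne_zero.2 hm
  refine Subtype.ext (Witt.ext_comp fun α => funext fun i => ?_)
  have := congrFun (congrArg (Witt.comp α) (congrArg Subtype.val hx)) i
  rw [← Nat.cast_smul_eq_nsmul R] at this
  change (m : R) * Witt.comp α x.1 i = 0 at this
  exact (mul_eq_zero.1 this).resolve_left hm'

theorem dividedAd_mem {k k' : Fin n} (hk : k ≠ k') (l : ℕ) (x : SPlus R n) :
    Witt.dividedAd R k k' l x.1 ∈ SPlus R n :=
  mem_of_nsmul_mem (Nat.factorial_ne_zero l) (iterate_ad hk l x ▸ SetLike.coe_mem _)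

/-- The Jordanian data attached to `h = ∂_k - ∂_{k'}` and `e = x^{ε_k} (∂_k - 2 ∂_{k'})`. -/
noncomputable def jordanianData {k k' : Fin n} (hk : k ≠ k') : JordanianData R (SPlus R n) where
  h := h R k k'
  e := e R hk
  D l := LinearMap.restrict (Witt.dividedAd R k k' l) fun x hx => dividedAd_mem hk l ⟨x, hx⟩
  decomp := decomp fun α => α k - α k'
  lie_h_e := lie_h_e hk
  torsionFree m x hm hx := eq_zero_of_nsmul hm hx
  factorial_smul_D l x := Subtype.ext (iterate_ad hk l x).symm
  decomp_of_weight m x hx := by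
    refine Finsupp.ext fun m' => Subtype.ext (Witt.ext_comp fun α => ?_)
    change Witt.comp α (Witt.gradedPart _ m' x.1) = _
    have hα := lie_h k k' x α
    rw [hx, ← Int.cast_smul_eq_zsmul R] at hα
    change (m : R) • Witt.comp α x.1 = _ at hα
    -- The coefficient of x^α is killed by m - (α_k - α_{k'}), so it vanishes unless α has weight m.
    rw [← sub_eq_zero, ← sub_smul, smul_eq_zero, ← Int.cast_sub, Int.cast_eq_zero,
      sub_eq_zero] at hα
    rw [Witt.comp_gradedPart, Finsupp.single_apply]
    rcases hα with hα | hα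
    · rw [← hα]; split_ifs <;> rfl
    · rw [hα, ite_self]; split_ifs
      · exact hα.symm
      · rfl
  span_weights := by
    rw [eq_top_iff, ← span_mono, Submodule.span_le]
    rintro x ⟨α, a, hx⟩
    exact Submodule.subset_span ⟨_, lie_h_mono k k' hx⟩

end SPlus

/-! ### The quantization of U(S⁺), its explicit formulas and its uniqueness. -/

namespace SPlus

section

attribute [local instance 100] LieRing.ofAssociativeRing
attribute [local instance 2000] Algebra.toModule

variable (R K : Type*) [CommRing R] [Field K] [Algebra R K] {n : ℕ}

theorem map_h (k k' : Fin n) : map R K (h R k k') = h K k k' := by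
  refine Subtype.ext ((Witt.map_mono R K _ _).trans ?_)
  change _ = Witt.mono 0 _
  congr 1
  ext i
  simp only [del, Pi.sub_apply, Pi.single_apply]
  split_ifs <;> simp

theorem map_e {k k' : Fin n} (hk : k ≠ k') : map R K (e R hk) = e K hk := by
  refine Subtype.ext ((Witt.map_mono R K _ _).trans ?_)
  change _ = Witt.mono (eps k) _
  congr 1
  ext i
  simp only [del, Pi.sub_apply, Pi.smul_apply, Pi.single_apply]
  split_ifs <;> simp [map_ofNat]

theorem basicTwist_eq {k k' : Fin n} (hk : k ≠ k') :
    basicTwist K hk = JordanianTwist.twist K (h K k k') (e K hk) := rfl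

variable [IsDomain R] [CharZero R] [CharZero K]

/-- The quantization of `U(S⁺_R)` attached to `k ≠ k'`. -/
noncomputable def quantum {k k' : Fin n} (hk : k ≠ k') : UHopf R n := (jordanianData hk).hopf

theorem isQuantization {k k' : Fin n} (hk : k ≠ k') : IsQuantization R K hk (quantum R hk) where
  isUnit_twistElement := JordanianTwist.isUnit_twistElement K
  comul_eq x := by
    have key := (jordanianData (R := R) hk).comul_mul_twist (baseChange_algebraMap R K n)
      (baseChange_ι R K) x
    change _ * JordanianTwist.twist K (map R K (h R k k')) (map R K (e R hk)) =
      JordanianTwist.twist K (map R K (h R k k')) (map R K (e R hk)) * _ at key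
    rw [map_h, map_e, ← basicTwist_eq] at key
    rw [← key, mul_assoc, Ring.mul_inverse_cancel (basicTwist K hk) (JordanianTwist.isUnit_twist K _ _), mul_one]
    rfl
  antipode_eq x := by
    have key := (jordanianData (R := R) hk).antipode_mul_twistElement
      (baseChange_algebraMap R K n) (baseChange_ι R K) x
    change _ * twistElement K (JordanianTwist.twist K (map R K (h R k k')) (map R K (e R hk))) =
      twistElement K (JordanianTwist.twist K (map R K (h R k k')) (map R K (e R hk))) * _ at key
    rw [map_h, map_e, ← basicTwist_eq] at key
    rw [← key, mul_assoc,
      Ring.mul_inverse_cancel (twistElement K (basicTwist K hk)) (JordanianTwist.isUnit_twistElement K), mul_one]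
    rfl
  counit_eq x := rfl
  comul_mod x := (jordanianData (R := R) hk).constantCoeff_comul x
  antipode_mod x := (jordanianData (R := R) hk).constantCoeff_antipode x
  twist_mod := JordanianTwist.constantCoeff_twist K _ _
  twist_classical := JordanianTwist.twist_classical K
  comul_classical a := (jordanianData (R := R) hk).comul_classical a

end

theorem hasFormulas {n : ℕ} {k k' : Fin n} (hk : k ≠ k') : HasFormulas hk (quantum ℤ hk) := by
  intro α a x hx
  set T := jordanianData (R := ℤ) hk with hT
  have hw : ⁅T.h, x⁆ = (α k - α k') • x := lie_h_mono k k' hx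
  -- Integrality of A_l is built in by taking the multiset coefficient; y_l is the divided power D_l
  -- x.
  refine ⟨fun l => Ring.multichoose (α k - 2 * α k') l,
    fun l => Witt.pair a (eps k) * Witt.predMultichoose (α k - 2 * α k') l, fun l => T.D l x,
    fun l => ?_, by simp [Witt.predMultichoose], fun l => rfl, fun l => ?_, ?_, ?_, ?_⟩
  · have := congrArg (Int.cast : ℤ → ℚ) (Witt.factorial_mul_multichoose (α k - 2 * α k') l)
    have hl : (l.factorial : ℚ) ≠ 0 := Nat.cast_ne_zero.2 (Nat.factorial_ne_zero l)
    push_cast at this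
    rw [← this]
    field_simp
  · change Witt.dividedAd ℤ k k' l x.1 = _
    rw [hx, Witt.dividedAd_mono]
    congr 1
  · exact (T.comul_C_ι x).trans (T.comulL_eq hw)
  · exact (T.antipode_C_ι x).trans (JordanianData.antipodeL_of_weight hw)
  · exact JordanianData.counit_C_ι x

/-- The constraints on A, B and y leave no choice, so Δ and ε agree on monomials, hence everywhere
by multiplicativity and R⟦t⟧-linearity. The antipodes then agree by `antipode_unique`. -/
theorem eq_of_hasFormulas {n : ℕ} {k k' : Fin n} {hk : k ≠ k'} {Q Q' : UHopf ℤ n}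
    (hQ : HasFormulas hk Q) (hQ' : HasFormulas hk Q') : Q = Q' := by
  have key : ∀ x ∈ {x : SPlus ℤ n | ∃ α a, (x : Witt ℤ n) = Witt.mono α a},
      Q.comul (inc ℤ x) = Q'.comul (inc ℤ x) ∧ Q.counit (inc ℤ x) = Q'.counit (inc ℤ x) := by
    rintro x ⟨α, a, hx⟩
    obtain ⟨A, B, y, hA, hB0, hB, hy, h1, -, h2⟩ := hQ α a x hx
    obtain ⟨A', B', y', hA', hB0', hB', hy', h1', -, h2'⟩ := hQ' α a x hx
    have eA : A = A' := funext fun l => Int.cast_injective ((hA l).trans (hA' l).symm)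
    have eB : B = B' := funext fun l => by
      cases l with
      | zero => rw [hB0, hB0']
      | succ l => rw [hB, hB', eA]
    have ey : y = y' := funext fun l => Subtype.ext (by rw [hy, hy', eA, eB])
    exact ⟨by rw [h1, h1', ey], by rw [h2, h2']⟩
  have hΔ : Q.comul = Q'.comul := AlgHom.ext fun z => JordanianData.algHom_congr_of_span
    Q.comul_linear Q'.comul_linear span_mono (fun x hx => (key x hx).1) z
  have hε : Q.counit = Q'.counit := AlgHom.ext fun z => JordanianData.algHom_congr_of_span
    Q.counit_linear Q'.counit_linear span_mono (fun x hx => (key x hx).2) z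
  exact HopfStructure.ext hΔ hε (HopfStructure.antipode_unique hΔ hε)

end SPlus

/-! ### Separating the twists by the action on functions on ℤⁿ. -/

namespace Witt

variable {R : Type*} [CommRing R] {n : ℕ}

theorem add_pair (a b : Fin n → R) (β : Fin n → ℤ) : pair (a + b) β = pair a β + pair b β := by
  simp [pair, add_mul, Finset.sum_add_distrib]

theorem smul_pair (c : R) (a : Fin n → R) (β : Fin n → ℤ) : pair (c • a) β = c * pair a β := by
  simp [pair, mul_assoc, Finset.mul_sum]

variable (R n) in
/-- The action `x^α ∂ : x^β ↦ ∂(β) x^{α + β}` on formal Laurent series. -/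
noncomputable def act : Witt R n →ₗ[R] Module.End R ((Fin n → ℤ) → R) :=
  Finsupp.lsum (M := Fin n → R) R fun α => LinearMap.mk₂ R
    (fun a p γ => pair a (γ - α) * p (γ - α))
    (fun a b p => by ext γ; simp [add_pair, add_mul])
    (fun c a p => by ext γ; simp [smul_pair, mul_assoc])
    (fun a p q => by ext γ; simp [mul_add])
    (fun c a p => by ext γ; simp [mul_left_comm])

theorem act_mono (α : Fin n → ℤ) (a : Fin n → R) (p : (Fin n → ℤ) → R) (γ : Fin n → ℤ) :
    act R n (mono α a) p γ = pair a (γ - α) * p (γ - α) := by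
  unfold act mono
  erw [Finsupp.lsum_single]
  rfl

theorem act_lie (f g : Witt R n) : act R n ⁅f, g⁆ = act R n f * act R n g - act R n g * act R n f := by
  induction f using Witt.induction with
  | h0 => rw [zero_lie, map_zero, zero_mul, mul_zero, sub_zero]
  | hadd f f' h h' => rw [add_lie, map_add, map_add, h, h', add_mul, mul_add]; abel
  | hs α a =>
  induction g using Witt.induction with
  | h0 => rw [lie_zero, map_zero, zero_mul, mul_zero, sub_zero]
  | hadd f f' h h' => rw [lie_add, map_add, map_add, h, h', add_mul, mul_add]; abel
  | hs β b =>
    refine LinearMap.ext fun p => funext fun γ => ?_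
    rw [lie_mono, LinearMap.sub_apply, Module.End.mul_apply, Module.End.mul_apply, Pi.sub_apply,
      act_mono, act_mono, act_mono, act_mono, act_mono, pair_sub_smul,
      show γ - β - α = γ - (α + β) by abel, show γ - α - β = γ - (α + β) by abel,
      show γ - α = (γ - (α + β)) + β by abel, show γ - β = (γ - (α + β)) + α by abel,
      pair_add, pair_add]
    ring

end Witt

namespace SPlus

section

attribute [local instance 100] LieRing.ofAssociativeRing
attribute [local instance 2000] Algebra.toModule

open UniversalEnvelopingAlgebra (ι)

variable (R : Type*) [CommRing R] {n : ℕ}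

/-- The algebra map on an enveloping algebra induced by a linear map that respects the bracket. -/
noncomputable def liftLinear {L A : Type*} [LieRing L] [LieAlgebra R L] [Ring A] [Algebra R A]
    (f : L →ₗ[R] A) (hf : ∀ x y, f ⁅x, y⁆ = f x * f y - f y * f x) :
    UniversalEnvelopingAlgebra R L →ₐ[R] A :=
  UniversalEnvelopingAlgebra.lift R
    { f with
      map_lie' := fun {x y} => by rw [LieRing.of_associative_ring_bracket]; exact hf x y }

theorem liftLinear_ι {L A : Type*} [LieRing L] [LieAlgebra R L] [Ring A] [Algebra R A]
    (f : L →ₗ[R] A) (hf : ∀ x y, f ⁅x, y⁆ = f x * f y - f y * f x) (x : L) :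
    liftLinear R f hf (ι R x) = f x :=
  UniversalEnvelopingAlgebra.lift_ι_apply R _ x

/-- The action of the enveloping algebra on formal Laurent series. -/
noncomputable def actU : U R n →ₐ[R] Module.End R ((Fin n → ℤ) → R) :=
  liftLinear R (Witt.act R n ∘ₗ (SPlus R n).toSubmodule.subtype) fun x y => Witt.act_lie x.1 y.1

theorem actU_ι (x : SPlus R n) : actU R (ι R x) = Witt.act R n x.1 :=
  liftLinear_ι R _ _ x

/-- The coefficient of `x^{α + β}` in `a · x^β`. -/
noncomputable def matrixCoeff (α β : Fin n → ℤ) : U R n →ₗ[R] R :=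
  LinearMap.proj (α + β) ∘ₗ LinearMap.applyₗ (Pi.single β (1 : R)) ∘ₗ (actU R).toLinearMap

theorem matrixCoeff_ι (α β γ : Fin n → ℤ) {x : SPlus R n} {a : Fin n → R}
    (hx : (x : Witt R n) = Witt.mono γ a) :
    matrixCoeff R α β (ι R x) = if γ = α then Witt.pair a β else 0 := by
  change actU R (ι R x) (Pi.single β (1 : R)) (α + β) = _
  rw [actU_ι, hx, Witt.act_mono, Pi.single_apply]
  split_ifs with h1 h2 h2
  · rw [h1, mul_one]
  · exact absurd (by rw [sub_eq_iff_eq_add, add_comm, add_right_inj] at h1; exact h1.symm) h2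
  · exact absurd (by rw [h2, add_sub_cancel_left]) h1
  · rw [mul_zero]

theorem matrixCoeff_hU (β : Fin n → ℤ) (k k' : Fin n) :
    matrixCoeff R 0 β (hU R k k') = (β k - β k' : ℤ) := by
  rw [hU, matrixCoeff_ι R 0 β 0 rfl, if_pos rfl]
  have := Witt.pair_del_sub (R := R) k k' 1 β
  rw [one_smul, one_mul] at this
  rw [this]
  push_cast
  rfl

theorem matrixCoeff_eU (α β : Fin n → ℤ) {k k' : Fin n} (hk : k ≠ k') :
    matrixCoeff R α β (eU R hk) = if eps k = α then ((β k - 2 * β k' : ℤ) : R) else 0 := by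
  rw [eU, matrixCoeff_ι R α β (eps k) rfl, Witt.pair_del_sub]
  push_cast
  rfl

/-- The first leg is tested on x^β and the second on x^{ε_k}, where e has matrix coefficient 1. Then
β = ε_k forces k = l and β = ε_{k'} forces k' = l'. Allowing a scalar c is what makes the lemma
applicable to coproducts. -/
theorem eq_of_hU_tmul_eU [Nontrivial R] {k k' l l' : Fin n} {hk : k ≠ k'} {hl : l ≠ l'} {c : R}
    (H : hU R k k' ⊗ₜ[R] eU R hk = c • (hU R l l' ⊗ₜ[R] eU R hl)) : k = l ∧ k' = l' := by
  have key : ∀ β : Fin n → ℤ, ((β k - β k' : ℤ) : R) =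
      c * (((β l - β l' : ℤ) : R) *
        if eps l = eps k then ((eps k l - 2 * eps k l' : ℤ) : R) else 0) := fun β => by
    have := congrArg (LinearMap.mul' R R ∘ₗ
      TensorProduct.map (matrixCoeff R 0 β) (matrixCoeff R (eps k) (eps k))) H
    rw [map_smul, LinearMap.comp_apply, LinearMap.comp_apply, TensorProduct.map_tmul,
      TensorProduct.map_tmul, LinearMap.mul'_apply, LinearMap.mul'_apply, matrixCoeff_hU,
      matrixCoeff_hU, matrixCoeff_eU, matrixCoeff_eU, if_pos rfl] at this
    simpa [eps, hk] using this
  have hkl : k = l := by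
    by_contra hne
    have h1 := key (eps k)
    have h2 : eps l ≠ eps k := fun h => by
      have := congrFun h k
      simp [eps, hne] at this
    rw [if_neg h2] at h1
    simp [eps, hk] at h1
  subst hkl
  refine ⟨rfl, ?_⟩
  by_contra hne
  have h1 := key (eps k')
  simp [eps, hk, hne] at h1

theorem basicTwist_injective {K : Type*} [Field K] {k k' l l' : Fin n} {hk : k ≠ k'} {hl : l ≠ l'}
    (H : basicTwist K hk = basicTwist K hl) : k = l ∧ k' = l' := by
  have := congrArg (coeff 1) H
  rw [basicTwist_eq, basicTwist_eq, JordanianTwist.coeff_one_twist, JordanianTwist.coeff_one_twist,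
    neg_inj] at this
  exact eq_of_hU_tmul_eU K (hk := hk) (hl := hl) (c := 1) (by rw [one_smul]; exact this)

/-- The coproducts are compared at the single element h = h(k, k'). The coefficient of t in Δ(h) is
h ⊗ e for the pair (k, k'), and for (l, l') it is an integer multiple of the corresponding tensor.
-/
theorem quantum_injective [IsDomain R] [CharZero R] {k k' l l' : Fin n} {hk : k ≠ k'} {hl : l ≠ l'}
    (H : quantum R hk = quantum R hl) : k = l ∧ k' = l' := by
  have := congrArg (fun Q : UHopf R n => coeff 1 (Q.comul (C (ι R (h R k k'))))) H
  change coeff 1 ((jordanianData hk).comul _) = coeff 1 ((jordanianData hl).comul _) at this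
  have hw : ∀ l l' : Fin n, ⁅h R l l', h R k k'⁆ = (0 : ℤ) • h R k k' := fun l l' => by
    rw [lie_h_mono l l' (x := h R k k') (α := 0) rfl]; rfl
  rw [JordanianData.comul_C_ι, JordanianData.comul_C_ι,
    JordanianData.coeff_one_comulL (T := jordanianData hk) (hw k k'),
    JordanianData.coeff_one_comulL (T := jordanianData hl) (hw l l')] at this
  have h2 : ∀ (l l' : Fin n) (hl : l ≠ l'), ⁅e R hl, h R k k'⁆ =
      (-(eps l k - eps l k' : ℤ) : R) • e R hl := fun l l' hl => by
    rw [← lie_skew, lie_h_mono k k' (x := e R hl) rfl, ← Int.cast_smul_eq_zsmul R, neg_smul]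
  change - (ι R ⁅h R k k', h R k k'⁆ ⊗ₜ[R] eU R hk) - hU R k k' ⊗ₜ[R] ι R ⁅e R hk, h R k k'⁆ =
    - (ι R ⁅h R l l', h R k k'⁆ ⊗ₜ[R] eU R hl) - hU R l l' ⊗ₜ[R] ι R ⁅e R hl, h R k k'⁆ at this
  rw [hw, hw, h2, h2, zero_smul, map_zero, TensorProduct.zero_tmul, TensorProduct.zero_tmul, neg_zero, zero_sub,
    zero_sub, map_smul, map_smul, TensorProduct.tmul_smul, TensorProduct.tmul_smul, neg_smul,
    neg_smul, neg_neg, neg_neg] at this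
  exact eq_of_hU_tmul_eU R (hk := hk) (hl := hl) (c := ((eps l k - eps l k' : ℤ) : R)) (by
    have h3 : ((eps k k - eps k k' : ℤ) : R) = 1 := by simp [eps, hk]
    rw [h3, one_smul] at this
    exact this)

end

/-! ### Counting, and the theorem. -/

theorem ncard_of_injective {n : ℕ} {X : Type*} (F : ∀ k k' : Fin n, k ≠ k' → X)
    (hF : ∀ (k k' l l' : Fin n) (hk : k ≠ k') (hl : l ≠ l'), F k k' hk = F l l' hl → k = l ∧ k' = l') :
    {x : X | ∃ (k k' : Fin n) (hk : k ≠ k'), x = F k k' hk}.ncard = n * (n - 1) := by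
  have h1 : {x : X | ∃ (k k' : Fin n) (hk : k ≠ k'), x = F k k' hk} =
      Set.range fun p : {p : Fin n × Fin n // p ∈ (Finset.univ : Finset (Fin n)).offDiag} =>
        F p.1.1 p.1.2 (Finset.mem_offDiag.1 p.2).2.2 := by
    ext x
    constructor
    · rintro ⟨k, k', hk, rfl⟩
      exact ⟨⟨(k, k'), Finset.mem_offDiag.2 ⟨Finset.mem_univ _, Finset.mem_univ _, hk⟩⟩, rfl⟩
    · rintro ⟨p, rfl⟩
      exact ⟨_, _, _, rfl⟩
  rw [h1, ← Set.image_univ, Set.ncard_image_of_injective, Set.ncard_univ, Nat.card_eq_fintype_card,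
    Fintype.card_coe, Finset.offDiag_card, Finset.card_univ, Fintype.card_fin, Nat.mul_sub_one]
  intro p q hpq
  obtain ⟨h2, h3⟩ := hF _ _ _ _ _ _ hpq
  exact Subtype.ext (Prod.ext h2 h3)

end SPlus

theorem corollary2p7 (K : Type*) [Field K] [CharZero K] (n : ℕ) :
    (∀ (k k' : Fin n) (hk : k ≠ k'),
      IsDrinfeldTwist K (basicTwist K hk) ∧
      ∃! Q : UHopf ℤ n, IsQuantization ℤ K hk Q ∧ HasFormulas hk Q) ∧
    {F : (U K n ⊗[K] U K n)⟦X⟧ | ∃ (k k' : Fin n) (hk : k ≠ k'), F = basicTwist K hk}.ncard =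
      n * (n - 1) ∧
    {Q : UHopf ℤ n | ∃ (k k' : Fin n) (hk : k ≠ k'),
      IsQuantization ℤ K hk Q ∧ HasFormulas hk Q}.ncard = n * (n - 1) := by
  refine ⟨fun k k' hk => ⟨JordanianTwist.isDrinfeldTwist K (lie_h_e hk), quantum ℤ hk,
    ⟨isQuantization ℤ K hk, hasFormulas hk⟩, fun Q hQ => eq_of_hasFormulas hQ.2 (hasFormulas hk)⟩,
    ncard_of_injective (fun k k' hk => basicTwist K hk)
      fun k k' l l' hk hl H => basicTwist_injective H, ?_⟩
  -- By uniqueness, the Hopf structures being counted are exactly the structures `quantum ℤ hk`,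
  -- which are pairwise distinct.
  rw [← ncard_of_injective (n := n) (fun k k' hk => quantum ℤ hk)
    fun k k' l l' hk hl H => quantum_injective ℤ H]
  congr 1
  ext Q
  refine exists_congr fun k => exists_congr fun k' => exists_congr fun hk => ⟨fun hQ =>
    eq_of_hasFormulas hQ.2 (hasFormulas hk), ?_⟩
  rintro rfl
  exact ⟨isQuantization ℤ K hk, hasFormulas hk⟩
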